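/- **Setting.** Let $\Omega\subset\mathbb R^3$ be an open Lipschitz polyhedron and $\mathcal T_h$ a conforming mesh of $\overline\Omega$ by finitely many closed nondegenerate tetrahedra (two different tetrahedra meet in the empty set or in a common vertex, edge or face), with vertex set $\mathcal V_h$. Let $\Gamma_D,\Gamma_N$ be disjoint, relatively open, possibly empty subsets of $\partial\Omega$ with $\partial\Omega=\overline{\Gamma_D}\cup\overline{\Gamma_N}$ such that each boundary face of the mesh lies entirely in $\overline{\Gamma_D}$ or in $\overline{\Gamma_N}$. Write $(\cdot,\cdot)_\omega$ for the $L^2(\omega)$ scalar product and $(\cdot,\cdot)=(\cdot,\cdot)_\Omega$. Let $H^1_D(\Omega)$ be the space of $v\in H^1(\Omega)$ with zero trace on $\Gamma_D$. Let $H_D(\mathrm{curl})$ be the space of $v\in H(\mathrm{curl},\Omega)$ with $v\times n=0$ on $\Gamma_D$, i.e. $(\nabla\times v,\varphi)-(v,\nabla\times\varphi)=0$ for all $\varphi\in[H^1(\Omega)]^3$ with $\varphi\times n=0$ on $\partial\Omega\setminus\Gamma_D$. Let $H_N(\mathrm{div})$ be the space of $v\in H(\mathrm{div},\Omega)$ with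 $v\cdot n=0$ on $\Gamma_N$, i.e. $(v,\nabla\varphi)+(\nabla\cdot v,\varphi)=0$ for all $\varphi\in H^1_D(\Omega)$. Let $\mathcal H$ be the cohomology space of all $v\in H_D(\mathrm{curl})\cap H_N(\mathrm{div})$ with $\nabla\times v=0$ and $\nabla\cdot v=0$. For $q\ge0$, $\mathcal N_q(\mathcal T_h)$ denotes the vector fields in $[L^2(\Omega)]^3$ whose restriction to each $K\in\mathcal T_h$ belongs to $[\mathcal P_q(K)]^3+x\times[\mathcal P_q(K)]^3$, where $\mathcal P_q(K)$ are the polynomials of total degree at most $q$. For $a\in\mathcal V_h$, let $\psi_a$ be the continuous piecewise affine hat function with value $1$ at $a$ and $0$ at all other vertices, let $\mathcal T_a$ be the set of tetrahedra sharing $a$, let $\omega_a$ be the open subdomain covered by $\mathcal T_a$, and let $\mathcal P_1(\mathcal T_a)$ be the functions in $L^2(\omega_a)$ whose restriction to each $K\in\mathcal T_a$ is in $\mathcal P_1(K)$. If $a\notin\overline{\Gamma_D}$, set $H^1_*(\omega_a)=\{v\in H^1(\omega_a):(v,1)_{\omega_a}=0\}$; if $a\in\overline{\Gamma_D}$, set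 $H^1_*(\omega_a)=\{v\in H^1(\omega_a): v=0\text{ on }\gamma_D\}$ in the sense of traces, where $\gamma_D$ is the part of $\Gamma_D$ covered by the boundary faces that share $a$ and lie in $\overline{\Gamma_D}$. **Theorem (Patchwise orthogonality).** Let $p\ge0$ be an integer and let $j\in H_N(\mathrm{div})$ satisfy $\nabla\cdot j=0$ and $(j,\varphi)=0$ for all $\varphi\in\mathcal H$. Then a vector field $A_h$ satisfies $$A_h\in\mathcal N_p(\mathcal T_h)\cap H_D(\mathrm{curl})\quad\text{and}\quad(\nabla\times A_h,\nabla\times v_h)=(j,v_h)\quad\forall v_h\in\mathcal N_0(\mathcal T_h)\cap H_D(\mathrm{curl})$$ if and only if $A_h\in\mathcal N_p(\mathcal T_h)\cap H_D(\mathrm{curl})$ and $$(\psi_a j,\nabla q_h)_{\omega_a}+(\nabla\psi_a\times(\nabla\times A_h),\nabla q_h)_{\omega_a}=0\quad\forall q_h\in\mathcal P_1(\mathcal T_a)\cap H^1_*(\omega_a),\ \forall a\in\mathcal V_h.$$ -/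

import Mathlib

open MeasureTheory Filter Topology
open scoped ContDiff Matrix

noncomputable section

namespace MaxwellPatch

/-! ### Vector calculus in three-dimensional Euclidean space -/

/-- Three-dimensional Euclidean space. -/
abbrev E3 : Type := EuclideanSpace ℝ (Fin 3)

/-- The vector product. -/
def cross (u v : E3) : E3 :=
  WithLp.toLp 2 ((WithLp.ofLp u) ⨯₃ (WithLp.ofLp v))

/-- The classical partial derivative in the `i`-th coordinate direction. -/
def pderiv (i : Fin 3) (f : E3 → ℝ) (x : E3) : ℝ :=
  fderiv ℝ f x (EuclideanSpace.single i 1)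

/-- The classical gradient. -/
def grad (f : E3 → ℝ) (x : E3) : E3 :=
  !₂[pderiv 0 f x, pderiv 1 f x, pderiv 2 f x]

/-- The classical curl. -/
def curl (f : E3 → E3) (x : E3) : E3 :=
  !₂[pderiv 1 (fun y => f y 2) x - pderiv 2 (fun y => f y 1) x,
     pderiv 2 (fun y => f y 0) x - pderiv 0 (fun y => f y 2) x,
     pderiv 0 (fun y => f y 1) x - pderiv 1 (fun y => f y 0) x]

/-! ### Sobolev spaces `H¹`, `H(curl)`, `H(div)` through weak derivatives -/

/-- Smooth functions with compact support contained in `Ω`. -/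
def IsTestFun {F : Type*} [NormedAddCommGroup F] [NormedSpace ℝ F] (Ω : Set E3) (f : E3 → F) :
    Prop :=
  ContDiff ℝ ∞ f ∧ HasCompactSupport f ∧ tsupport f ⊆ Ω

/-- `v ∈ L²(Ω)`; scalar- or vector-valued. -/
def MemL2 {F : Type*} [NormedAddCommGroup F] (Ω : Set E3) (v : E3 → F) : Prop :=
  MemLp v 2 (volume.restrict Ω)

/-- The `L²(Ω)` scalar product of vector fields. -/
def ip (Ω : Set E3) (v w : E3 → E3) : ℝ :=
  ∫ x in Ω, inner ℝ (v x) (w x)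

/-- `u, g` are in `L²(Ω)` and `g` is the weak gradient of `u` on `Ω`. -/
def HasWeakGrad (Ω : Set E3) (u : E3 → ℝ) (g : E3 → E3) : Prop :=
  MemL2 Ω u ∧ MemL2 Ω g ∧
    ∀ φ : E3 → ℝ, IsTestFun Ω φ → ∀ i : Fin 3,
      ∫ x in Ω, u x * pderiv i φ x = -∫ x in Ω, g x i * φ x

/-- `v, c` are in `L²(Ω)` and `c` is the weak curl of `v` on `Ω`. -/
def HasWeakCurl (Ω : Set E3) (v c : E3 → E3) : Prop :=
  MemL2 Ω v ∧ MemL2 Ω c ∧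
    ∀ φ : E3 → E3, IsTestFun Ω φ → ip Ω v (curl φ) = ip Ω c φ

/-- `v, d` are in `L²(Ω)` and `d` is the weak divergence of `v` on `Ω`. -/
def HasWeakDiv (Ω : Set E3) (v : E3 → E3) (d : E3 → ℝ) : Prop :=
  MemL2 Ω v ∧ MemL2 Ω d ∧
    ∀ φ : E3 → ℝ, IsTestFun Ω φ → ip Ω v (grad φ) = -∫ x in Ω, d x * φ x

/-- `H¹(Ω)`. -/
def MemH1 (Ω : Set E3) (u : E3 → ℝ) : Prop := ∃ g, HasWeakGrad Ω u g

/-- `H(curl, Ω)`. -/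
def MemHcurl (Ω : Set E3) (v : E3 → E3) : Prop := ∃ c, HasWeakCurl Ω v c

/-- `H(div, Ω)`. -/
def MemHdiv (Ω : Set E3) (v : E3 → E3) : Prop := ∃ d, HasWeakDiv Ω v d

open scoped Classical in
/-- The weak gradient on `Ω` of a function in `H¹(Ω)` (unique up to a null subset of `Ω`). -/
def weakGrad (Ω : Set E3) (u : E3 → ℝ) : E3 → E3 :=
  if h : MemH1 Ω u then h.choose else 0

open scoped Classical in
/-- The weak curl on `Ω` of a field in `H(curl, Ω)` (unique up to a null subset of `Ω`). -/
def weakCurl (Ω : Set E3) (v : E3 → E3) : E3 → E3 :=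
  if h : MemHcurl Ω v then h.choose else 0

open scoped Classical in
/-- The weak divergence on `Ω` of a field in `H(div, Ω)` (unique up to a null subset of `Ω`). -/
def weakDiv (Ω : Set E3) (v : E3 → E3) : E3 → ℝ :=
  if h : MemHdiv Ω v then h.choose else 0

/-! ### Traces and boundary conditions -/

/-- Surface measure on `∂Ω` (the two-dimensional Hausdorff measure, up to a constant factor). -/
def surf (Ω : Set E3) : Measure E3 :=
  (Measure.hausdorffMeasure 2).restrict (frontier Ω)

/-- `g ∈ L²(∂Ω)` is the trace of `v ∈ H¹(Ω)`: some sequence of functions in `H¹(Ω)` that are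
continuous on the closure of `Ω` converges to `v` in `H¹(Ω)` while its boundary values converge
to `g` in `L²(∂Ω)`. -/
def HasTrace (Ω : Set E3) (v g : E3 → ℝ) : Prop :=
  MemH1 Ω v ∧ MemLp g 2 (surf Ω) ∧
    ∃ u : ℕ → E3 → ℝ,
      (∀ k, MemH1 Ω (u k) ∧ ContinuousOn (u k) (closure Ω)) ∧
      Tendsto (fun k => eLpNorm (u k - v) 2 (volume.restrict Ω)) atTop (𝓝 0) ∧
      Tendsto (fun k => eLpNorm (weakGrad Ω (u k) - weakGrad Ω v) 2 (volume.restrict Ω))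
        atTop (𝓝 0) ∧
      Tendsto (fun k => eLpNorm (u k - g) 2 (surf Ω)) atTop (𝓝 0)

/-- `v ∈ H¹(Ω)` and `v = 0` on the part `S` of `∂Ω` in the sense of traces. -/
def MemH1Zero (Ω S : Set E3) (v : E3 → ℝ) : Prop :=
  ∃ g, HasTrace Ω v g ∧ ∀ᵐ x ∂((surf Ω).restrict S), g x = 0

/-- `ν` is the outward unit normal of `Ω` at the boundary point `x`, around which `∂Ω` is flat.
For a polyhedron this covers almost every boundary point, all but those on edges. -/
def IsOutwardNormal (Ω : Set E3) (x ν : E3) : Prop :=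
  ‖ν‖ = 1 ∧ ∃ r > 0, ∀ y ∈ Metric.ball x r, y ∈ Ω ↔ inner ℝ (y - x) ν < 0

/-- `φ ∈ [H¹(Ω)]³` and `φ × n = 0` on the part `S` of `∂Ω` in the sense of traces. -/
def MemH1TangZero (Ω S : Set E3) (φ : E3 → E3) : Prop :=
  ∃ g : E3 → E3, (∀ i : Fin 3, HasTrace Ω (fun x => φ x i) (fun x => g x i)) ∧
    ∀ᵐ x ∂((surf Ω).restrict S), ∀ ν, IsOutwardNormal Ω x ν → cross (g x) ν = 0

/-- `v ∈ H(curl, Ω)` with vanishing tangential trace `v × n = 0` on the part `Γ` of `∂Ω`. -/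
def MemHcurlZero (Ω Γ : Set E3) (v : E3 → E3) : Prop :=
  MemHcurl Ω v ∧
    ∀ φ, MemH1TangZero Ω (frontier Ω \ Γ) φ →
      ip Ω (weakCurl Ω v) φ - ip Ω v (weakCurl Ω φ) = 0

/-- `v ∈ H(div, Ω)` with vanishing normal trace `v · n = 0` on `Γ_N`, by duality with the
functions of `H¹(Ω)` that vanish on the complementary part `ΓD`. -/
def MemHdivN (Ω ΓD : Set E3) (v : E3 → E3) : Prop :=
  MemHdiv Ω v ∧
    ∀ φ, MemH1Zero Ω ΓD φ →
      ip Ω v (weakGrad Ω φ) + ∫ x in Ω, weakDiv Ω v x * φ x = 0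

/-- The cohomology space: curl-free and divergence-free fields with vanishing tangential trace on
`Γ_D` and vanishing normal trace on `Γ_N`. -/
def MemCohomology (Ω ΓD : Set E3) (v : E3 → E3) : Prop :=
  MemHcurlZero Ω ΓD v ∧ MemHdivN Ω ΓD v ∧
    weakCurl Ω v =ᵐ[volume.restrict Ω] 0 ∧ weakDiv Ω v =ᵐ[volume.restrict Ω] 0

/-- The assumption on the current density: it lies in `H_N(div)`, it is divergence-free, and it is
`L²`-orthogonal to the cohomology space. -/
def IsCurrentDensity (Ω ΓD : Set E3) (j : E3 → E3) : Prop :=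
  MemHdivN Ω ΓD j ∧ weakDiv Ω j =ᵐ[volume.restrict Ω] 0 ∧
    ∀ φ, MemCohomology Ω ΓD φ → ip Ω j φ = 0

/-! ### Domain, mesh, and boundary partition -/

/-- Open sets that are, near each boundary point and in suitable Cartesian coordinates, the region
below the graph of a Lipschitz function. -/
def IsLipschitzDomain (Ω : Set E3) : Prop :=
  IsOpen Ω ∧ ∀ x ∈ frontier Ω, ∃ (e : E3 ≃ₗᵢ[ℝ] E3) (r : ℝ) (K : NNReal)
    (γ : EuclideanSpace ℝ (Fin 2) → ℝ), 0 < r ∧ LipschitzWith K γ ∧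
      ∀ y ∈ Metric.ball x r, y ∈ Ω ↔ (e y) 2 < γ !₂[(e y) 0, (e y) 1]

/-- The closed simplex with the given vertices. -/
def hull (K : Finset E3) : Set E3 := convexHull ℝ (K : Set E3)

/-- A conforming tetrahedral mesh of `Ω`. Each tetrahedron is given by its set of vertices; two
tetrahedra intersect in the simplex spanned by their common vertices (if any). -/
structure TetMesh (Ω : Set E3) where
  cells : Finset (Finset E3)
  card_cell : ∀ K ∈ cells, K.card = 4
  indep : ∀ K ∈ cells, AffineIndependent ℝ (fun v : K => (v : E3))
  inter : ∀ K ∈ cells, ∀ L ∈ cells, hull K ∩ hull L = convexHull ℝ ((K : Set E3) ∩ (L : Set E3))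
  cover : ⋃ K ∈ cells, hull K = closure Ω

namespace TetMesh

variable {Ω : Set E3} (T : TetMesh Ω)

/-- The vertices of the mesh. -/
def vertices : Set E3 := {a | ∃ K ∈ T.cells, a ∈ K}

/-- The boundary faces of the mesh, given by their vertices. -/
def IsBoundaryFace (F : Finset E3) : Prop :=
  F.card = 3 ∧ (∃ K ∈ T.cells, F ⊆ K) ∧ hull F ⊆ frontier Ω

/-- The tetrahedra that share the vertex `a`. -/
def patch (a : E3) : Set (Finset E3) := {K | K ∈ T.cells ∧ a ∈ K}

/-- The open subdomain covered by the patch of `a`. -/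
def patchDomain (a : E3) : Set E3 := interior (⋃ K ∈ T.patch a, hull K)

/-- `w` collects the barycentric coordinates of the point `x` with respect to the vertices of a
tetrahedron that contains it, extended by zero to all other points. -/
def IsBary (x : E3) (w : E3 → ℝ) : Prop :=
  ∃ K ∈ T.cells, (∀ v ∈ K, 0 ≤ w v) ∧ (∀ v, v ∉ K → w v = 0) ∧
    ∑ v ∈ K, w v = 1 ∧ ∑ v ∈ K, w v • v = x

theorem IsBary.unique {x : E3} {w w' : E3 → ℝ} (h : T.IsBary x w) (h' : T.IsBary x w') :
    w = w' := by
  classical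
  obtain ⟨K, hK, h0, hz, h1, hx⟩ := h
  obtain ⟨L, hL, h0', hz', h1', hx'⟩ := h'
  have key : ∀ (M : Finset E3), M ∈ T.cells → ∀ f g : E3 → ℝ,
      ∑ v ∈ M, f v = 1 → ∑ v ∈ M, g v = 1 →
      ∑ v ∈ M, f v • v = ∑ v ∈ M, g v • v → ∀ v ∈ M, f v = g v := by
    intro M hM f g hf hg hfg v hv
    have hi := (affineIndependent_iff (k := ℝ)).1 (T.indep M hM) Finset.univ
      (fun v => f v - g v)
    have e1 : ∑ i : M, (f i - g i) = 0 := by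
      rw [Finset.sum_coe_sort M (fun v => f v - g v), Finset.sum_sub_distrib, hf, hg, sub_self]
    have e2 : ∑ i : M, (f i - g i) • (i : E3) = 0 := by
      rw [Finset.sum_coe_sort M (fun v => (f v - g v) • v)]
      simp only [sub_smul, Finset.sum_sub_distrib, hfg, sub_self]
    exact sub_eq_zero.1 (hi e1 e2 ⟨v, hv⟩ (Finset.mem_univ _))
  have mem : ∀ (M : Finset E3) (f : E3 → ℝ), (∀ v ∈ M, 0 ≤ f v) → ∑ v ∈ M, f v = 1 →
      ∑ v ∈ M, f v • v = x → x ∈ hull M := by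
    intro M f p s e
    rw [← e]
    exact (convex_convexHull ℝ _).sum_mem p s (fun v hv => subset_convexHull ℝ _ hv)
  have hKL : x ∈ convexHull ℝ ((K ∩ L : Finset E3) : Set E3) := by
    rw [Finset.coe_inter, ← T.inter K hK L hL]
    exact ⟨mem K w h0 h1 hx, mem L w' h0' h1' hx'⟩
  obtain ⟨u, -, u1, ux⟩ := Finset.mem_convexHull'.1 hKL
  set u' : E3 → ℝ := fun v => if v ∈ K ∩ L then u v else 0 with hu'
  have ext : ∀ M : Finset E3, K ∩ L ⊆ M →
      ∑ v ∈ M, u' v = 1 ∧ ∑ v ∈ M, u' v • v = x := by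
    intro M hM
    constructor
    · rw [← Finset.sum_subset hM (fun v _ hv => by simp only [hu', if_neg hv]), ← u1]
      exact Finset.sum_congr rfl (fun v hv => by simp only [hu', if_pos hv])
    · rw [← Finset.sum_subset hM (fun v _ hv => by simp only [hu', if_neg hv, zero_smul]), ← ux]
      exact Finset.sum_congr rfl (fun v hv => by simp only [hu', if_pos hv])
  obtain ⟨k1, k2⟩ := ext K Finset.inter_subset_left
  obtain ⟨l1, l2⟩ := ext L Finset.inter_subset_right
  funext v
  have a1 : w v = u' v := by
    by_cases hv : v ∈ K
    · exact key K hK w u' h1 k1 (hx.trans k2.symm) v hv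
    · rw [hz v hv]; simp only [hu']; rw [if_neg (fun h => hv (Finset.mem_inter.1 h).1)]
  have a2 : w' v = u' v := by
    by_cases hv : v ∈ L
    · exact key L hL w' u' h1' l1 (hx'.trans l2.symm) v hv
    · rw [hz' v hv]; simp only [hu']; rw [if_neg (fun h => hv (Finset.mem_inter.1 h).2)]
  rw [a1, a2]

open scoped Classical in
/-- The hat function of the vertex `a`: at a point of the closed domain, the barycentric coordinate
that belongs to `a`; zero outside of the closed domain. -/
def hat (a x : E3) : ℝ :=
  if h : ∃ w, T.IsBary x w then h.choose a else 0

theorem hat_eq {x : E3} {w : E3 → ℝ} (h : T.IsBary x w) (a : E3) : T.hat a x = w a := by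
  have hex : ∃ w, T.IsBary x w := ⟨w, h⟩
  unfold hat
  rw [dif_pos hex]
  exact congrFun (IsBary.unique T hex.choose_spec h) a

/-- The part of `ΓD` covered by the boundary faces that share `a` and lie in the closure
of `ΓD`. -/
def gammaD (ΓD : Set E3) (a : E3) : Set E3 :=
  ΓD ∩ ⋃ F ∈ {F : Finset E3 | T.IsBoundaryFace F ∧ a ∈ F ∧ hull F ⊆ closure ΓD}, hull F

/-- The local space `H¹_*(ω_a)`: functions vanishing on `gammaD` if `a` is in the closure of `ΓD`,
and functions with mean value zero for all the other vertices. -/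
def MemH1Star (ΓD : Set E3) (a : E3) (q : E3 → ℝ) : Prop :=
  (a ∈ closure ΓD → MemH1Zero (T.patchDomain a) (T.gammaD ΓD a) q) ∧
  (a ∉ closure ΓD → MemH1 (T.patchDomain a) q ∧ ∫ x in T.patchDomain a, q x = 0)

/-- `ΓD`, `ΓN` are disjoint relatively open parts of `∂Ω` whose closures cover `∂Ω`, and each
boundary face of the mesh lies entirely in one of the two closures. -/
structure IsBoundaryPartition (ΓD ΓN : Set E3) : Prop where
  disj : Disjoint ΓD ΓN
  openD : ∃ U, IsOpen U ∧ ΓD = U ∩ frontier Ω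
  openN : ∃ U, IsOpen U ∧ ΓN = U ∩ frontier Ω
  cover : frontier Ω = closure ΓD ∪ closure ΓN
  faces : ∀ F, T.IsBoundaryFace F → hull F ⊆ closure ΓD ∨ hull F ⊆ closure ΓN

end TetMesh

/-! ### Piecewise polynomial spaces -/

/-- The function on three-dimensional space given by a polynomial. -/
def polyEval (P : MvPolynomial (Fin 3) ℝ) (x : E3) : ℝ := MvPolynomial.eval (fun i => x i) P

/-- The vector field given by three polynomials. -/
def polyField (P : Fin 3 → MvPolynomial (Fin 3) ℝ) (x : E3) : E3 :=
  WithLp.toLp 2 (fun i => polyEval (P i) x)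

/-- On the simplex with vertices `K`, `v` is a polynomial of total degree at most `q`. -/
def IsPolyOn (q : ℕ) (K : Finset E3) (v : E3 → ℝ) : Prop :=
  ∃ P : MvPolynomial (Fin 3) ℝ, P.totalDegree ≤ q ∧
    ∀ᵐ x ∂(volume.restrict (hull K)), v x = polyEval P x

/-- On the simplex with vertices `K`, `v` belongs to the Nédélec space `[P_q]³ + x × [P_q]³`. -/
def IsNedelecOn (q : ℕ) (K : Finset E3) (v : E3 → E3) : Prop :=
  ∃ P Q : Fin 3 → MvPolynomial (Fin 3) ℝ,
    (∀ i, (P i).totalDegree ≤ q) ∧ (∀ i, (Q i).totalDegree ≤ q) ∧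
    ∀ᵐ x ∂(volume.restrict (hull K)), v x = polyField P x + cross x (polyField Q x)

namespace TetMesh

variable {Ω : Set E3} (T : TetMesh Ω)

/-- The broken Nédélec space `N_q(T_h)`. -/
def MemNedelec (q : ℕ) (v : E3 → E3) : Prop :=
  MemL2 Ω v ∧ ∀ K ∈ T.cells, IsNedelecOn q K v

/-- The broken polynomial space `P_q(T_a)` on the patch of `a`. -/
def MemPolyPatch (q : ℕ) (a : E3) (v : E3 → ℝ) : Prop :=
  MemL2 (T.patchDomain a) v ∧ ∀ K ∈ T.patch a, IsPolyOn q K v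

/-- The assumption on the discrete magnetic vector potential: `A` is a conforming Nédélec field of
degree `p` and satisfies the lowest-order Galerkin orthogonality. -/
def IsDiscretePotential (p : ℕ) (ΓD : Set E3) (j A : E3 → E3) : Prop :=
  (T.MemNedelec p A ∧ MemHcurlZero Ω ΓD A) ∧
    ∀ v, T.MemNedelec 0 v → MemHcurlZero Ω ΓD v →
      ip Ω (weakCurl Ω A) (weakCurl Ω v) = ip Ω j v

end TetMesh

end MaxwellPatch

end

noncomputable section

namespace MaxwellPatch

/-! Both implications come from elementary identities for lowest-order Nédélec fields, applied with
the hat function `ψ_a` of each vertex `a`.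

From the Galerkin orthogonality to the patches (`patchForm_eq_zero`): let `q` be an admissible
piecewise affine function on the patch of `a`. The product `ψ_a q`, extended by zero, lies in
`H¹_D(Ω)`, so `(j, ψ_a ∇q + q ∇ψ_a) = 0` because `j` is divergence-free with zero flux through
`Γ_N`. The field `ψ_a ∇q - q ∇ψ_a`, extended by zero, is a lowest-order Nédélec field with vanishing
tangential trace on `Γ_D` and with curl `2 ∇ψ_a × ∇q`, so it may be used as a Galerkin test field.
Adding the two relations gives `(j, ψ_a ∇q) = (∇ × A, ∇ψ_a × ∇q)`, and the antisymmetry of the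
triple product turns this into the patch identity.

From the patches to the Galerkin orthogonality (`ip_weakCurl_eq`): a lowest-order Nédélec field `v`
is affine on each cell `K`, hence on `K` it equals `∑_a ψ_a v_K(a)`, and its curl is `∑_a ∇ψ_a ×
v_K(a)`. For a fixed vertex `a` the vectors `v_K(a)` are the gradients of the pieces `v_K(a) · (x -
a)` of one piecewise affine function `q_a`. Tangential continuity of `v` makes `q_a` continuous on
the patch, and the boundary condition of `v` makes it vanish on the Dirichlet faces at `a`. Up to a
constant `q_a` is therefore admissible, and the sum of the patch identities over all vertices is the
Galerkin identity for `v`.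

Most of the work translates the weak definitions into pointwise statements about polynomial pieces
and back: a weak gradient corresponds to agreement across inner faces, a weak curl to agreement of
tangential components, and boundary conditions to conditions on outer faces. The basis is a Gauss
theorem on one tetrahedron (`IsTet.gauss`), obtained as the limit of smooth cut-off functions whose
derivatives concentrate at the faces. Surface densities are then compared pointwise by testing with
bump functions (`Conforming.localize`). Traces enter by passing to the limit in Green formulas
(`Conforming.trace_green`). No normalizing constant of the surface measure is ever computed.

One geometric point needs care: agreement across faces must imply agreement at all common points,
including edges and vertices. This uses the Lipschitz property of the domain, by which cells that
share a vertex or an edge are linked through faces containing it (`Conforming.chain`). -/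

/-! ### Barycentric coordinates on a tetrahedron -/

/-- `K` is the vertex set of a nondegenerate tetrahedron. -/
structure IsTet (K : Finset E3) : Prop where
  card : K.card = 4
  indep : AffineIndependent ℝ (fun v : K => (v : E3))

/-- The vertices of a tetrahedron as an affine basis. -/
def IsTet.basis {K : Finset E3} (h : IsTet K) : AffineBasis K ℝ E3 :=
  ⟨fun v => v, h.indep, by
    rw [h.indep.affineSpan_eq_top_iff_card_eq_finrank_add_one]; simp [h.card]⟩

open scoped Classical in
/-- The barycentric coordinate of `x` with respect to the vertex `v` of the tetrahedron `K`. -/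
def lam (K : Finset E3) (v x : E3) : ℝ :=
  if h : IsTet K ∧ v ∈ K then h.1.basis.coord ⟨v, h.2⟩ x else 0

open scoped Classical in
/-- The gradient of the barycentric coordinate `lam K v`. -/
def glam (K : Finset E3) (v : E3) : E3 :=
  if h : IsTet K ∧ v ∈ K then
    (InnerProductSpace.toDual ℝ E3).symm
      (LinearMap.toContinuousLinearMap (h.1.basis.coord ⟨v, h.2⟩).linear)
  else 0

theorem lam_sub (K : Finset E3) (v x y : E3) :
    lam K v x = lam K v y + inner ℝ (glam K v) (x - y) := by
  unfold lam glam
  split_ifs with h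
  · rw [InnerProductSpace.toDual_symm_apply]
    have := (h.1.basis.coord ⟨v, h.2⟩).map_vadd y (x - y)
    simp only [vadd_eq_add, sub_add_cancel] at this
    rw [this]; simp [add_comm]
  · simp

theorem lam_eq (K : Finset E3) (v x : E3) :
    lam K v x = lam K v 0 + inner ℝ (glam K v) x := by
  simpa using lam_sub K v x 0

theorem inner_glam_sub {K : Finset E3} {v : E3} (x y : E3) :
    inner ℝ (glam K v) (x - y) = lam K v x - lam K v y := by
  rw [lam_sub K v x y]; ring

theorem continuous_lam (K : Finset E3) (v : E3) : Continuous (lam K v) := by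
  rw [show lam K v = fun x => lam K v 0 + inner ℝ (glam K v) x from funext (lam_eq K v)]
  fun_prop

theorem contDiff_lam (K : Finset E3) (v : E3) : ContDiff ℝ ∞ (lam K v) := by
  rw [show lam K v = fun x => lam K v 0 + inner ℝ (glam K v) x from funext (lam_eq K v)]
  exact contDiff_const.add (contDiff_const.inner ℝ contDiff_id)

/-! ### Simplices as convex hulls, and their faces in barycentric coordinates. -/

theorem convex_hull (K : Finset E3) : Convex ℝ (hull K) := convex_convexHull ℝ _

theorem isCompact_hull (K : Finset E3) : IsCompact (hull K) :=
  K.finite_toSet.isCompact_convexHull ℝ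

theorem isClosed_hull (K : Finset E3) : IsClosed (hull K) := (isCompact_hull K).isClosed

theorem measurableSet_hull (K : Finset E3) : MeasurableSet (hull K) :=
  (isClosed_hull K).measurableSet

theorem interior_hull_ae_eq (K : Finset E3) : interior (hull K) =ᵐ[volume] hull K :=
  interior_ae_eq_of_null_frontier ((convex_hull K).addHaar_frontier volume)

theorem mem_hull_of_mem {K : Finset E3} {v : E3} (hv : v ∈ K) : v ∈ hull K :=
  subset_convexHull ℝ _ hv

theorem hull_mono {F K : Finset E3} (h : F ⊆ K) : hull F ⊆ hull K :=
  convexHull_mono (by exact_mod_cast h)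

namespace IsTet

variable {K : Finset E3} (hK : IsTet K)
include hK

theorem lam_of_mem {v : E3} (hv : v ∈ K) (x : E3) : lam K v x = hK.basis.coord ⟨v, hv⟩ x := by
  unfold lam; rw [dif_pos ⟨hK, hv⟩]

theorem sum_lam (x : E3) : ∑ v ∈ K, lam K v x = 1 := by
  rw [← hK.basis.sum_coord_apply_eq_one x, ← Finset.sum_coe_sort]
  exact Finset.sum_congr rfl fun v _ => hK.lam_of_mem v.2 x

theorem sum_lam_smul (x : E3) : ∑ v ∈ K, lam K v x • v = x := by
  conv_rhs => rw [← hK.basis.linear_combination_coord_eq_self x]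
  rw [← Finset.sum_coe_sort]
  exact Finset.sum_congr rfl fun v _ => by rw [hK.lam_of_mem v.2 x]; rfl

theorem lam_unique {w : E3 → ℝ} {x : E3} (h1 : ∑ v ∈ K, w v = 1) (hx : ∑ v ∈ K, w v • v = x)
    {v : E3} (hv : v ∈ K) : lam K v x = w v := by
  have hi := (affineIndependent_iff (k := ℝ)).1 hK.indep Finset.univ
    (fun v => lam K v x - w v)
  have e1 : ∑ i : K, (lam K i x - w i) = 0 := by
    rw [Finset.sum_coe_sort K (fun v => lam K v x - w v), Finset.sum_sub_distrib, h1,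
      hK.sum_lam, sub_self]
  have e2 : ∑ i : K, (lam K i x - w i) • (i : E3) = 0 := by
    rw [Finset.sum_coe_sort K (fun v => (lam K v x - w v) • v)]
    simp only [sub_smul, Finset.sum_sub_distrib, hx, hK.sum_lam_smul, sub_self]
  exact sub_eq_zero.1 (hi e1 e2 ⟨v, hv⟩ (Finset.mem_univ _))

theorem lam_self {v : E3} (hv : v ∈ K) : lam K v v = 1 := by
  rw [hK.lam_of_mem hv]; exact hK.basis.coord_apply_eq ⟨v, hv⟩

theorem lam_ne {v w : E3} (hv : v ∈ K) (hw : w ∈ K) (h : v ≠ w) : lam K v w = 0 := by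
  rw [hK.lam_of_mem hv]
  exact hK.basis.coord_apply_ne (i := ⟨v, hv⟩) (j := ⟨w, hw⟩) (by simpa using h)

theorem mem_hull_iff {x : E3} : x ∈ hull K ↔ ∀ v ∈ K, 0 ≤ lam K v x := by
  have : hull K = convexHull ℝ (Set.range hK.basis) := by
    unfold hull; congr 1; exact Subtype.range_coe.symm
  rw [this, hK.basis.convexHull_eq_nonneg_coord]
  exact ⟨fun h v hv => by rw [hK.lam_of_mem hv]; exact h _,
    fun h i => by rw [← hK.lam_of_mem i.2]; exact h _ i.2⟩

theorem mem_interior_iff {x : E3} : x ∈ interior (hull K) ↔ ∀ v ∈ K, 0 < lam K v x := by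
  have : hull K = convexHull ℝ (Set.range hK.basis) := by
    unfold hull; congr 1; exact Subtype.range_coe.symm
  rw [this, hK.basis.interior_convexHull]
  exact ⟨fun h v hv => by rw [hK.lam_of_mem hv]; exact h _,
    fun h i => by rw [← hK.lam_of_mem i.2]; exact h _ i.2⟩

/-- Convex weights on `F`, extended by zero, are weights on `K`, and barycentric coordinates are
unique. -/
theorem mem_hull_subset_iff {F : Finset E3} (hF : F ⊆ K) {x : E3} :
    x ∈ hull F ↔ (∀ v ∈ K, 0 ≤ lam K v x) ∧ ∀ v ∈ K, v ∉ F → lam K v x = 0 := by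
  classical
  constructor
  · intro h
    refine ⟨hK.mem_hull_iff.1 (hull_mono hF h), fun v hv hvF => ?_⟩
    obtain ⟨w, -, w1, wx⟩ := Finset.mem_convexHull'.1 h
    have := hK.lam_unique (w := fun v => if v ∈ F then w v else 0) (x := x) ?_ ?_ hv
    · rw [this, if_neg hvF]
    · rw [← w1, ← Finset.sum_subset hF (fun v _ hv => if_neg hv)]
      exact Finset.sum_congr rfl (fun v hv => if_pos hv)
    · rw [← wx, ← Finset.sum_subset hF (fun v _ hv => by rw [if_neg hv, zero_smul])]
      exact Finset.sum_congr rfl (fun v hv => by rw [if_pos hv])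
  · rintro ⟨h0, hz⟩
    refine Finset.mem_convexHull'.2 ⟨fun v => lam K v x, fun v hv => h0 v (hF hv), ?_, ?_⟩
    · rw [← hK.sum_lam x]
      exact Finset.sum_subset hF fun v hv hvF => hz v hv hvF
    · conv_rhs => rw [← hK.sum_lam_smul x]
      exact Finset.sum_subset hF fun v hv hvF => by
        simp only [hz v hv hvF, zero_smul]

theorem lam_eq_sum_subset {F : Finset E3} (hF : F ⊆ K) {w : E3 → ℝ} {x : E3}
    (h1 : ∑ v ∈ F, w v = 1) (hx : ∑ v ∈ F, w v • v = x) {v : E3} (hv : v ∈ F) :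
    lam K v x = w v := by
  classical
  have := hK.lam_unique (w := fun v => if v ∈ F then w v else 0) (x := x) ?_ ?_ (hF hv)
  · rw [this, if_pos hv]
  · rw [← h1, ← Finset.sum_subset hF (fun v _ hv => if_neg hv)]
    exact Finset.sum_congr rfl (fun v hv => if_pos hv)
  · rw [← hx, ← Finset.sum_subset hF (fun v _ hv => by rw [if_neg hv, zero_smul])]
    exact Finset.sum_congr rfl (fun v hv => by rw [if_pos hv])

theorem sum_glam : ∑ v ∈ K, glam K v = 0 := by
  have h : ∀ x : E3, inner ℝ (∑ v ∈ K, glam K v) x = 0 := by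
    intro x
    have h1 := hK.sum_lam x
    rw [Finset.sum_congr rfl fun v _ => lam_eq K v x, Finset.sum_add_distrib, hK.sum_lam,
      ← sum_inner] at h1
    linarith
  exact inner_self_eq_zero.1 (h _)

/-- A linear function equals the barycentric interpolant of its vertex values; comparing gradients
gives the formula. -/
theorem sum_inner_smul_glam (w : E3) : ∑ v ∈ K, inner ℝ w v • glam K v = w := by
  have h : ∀ x : E3, inner ℝ (∑ v ∈ K, inner ℝ w v • glam K v) x = inner ℝ w x := by
    intro x
    have h1 : ∀ y : E3, inner ℝ w y = ∑ v ∈ K, lam K v y * inner ℝ w v := by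
      intro y
      conv_lhs => rw [← hK.sum_lam_smul y]
      simp [inner_sum, inner_smul_right]
    have h2 := h1 x
    have h0 := h1 0
    rw [Finset.sum_congr rfl fun v _ => by rw [lam_eq K v x], ] at h2
    simp only [add_mul, Finset.sum_add_distrib, ← h0, inner_zero_right, zero_add] at h2
    rw [h2, sum_inner]
    exact Finset.sum_congr rfl fun v _ => by rw [inner_smul_left]; simp [mul_comm]
  exact ext_inner_right ℝ h

theorem exists_ne (v : E3) : ∃ w ∈ K, w ≠ v :=
  Finset.exists_mem_ne (by rw [hK.card]; norm_num) v

theorem glam_ne_zero {v : E3} (hv : v ∈ K) : glam K v ≠ 0 := by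
  intro h
  obtain ⟨w, hw, hwv⟩ := hK.exists_ne v
  have := inner_glam_sub (K := K) (v := v) v w
  rw [h, hK.lam_self hv, hK.lam_ne hv hw hwv.symm] at this
  simp at this

theorem nonempty_interior : (interior (hull K)).Nonempty := by
  refine ⟨∑ v ∈ K, (4 : ℝ)⁻¹ • v, hK.mem_interior_iff.2 fun v hv => ?_⟩
  rw [hK.lam_unique (w := fun _ => (4 : ℝ)⁻¹) (by simp [hK.card]) rfl hv]
  norm_num

theorem closure_interior : closure (interior (hull K)) = hull K := by
  rw [(convex_hull K).closure_interior_eq_closure_of_nonempty_interior hK.nonempty_interior,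
    (isClosed_hull K).closure_eq]

end IsTet

/-! ### The vector product -/

@[simp] theorem cross_zero_apply (u v : E3) : cross u v 0 = u 1 * v 2 - u 2 * v 1 := by
  simp [cross, cross_apply]

@[simp] theorem cross_one_apply (u v : E3) : cross u v 1 = u 2 * v 0 - u 0 * v 2 := by
  simp [cross, cross_apply]

@[simp] theorem cross_two_apply (u v : E3) : cross u v 2 = u 0 * v 1 - u 1 * v 0 := by
  simp [cross, cross_apply]

theorem ext_three {u v : E3} (h0 : u 0 = v 0) (h1 : u 1 = v 1) (h2 : u 2 = v 2) : u = v := by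
  ext i; fin_cases i <;> assumption

theorem inner_three (u v : E3) : inner ℝ u v = u 0 * v 0 + u 1 * v 1 + u 2 * v 2 := by
  simp [PiLp.inner_apply, Fin.sum_univ_three, mul_comm]

theorem exists_smul_of_cross_eq_zero {N w : E3} (hN : N ≠ 0) (h : cross N w = 0) :
    ∃ c : ℝ, w = c • N := by
  have hne : inner ℝ N N ≠ 0 := fun h0 => hN (inner_self_eq_zero.1 h0)
  have h0 : cross N w 0 = 0 := by rw [h]; rfl
  have h1 : cross N w 1 = 0 := by rw [h]; rfl
  have h2 : cross N w 2 = 0 := by rw [h]; rfl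
  simp only [cross_zero_apply, cross_one_apply, cross_two_apply] at h0 h1 h2
  refine ⟨inner ℝ N w / inner ℝ N N, ?_⟩
  -- This is the expansion of `N × (N × w) = 0`.
  have key : inner ℝ N N • w = inner ℝ N w • N := by
    apply ext_three <;> simp only [inner_three, PiLp.smul_apply, smul_eq_mul]
    · linear_combination N 2 * h1 - N 1 * h2
    · linear_combination N 0 * h2 - N 2 * h0
    · linear_combination N 1 * h0 - N 0 * h1
  rw [div_eq_inv_mul, mul_smul, ← key, smul_smul, inv_mul_cancel₀ hne, one_smul]

theorem cross_smul_self (c : ℝ) (N : E3) : cross N (c • N) = 0 := by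
  apply ext_three <;> simp <;> ring

/-- A vector is orthogonal to the face opposite to `b` iff its vector product with the gradient of
the barycentric coordinate of `b` vanishes. -/
theorem IsTet.cross_glam_eq_zero_iff {K : Finset E3} (hK : IsTet K) {b : E3} (hb : b ∈ K) {w : E3} :
    cross (glam K b) w = 0 ↔ ∀ u ∈ K, ∀ v ∈ K, u ≠ b → v ≠ b → inner ℝ w u = inner ℝ w v := by
  classical
  constructor
  · intro h u hu v hv hub hvb
    obtain ⟨c, rfl⟩ := exists_smul_of_cross_eq_zero (hK.glam_ne_zero hb) h
    have := inner_glam_sub (K := K) (v := b) u v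
    rw [hK.lam_ne hb hu hub.symm, hK.lam_ne hb hv hvb.symm, inner_sub_right] at this
    simp only [inner_smul_left]
    rw [show inner ℝ (glam K b) u = inner ℝ (glam K b) v by linarith]
  · intro h
    obtain ⟨u, hu, hub⟩ := hK.exists_ne b
    have h1 := hK.sum_inner_smul_glam w
    have h2 := hK.sum_glam
    rw [← Finset.add_sum_erase K _ hb] at h1 h2
    have h3 : ∑ v ∈ K.erase b, inner ℝ w v • glam K v
        = inner ℝ w u • ∑ v ∈ K.erase b, glam K v := by
      rw [Finset.smul_sum]
      refine Finset.sum_congr rfl fun v hv => ?_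
      rw [h v (Finset.mem_of_mem_erase hv) u hu (Finset.ne_of_mem_erase hv) hub]
    rw [h3, eq_neg_of_add_eq_zero_right h2, smul_neg, ← sub_eq_add_neg, ← sub_smul] at h1
    rw [← h1]; exact cross_smul_self _ _

open scoped Classical

/-! ### Conforming families of tetrahedra -/

/-- A finite family of tetrahedra any two of which meet in the simplex of their common vertices. -/
structure Conforming (S : Finset (Finset E3)) : Prop where
  tet : ∀ K ∈ S, IsTet K
  inter : ∀ K ∈ S, ∀ L ∈ S, hull K ∩ hull L = hull (K ∩ L)

/-- The open set covered by a family of tetrahedra. -/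
def dom (S : Finset (Finset E3)) : Set E3 := interior (⋃ K ∈ S, hull K)

/-- The relative interior of the simplex with vertices `E`, a part of the vertices of the
tetrahedron `K`. -/
def openFace (K E : Finset E3) : Set E3 :=
  {x | (∀ v ∈ E, 0 < lam K v x) ∧ ∀ v ∈ K, v ∉ E → lam K v x = 0}

theorem openFace_self {K : Finset E3} (hK : IsTet K) : openFace K K = interior (hull K) := by
  ext x
  rw [hK.mem_interior_iff]
  exact ⟨fun h => h.1, fun h => ⟨h, fun v hv hv' => absurd hv hv'⟩⟩

theorem openFace_subset {K E : Finset E3} (hK : IsTet K) (hE : E ⊆ K) :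
    openFace K E ⊆ hull E := by
  intro x hx
  rw [hK.mem_hull_subset_iff hE]
  refine ⟨fun v hv => ?_, hx.2⟩
  by_cases hvE : v ∈ E
  · exact (hx.1 v hvE).le
  · exact (hx.2 v hv hvE).ge

theorem openFace_nonempty {K E : Finset E3} (hK : IsTet K) (hE : E ⊆ K) (hne : E.Nonempty) :
    (openFace K E).Nonempty := by
  have hc : (0 : ℝ) < E.card := by exact_mod_cast hne.card_pos
  set x : E3 := ∑ v ∈ E, (E.card : ℝ)⁻¹ • v with hx
  have h1 : ∑ v ∈ E, (E.card : ℝ)⁻¹ = 1 := by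
    rw [Finset.sum_const, nsmul_eq_mul, mul_inv_cancel₀ hc.ne']
  refine ⟨x, fun v hv => ?_, ?_⟩
  · rw [hK.lam_eq_sum_subset hE (w := fun _ => (E.card : ℝ)⁻¹) h1 hx.symm hv]; positivity
  · have : x ∈ hull E := Finset.mem_convexHull'.2 ⟨fun _ => (E.card : ℝ)⁻¹,
      fun _ _ => by positivity, h1, hx.symm⟩
    exact ((hK.mem_hull_subset_iff hE).1 this).2

theorem openFace_congr {K L E : Finset E3} (hK : IsTet K) (hL : IsTet L) (hEK : E ⊆ K)
    (hEL : E ⊆ L) : openFace K E = openFace L E := by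
  have key : ∀ {K L : Finset E3}, IsTet K → IsTet L → E ⊆ K → E ⊆ L →
      openFace K E ⊆ openFace L E := by
    intro K L hK hL hEK hEL x hx
    have hxE := openFace_subset hK hEK hx
    refine ⟨fun v hv => ?_, ((hL.mem_hull_subset_iff hEL).1 hxE).2⟩
    obtain ⟨w, -, w1, wx⟩ := Finset.mem_convexHull'.1 hxE
    rw [hL.lam_eq_sum_subset hEL w1 wx hv, ← hK.lam_eq_sum_subset hEK w1 wx hv]
    exact hx.1 v hv
  exact (key hK hL hEK hEL).antisymm (key hL hK hEL hEK)

theorem IsTet.erase_nonempty {K : Finset E3} (hK : IsTet K) (b : E3) : (K.erase b).Nonempty :=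
  (hK.exists_ne b).imp fun _ hw => Finset.mem_erase.2 ⟨hw.2, hw.1⟩

theorem lam_lineMap (K : Finset E3) (v x y : E3) (t : ℝ) :
    lam K v (x + t • (y - x)) = (1 - t) * lam K v x + t * lam K v y := by
  rw [lam_eq K v (x + t • (y - x)), lam_eq K v x, lam_eq K v y]
  simp only [inner_add_right, inner_smul_right, inner_sub_right]; ring

theorem openFace_lineMap {K E : Finset E3} (hK : IsTet K) (hE : E ⊆ K) {x y : E3}
    (hx : x ∈ openFace K E) (hy : y ∈ hull E) {t : ℝ} (ht0 : 0 ≤ t) (ht1 : t < 1) :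
    x + t • (y - x) ∈ openFace K E := by
  rw [hK.mem_hull_subset_iff hE] at hy
  refine ⟨fun v hv => ?_, fun v hv hvE => ?_⟩ <;> rw [lam_lineMap]
  · have := hx.1 v hv
    have := hy.1 v (hE hv)
    have : 0 < 1 - t := by linarith
    positivity
  · rw [hx.2 v hv hvE, hy.2 v hv hvE]; ring

theorem tendsto_lineMap_zero (x y : E3) :
    Tendsto (fun t : ℝ => x + t • (y - x)) (𝓝[>] 0) (𝓝 x) := by
  have : Continuous fun t : ℝ => x + t • (y - x) := by fun_prop
  simpa using (this.tendsto 0).mono_left nhdsWithin_le_nhds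

theorem hull_subset_closure_openFace {K E : Finset E3} (hK : IsTet K) (hE : E ⊆ K)
    (hne : E.Nonempty) : hull E ⊆ closure (openFace K E) := by
  intro y hy
  obtain ⟨x, hx⟩ := openFace_nonempty hK hE hne
  have : Continuous fun t : ℝ => x + t • (y - x) := by fun_prop
  have h1 : Tendsto (fun t : ℝ => x + t • (y - x)) (𝓝[<] 1) (𝓝 y) := by
    simpa using (this.tendsto 1).mono_left nhdsWithin_le_nhds
  refine mem_closure_of_tendsto h1 ?_
  filter_upwards [Ioo_mem_nhdsLT (zero_lt_one : (0 : ℝ) < 1)] with t ht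
  exact openFace_lineMap hK hE hx hy ht.1.le ht.2

theorem eventually_lam_pos {K E : Finset E3} {x : E3} (hx : ∀ v ∈ E, 0 < lam K v x) :
    ∀ᶠ y in 𝓝 x, ∀ v ∈ E, 0 < lam K v y := by
  rw [Filter.eventually_all_finset]
  exact fun v hv => (continuous_lam K v).continuousAt.eventually (lt_mem_nhds (hx v hv))

theorem eventually_mem_hull (S : Finset (Finset E3)) (x : E3) :
    ∀ᶠ y in 𝓝 x, ∀ K ∈ S, y ∈ hull K → x ∈ hull K := by
  rw [Filter.eventually_all_finset]
  intro K _
  by_cases hx : x ∈ hull K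
  · exact Eventually.of_forall fun _ _ => hx
  · filter_upwards [(isClosed_hull K).isOpen_compl.mem_nhds hx] with y hy hy'
    exact absurd hy' hy

theorem isOpen_dom (S : Finset (Finset E3)) : IsOpen (dom S) := isOpen_interior

theorem isCompact_biUnion_hull (S : Finset (Finset E3)) : IsCompact (⋃ K ∈ S, hull K) :=
  S.isCompact_biUnion fun K _ => isCompact_hull K

theorem dom_subset (S : Finset (Finset E3)) : dom S ⊆ ⋃ K ∈ S, hull K := interior_subset

theorem closure_dom_subset (S : Finset (Finset E3)) : closure (dom S) ⊆ ⋃ K ∈ S, hull K :=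
  closure_minimal (dom_subset S) (isCompact_biUnion_hull S).isClosed

theorem interior_hull_subset_dom {S : Finset (Finset E3)} {K : Finset E3} (hK : K ∈ S) :
    interior (hull K) ⊆ dom S :=
  interior_mono (Set.subset_biUnion_of_mem (u := fun K => hull K) hK)

theorem dom_ae_eq (S : Finset (Finset E3)) : dom S =ᵐ[volume] (⋃ K ∈ S, interior (hull K) : Set E3) := by
  have h1 : (⋃ K ∈ S, interior (hull K) : Set E3) ⊆ dom S :=
    Set.iUnion₂_subset fun K hK => interior_hull_subset_dom hK
  refine EventuallyLE.antisymm ?_ (ae_of_all _ h1)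
  have h2 : ∀ᵐ x : E3, ∀ K ∈ S, (x ∈ interior (hull K) ↔ x ∈ hull K) := by
    rw [Filter.eventually_all_finset]
    exact fun K _ => (interior_hull_ae_eq K).mem_iff
  filter_upwards [h2] with x hx hxd
  obtain ⟨K, hK, hxK⟩ := Set.mem_iUnion₂.1 (dom_subset S hxd)
  exact Set.mem_iUnion₂.2 ⟨K, hK, (hx K hK).2 hxK⟩

theorem ae_dom_iff {S : Finset (Finset E3)} {p : E3 → Prop} :
    (∀ᵐ x ∂(volume.restrict (dom S)), p x) ↔ ∀ K ∈ S, ∀ᵐ x ∂(volume.restrict (hull K)), p x := by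
  rw [Measure.restrict_congr_set (dom_ae_eq S), ae_restrict_biUnion_finset_iff]
  refine forall₂_congr fun K _ => ?_
  rw [Measure.restrict_congr_set (interior_hull_ae_eq K)]

theorem volume_dom_lt_top (S : Finset (Finset E3)) : volume (dom S) < ⊤ :=
  (measure_mono (dom_subset S)).trans_lt (isCompact_biUnion_hull S).measure_lt_top

/-! ### Incidence of cells and faces in a conforming family. -/

namespace Conforming

variable {S : Finset (Finset E3)} (hS : Conforming S)
include hS

theorem mono {S' : Finset (Finset E3)} (h : S' ⊆ S) : Conforming S' :=
  ⟨fun K hK => hS.tet K (h hK), fun K hK L hL => hS.inter K (h hK) L (h hL)⟩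

theorem hull_subset_closure {K : Finset E3} (hK : K ∈ S) : hull K ⊆ closure (dom S) := by
  rw [← (hS.tet K hK).closure_interior]
  exact closure_mono (interior_hull_subset_dom hK)

theorem closure_dom : closure (dom S) = ⋃ K ∈ S, hull K :=
  (closure_dom_subset S).antisymm (Set.iUnion₂_subset fun _ hK => hS.hull_subset_closure hK)

/-- This is how conformity is mostly used: the common part of two cells is spanned by their common
vertices, and a point in the relative interior of a face needs all vertices of that face. -/
theorem subset_of_mem_openFace {K L E : Finset E3} (hK : K ∈ S) (hL : L ∈ S) (hE : E ⊆ K) {x : E3}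
    (hx : x ∈ openFace K E) (hxL : x ∈ hull L) : E ⊆ L := by
  have hT := hS.tet K hK
  have h1 : x ∈ hull (K ∩ L) := by
    rw [← hS.inter K hK L hL]
    exact ⟨hull_mono hE (openFace_subset hT hE hx), hxL⟩
  intro v hv
  by_contra hvL
  have := ((hT.mem_hull_subset_iff Finset.inter_subset_left).1 h1).2 v (hE hv)
    (fun h => hvL (Finset.mem_inter.1 h).2)
  exact (hx.1 v hv).ne' this

theorem eq_of_subset {K L : Finset E3} (hK : K ∈ S) (hL : L ∈ S) (h : K ⊆ L) : K = L :=
  Finset.eq_of_subset_of_card_le h (by rw [(hS.tet K hK).card, (hS.tet L hL).card])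

theorem disjoint_interior {K L : Finset E3} (hK : K ∈ S) (hL : L ∈ S) (h : K ≠ L) :
    Disjoint (interior (hull K)) (interior (hull L)) := by
  refine Set.disjoint_left.2 fun x hx hx' => h (hS.eq_of_subset hK hL ?_)
  rw [← openFace_self (hS.tet K hK)] at hx
  exact hS.subset_of_mem_openFace hK hL subset_rfl hx (interior_subset hx')

theorem setIntegral_dom {F : Type*} [NormedAddCommGroup F] [NormedSpace ℝ F] {f : E3 → F}
    (hf : IntegrableOn f (dom S)) : ∫ x in dom S, f x = ∑ K ∈ S, ∫ x in hull K, f x := by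
  rw [setIntegral_congr_set (dom_ae_eq S), integral_biUnion_finset S
    (fun K _ => isOpen_interior.measurableSet)
    (fun K hK L hL h => hS.disjoint_interior hK hL h)
    (fun K hK => hf.mono_set (interior_hull_subset_dom hK))]
  exact Finset.sum_congr rfl fun K _ => setIntegral_congr_set (interior_hull_ae_eq K)

/-- The other tetrahedron at an interior face. -/
theorem exists_erase_eq {K L : Finset E3} (hK : K ∈ S) (hL : L ∈ S) (hne : K ≠ L) {b : E3}
    (hb : b ∈ K) (h : K.erase b ⊆ L) :
    ∃ c ∈ L, c ∉ K ∧ L.erase c = K.erase b := by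
  have hcard : (K.erase b).card = 3 := by
    rw [Finset.card_erase_of_mem hb, (hS.tet K hK).card]
  obtain ⟨c, hcL, hcK⟩ : ∃ c ∈ L, c ∉ K := by
    by_contra! hcon
    exact hne (hS.eq_of_subset hL hK hcon).symm
  refine ⟨c, hcL, hcK, (Finset.eq_of_subset_of_card_le (fun v hv => ?_) ?_).symm⟩
  · refine Finset.mem_erase.2 ⟨?_, h hv⟩
    rintro rfl
    exact hcK (Finset.mem_of_mem_erase hv)
  · rw [hcard, Finset.card_erase_of_mem hcL, (hS.tet L hL).card]

/-- Both coordinates are affine and vanish on the common face, so they are proportional; the sign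
says that the two cells lie on opposite sides. -/
theorem exists_neg_lam_eq {K L : Finset E3} (hK : K ∈ S) (hL : L ∈ S) {b c : E3}
    (hb : b ∈ K) (hc : c ∈ L) (hcK : c ∉ K) (h : L.erase c = K.erase b) :
    ∃ s < 0, ∀ y, lam L c y = s * lam K b y := by
  have hTK := hS.tet K hK
  have hTL := hS.tet L hL
  -- When `lam L c` is expanded through its values at the vertices of `K`, only `b` contributes, the
  -- other vertices being on the common face.
  have hlin : ∀ y, lam L c y = lam L c b * lam K b y := by
    intro y
    have h1 : lam L c y = ∑ v ∈ K, lam K v y * lam L c v := by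
      have e1 : lam L c y = lam L c 0 + inner ℝ (glam L c) (∑ v ∈ K, lam K v y • v) := by
        rw [hTK.sum_lam_smul]; exact lam_eq L c y
      rw [e1, inner_sum, ← mul_one (lam L c 0), ← hTK.sum_lam y, Finset.mul_sum,
        ← Finset.sum_add_distrib]
      refine Finset.sum_congr rfl fun v _ => ?_
      rw [inner_smul_right, lam_eq L c v]; ring
    rw [h1, ← Finset.add_sum_erase K _ hb, Finset.sum_eq_zero, add_zero, mul_comm]
    intro v hv
    rw [← h] at hv
    rw [hTL.lam_ne hc (Finset.mem_of_mem_erase hv) (Finset.ne_of_mem_erase hv).symm, mul_zero]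
  refine ⟨lam L c b, ?_, hlin⟩
  by_contra! hs
  -- The factor is nonzero since `lam L c` is one at `c`. Were it positive, points just off the
  -- common face towards `b` would be interior to both cells.
  rcases hs.eq_or_lt with hs | hs
  · have := hlin c
    rw [← hs, hTL.lam_self hc] at this
    simp at this
  · obtain ⟨x, hx⟩ := openFace_nonempty hTK (Finset.erase_subset b K)
      (hTK.erase_nonempty b)
    have hxL : ∀ v ∈ L.erase c, 0 < lam L v x := by
      have hx' := hx
      rw [openFace_congr hTK hTL (Finset.erase_subset b K) (h ▸ Finset.erase_subset c L), ← h] at hx'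
      exact hx'.1
    have h1 := (eventually_lam_pos hx.1).and (eventually_lam_pos hxL)
    have h2 := (tendsto_lineMap_zero x b).eventually h1
    obtain ⟨t, ⟨ht1, ht2⟩, ht⟩ := (h2.and self_mem_nhdsWithin).exists
    set y := x + t • (b - x)
    have hyb : 0 < lam K b y := by
      rw [lam_lineMap, hx.2 b hb (by simp), hTK.lam_self hb]
      simpa using ht
    have hyK : y ∈ interior (hull K) := hTK.mem_interior_iff.2 fun v hv => by
      by_cases hvb : v = b
      · rwa [hvb]
      · exact ht1 v (Finset.mem_erase.2 ⟨hvb, hv⟩)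
    have hyL : y ∈ interior (hull L) := hTL.mem_interior_iff.2 fun v hv => by
      by_cases hvc : v = c
      · rw [hvc, hlin]; positivity
      · exact ht2 v (Finset.mem_erase.2 ⟨hvc, hv⟩)
    have hne : K ≠ L := by rintro rfl; exact hcK hc
    exact Set.disjoint_left.1 (hS.disjoint_interior hK hL hne) hyK hyL

/-- The cells on the two sides of the face together fill a neighbourhood of the point. -/
theorem mem_dom_of_mem_openFace {K L : Finset E3} (hK : K ∈ S) (hL : L ∈ S) (hne : K ≠ L) {b : E3}
    (hb : b ∈ K) (h : K.erase b ⊆ L) {x : E3} (hx : x ∈ openFace K (K.erase b)) : x ∈ dom S := by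
  obtain ⟨c, hc, hcK, hLK⟩ := hS.exists_erase_eq hK hL hne hb h
  obtain ⟨s, hs, hlin⟩ := hS.exists_neg_lam_eq hK hL hb hc hcK hLK
  have hTK := hS.tet K hK
  have hTL := hS.tet L hL
  have hxL : x ∈ openFace L (L.erase c) := by
    rwa [hLK, openFace_congr hTL hTK h (Finset.erase_subset b K)]
  refine mem_interior_iff_mem_nhds.2 ?_
  filter_upwards [eventually_lam_pos hx.1, eventually_lam_pos hxL.1] with y hyK hyL
  rcases le_total 0 (lam K b y) with h0 | h0
  · refine Set.mem_iUnion₂.2 ⟨K, hK, hTK.mem_hull_iff.2 fun v hv => ?_⟩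
    by_cases hvb : v = b
    · rwa [hvb]
    · exact (hyK v (Finset.mem_erase.2 ⟨hvb, hv⟩)).le
  · refine Set.mem_iUnion₂.2 ⟨L, hL, hTL.mem_hull_iff.2 fun v hv => ?_⟩
    by_cases hvc : v = c
    · rw [hvc, hlin]; exact mul_nonneg_of_nonpos_of_nonpos hs.le h0
    · exact (hyL v (Finset.mem_erase.2 ⟨hvc, hv⟩)).le

/-- Near the relative interior of an outer face only the cell `K` is present, so there the domain is
a half-space. -/
theorem eventually_mem_dom_iff {K : Finset E3} (hK : K ∈ S) {b : E3} (hb : b ∈ K)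
    (h : ∀ L ∈ S, K.erase b ⊆ L → L = K) {x : E3} (hx : x ∈ openFace K (K.erase b)) :
    ∀ᶠ y in 𝓝 x, (y ∈ dom S ↔ 0 < lam K b y) := by
  have hTK := hS.tet K hK
  have h1 : ∀ᶠ y in 𝓝 x, y ∈ ⋃ L ∈ S, hull L → 0 ≤ lam K b y := by
    filter_upwards [eventually_mem_hull S x] with y hy hyS
    obtain ⟨L, hL, hyL⟩ := Set.mem_iUnion₂.1 hyS
    have := h L hL (hS.subset_of_mem_openFace hK hL (Finset.erase_subset b K) hx (hy L hL hyL))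
    exact hTK.mem_hull_iff.1 (this ▸ hyL) b hb
  filter_upwards [h1.eventually_nhds, eventually_lam_pos hx.1] with y hy hyK
  constructor
  · intro hyd
    by_contra! h0
    -- A small step against the gradient stays in the open domain but makes the coordinate of `b`
    -- negative.
    have h2 := (tendsto_lineMap_zero y (y - glam K b)).eventually
      (hy.and ((isOpen_dom S).mem_nhds hyd))
    obtain ⟨t, ⟨ht1, ht2⟩, ht⟩ := (h2.and self_mem_nhdsWithin).exists
    have h3 := ht1 (dom_subset S ht2)
    rw [lam_sub K b _ y] at h3
    have h4 : 0 < inner ℝ (glam K b) (glam K b) :=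
      real_inner_self_pos.2 (hTK.glam_ne_zero hb)
    simp only [sub_sub_cancel_left, add_sub_cancel_left, inner_smul_right, inner_neg_right] at h3
    have ht' : 0 < t := ht
    nlinarith [mul_pos ht' h4]
  · intro h0
    refine interior_hull_subset_dom hK (hTK.mem_interior_iff.2 fun v hv => ?_)
    by_cases hvb : v = b
    · rwa [hvb]
    · exact hyK v (Finset.mem_erase.2 ⟨hvb, hv⟩)

theorem notMem_dom_of_mem_openFace {K : Finset E3} (hK : K ∈ S) {b : E3} (hb : b ∈ K)
    (h : ∀ L ∈ S, K.erase b ⊆ L → L = K) {x : E3} (hx : x ∈ openFace K (K.erase b)) :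
    x ∉ dom S := by
  rw [(hS.eventually_mem_dom_iff hK hb h hx).self_of_nhds, hx.2 b hb (by simp)]
  exact lt_irrefl 0

theorem notMem_dom_of_mem_hull {K : Finset E3} (hK : K ∈ S) {b : E3} (hb : b ∈ K)
    (h : ∀ L ∈ S, K.erase b ⊆ L → L = K) {x : E3} (hx : x ∈ hull (K.erase b)) :
    x ∉ dom S := by
  intro hxd
  obtain ⟨y, hyd, hyF⟩ := mem_closure_iff.1 (hull_subset_closure_openFace (hS.tet K hK)
    (Finset.erase_subset b K) ((hS.tet K hK).erase_nonempty b) hx) _ (isOpen_dom S) hxd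
  exact hS.notMem_dom_of_mem_openFace hK hb h hyF hyd

theorem hull_erase_subset_frontier {K : Finset E3} (hK : K ∈ S) {b : E3} (hb : b ∈ K)
    (h : ∀ L ∈ S, K.erase b ⊆ L → L = K) : hull (K.erase b) ⊆ frontier (dom S) := by
  intro x hx
  rw [(isOpen_dom S).frontier_eq]
  exact ⟨hS.hull_subset_closure hK (hull_mono (Finset.erase_subset b K) hx),
    hS.notMem_dom_of_mem_hull hK hb h hx⟩

/-- A frontier point lies in a cell but not in its interior, so one of its barycentric coordinates
vanishes. -/
theorem exists_mem_hull_erase {x : E3} (hx : x ∈ frontier (dom S)) :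
    ∃ K ∈ S, ∃ b ∈ K, x ∈ hull (K.erase b) := by
  rw [(isOpen_dom S).frontier_eq] at hx
  obtain ⟨K, hK, hxK⟩ := Set.mem_iUnion₂.1 (closure_dom_subset S hx.1)
  have hTK := hS.tet K hK
  have : x ∉ interior (hull K) := fun h => hx.2 (interior_hull_subset_dom hK h)
  rw [hTK.mem_interior_iff] at this
  push Not at this
  obtain ⟨b, hb, hb0⟩ := this
  refine ⟨K, hK, b, hb, (hTK.mem_hull_subset_iff (Finset.erase_subset b K)).2
    ⟨hTK.mem_hull_iff.1 hxK, fun v hv hvb => ?_⟩⟩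
  have : v = b := by by_contra hne; exact hvb (Finset.mem_erase.2 ⟨hne, hv⟩)
  rw [this]; exact le_antisymm hb0 (hTK.mem_hull_iff.1 hxK b hb)

end Conforming

/-! ### Lipschitz domains -/

/-- The upward direction of the coordinate system `e`. -/
def upward (e : E3 ≃ₗᵢ[ℝ] E3) : E3 := e.symm (EuclideanSpace.single 2 1)

theorem apply_add_upward (e : E3 ≃ₗᵢ[ℝ] E3) (x : E3) (t : ℝ) :
    e (x + t • upward e) 2 = e x 2 + t ∧
      !₂[e (x + t • upward e) 0, e (x + t • upward e) 1] = !₂[e x 0, e x 1] := by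
  simp [upward]

theorem continuous_graph (e : E3 ≃ₗᵢ[ℝ] E3) {γ : EuclideanSpace ℝ (Fin 2) → ℝ}
    (hγ : Continuous γ) : Continuous fun y : E3 => γ !₂[e y 0, e y 1] := by
  refine hγ.comp ((PiLp.continuous_toLp 2 _).comp (continuous_pi fun i => ?_))
  have h : ∀ j : Fin 3, Continuous fun y : E3 => e y j := fun j => by fun_prop
  fin_cases i
  · exact h 0
  · exact h 1

theorem continuous_height (e : E3 ≃ₗᵢ[ℝ] E3) : Continuous fun y : E3 => e y 2 := by
  fun_prop

theorem continuous_add_upward (e : E3 ≃ₗᵢ[ℝ] E3) (x : E3) :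
    Continuous fun t : ℝ => x + t • upward e := by fun_prop

/-- A frontier point interior to the closure would have nearby points strictly above the graph that
still belong to the closure, although a neighbourhood of them misses `Ω`. This excludes slits and
makes `Ω` the interior of the union of its cells. -/
theorem IsLipschitzDomain.interior_closure {Ω : Set E3} (h : IsLipschitzDomain Ω) :
    interior (closure Ω) = Ω := by
  refine Set.Subset.antisymm (fun x hx => ?_) (interior_maximal subset_closure h.1)
  by_contra hxΩ
  obtain ⟨e, r, C, γ, hr, hγ, hy⟩ := h.2 x (by
    rw [h.1.frontier_eq]; exact ⟨interior_subset hx, hxΩ⟩)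
  have hx0 : γ !₂[e x 0, e x 1] ≤ e x 2 :=
    not_lt.1 fun hlt => hxΩ ((hy x (Metric.mem_ball_self hr)).2 hlt)
  have h1 : Tendsto (fun t : ℝ => x + t • upward e) (𝓝[>] 0) (𝓝 x) := by
    simpa using ((continuous_add_upward e x).tendsto 0).mono_left nhdsWithin_le_nhds
  obtain ⟨t, ⟨ht1, ht2⟩, ht⟩ := ((h1.eventually ((eventually_mem_set.2 (isOpen_interior.mem_nhds hx)).and
    (eventually_mem_set.2 (Metric.ball_mem_nhds x hr)))).and self_mem_nhdsWithin).exists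
  have ht : 0 < t := ht
  obtain ⟨e1, e2⟩ := apply_add_upward e x t
  obtain ⟨y, ⟨hyb, hyγ⟩, hyΩ⟩ := mem_closure_iff.1 (interior_subset ht1)
    (Metric.ball x r ∩ {y | γ !₂[e y 0, e y 1] < e y 2})
    (Metric.isOpen_ball.inter (isOpen_lt (continuous_graph e hγ.continuous) (continuous_height e)))
    ⟨ht2, by rw [Set.mem_ofPred_eq, e1, e2]; linarith⟩
  exact lt_asymm hyγ ((hy y hyb).1 hyΩ)

/-- Near any point of its closure, a Lipschitz domain is connected: points sufficiently close can be
joined inside a given neighbourhood. -/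
theorem IsLipschitzDomain.exists_isPreconnected {Ω : Set E3} (h : IsLipschitzDomain Ω) {z : E3}
    (hz : z ∈ closure Ω) {U : Set E3} (hU : U ∈ 𝓝 z) :
    ∀ᶠ x in 𝓝 z, x ∈ Ω → ∀ᶠ y in 𝓝 z, y ∈ Ω → ∃ W ⊆ U ∩ Ω, IsPreconnected W ∧ x ∈ W ∧ y ∈ W := by
  by_cases hzΩ : z ∈ Ω
  · obtain ⟨r, hr, hrb⟩ := Metric.mem_nhds_iff.1 (Filter.inter_mem hU (h.1.mem_nhds hzΩ))
    filter_upwards [Metric.ball_mem_nhds z hr] with x hx _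
    filter_upwards [Metric.ball_mem_nhds z hr] with y hy _
    exact ⟨Metric.ball z r, hrb, (convex_ball z r).isPreconnected, hx, hy⟩
  obtain ⟨e, r, C, γ, hr, hγ, hy⟩ := h.2 z (by rw [h.1.frontier_eq]; exact ⟨hz, hzΩ⟩)
  have hz0 : e z 2 ≤ γ !₂[e z 0, e z 1] := by
    by_contra! hlt
    obtain ⟨y, ⟨hyb, hyγ⟩, hyΩ⟩ := mem_closure_iff.1 hz
      (Metric.ball z r ∩ {y | γ !₂[e y 0, e y 1] < e y 2})
      (Metric.isOpen_ball.inter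
        (isOpen_lt (continuous_graph e hγ.continuous) (continuous_height e)))
      ⟨Metric.mem_ball_self hr, hlt⟩
    exact lt_asymm hyγ ((hy y hyb).1 hyΩ)
  obtain ⟨ρ, hρ, hρb⟩ := Metric.mem_nhds_iff.1 (Filter.inter_mem hU (Metric.ball_mem_nhds z hr))
  have hnorm : ‖upward e‖ = 1 := by simp [upward]
  -- Lowering points near `z` by `s` brings them into one small ball inside `Ω`; with half the
  -- radius the vertical segments stay in the ball of radius `ρ`.
  set s : ℝ := ρ / 2 with hs
  set z' : E3 := z + (-s) • upward e with hz'
  have hz'b : z' ∈ Metric.ball z ρ := by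
    rw [Metric.mem_ball, hz', dist_eq_norm, add_sub_cancel_left, norm_smul, hnorm, Real.norm_eq_abs,
      abs_neg, abs_of_pos (by positivity)]
    linarith
  have hz'Ω : z' ∈ Ω := by
    rw [hy z' (hρb hz'b).2]
    obtain ⟨e1, e2⟩ := apply_add_upward e z (-s)
    rw [hz', e1, e2]; linarith
  obtain ⟨ε, hε, hεb⟩ := Metric.mem_nhds_iff.1
    (Filter.inter_mem (h.1.mem_nhds hz'Ω) (Metric.isOpen_ball.mem_nhds hz'b))
  have hpath : ∀ x ∈ Metric.ball z (min ε s) ∩ Ω,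
      IsPreconnected (segment ℝ x (x + (-s) • upward e)) ∧
      segment ℝ x (x + (-s) • upward e) ⊆ U ∩ Ω ∧ x + (-s) • upward e ∈ Metric.ball z' ε := by
    rintro x ⟨hxb, hxΩ⟩
    have hxd := Metric.mem_ball.1 hxb
    have hxρ : ∀ t ∈ Set.Icc (0 : ℝ) 1, x + t • ((x + (-s) • upward e) - x) ∈ Metric.ball z ρ := by
      intro t ht
      rw [Metric.mem_ball, dist_eq_norm, add_sub_cancel_left,
        show x + t • (-s) • upward e - z = (x - z) + (-(t * s)) • upward e by module]
      have h1 := norm_add_le (x - z) ((-(t * s)) • upward e)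
      rw [norm_smul, hnorm, Real.norm_eq_abs, abs_neg, mul_one, ← dist_eq_norm] at h1
      have h2 : |t * s| ≤ s := by
        rw [abs_of_nonneg (mul_nonneg ht.1 (by positivity))]
        exact mul_le_of_le_one_left (by positivity) ht.2
      have := min_le_right ε s
      linarith
    have hxr : x ∈ Metric.ball z r := (hρb (Metric.ball_subset_ball (by
      have := min_le_right ε s; linarith) hxb)).2
    refine ⟨(convex_segment _ _).isPreconnected, fun w hw => ?_, ?_⟩
    · rw [segment_eq_image'] at hw
      obtain ⟨t, ht, rfl⟩ := hw
      have hwρ := hxρ t ht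
      refine ⟨(hρb hwρ).1, ?_⟩
      simp only
      rw [hy _ (hρb hwρ).2, add_sub_cancel_left, smul_smul]
      obtain ⟨e1, e2⟩ := apply_add_upward e x (t * -s)
      rw [e1, e2]
      have h1 := (hy x hxr).1 hxΩ
      have h2 : 0 ≤ t * s := mul_nonneg ht.1 (by positivity)
      linarith
    · rw [Metric.mem_ball, hz', dist_add_right]
      exact hxd.trans_le (min_le_left _ _)
  have hmin : 0 < min ε s := lt_min hε (by positivity)
  filter_upwards [Metric.ball_mem_nhds z hmin] with x hx hxΩ
  filter_upwards [Metric.ball_mem_nhds z hmin] with y hy hyΩ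
  obtain ⟨px, sx, bx⟩ := hpath x ⟨hx, hxΩ⟩
  obtain ⟨py, sy, by'⟩ := hpath y ⟨hy, hyΩ⟩
  refine ⟨(segment ℝ x (x + (-s) • upward e) ∪ Metric.ball z' ε) ∪
    segment ℝ y (y + (-s) • upward e), ?_, ?_, ?_, ?_⟩
  · refine Set.union_subset (Set.union_subset sx fun w hw => ?_) sy
    exact ⟨(hρb (hεb hw).2).1, (hεb hw).1⟩
  · exact (px.union _ (right_mem_segment ℝ _ _) bx (convex_ball _ _).isPreconnected).union _
      (Or.inr by') (right_mem_segment ℝ _ _) py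
  · exact Or.inl (Or.inl (left_mem_segment ℝ _ _))
  · exact Or.inr (left_mem_segment ℝ _ _)

/-! ### Chains of tetrahedra through common faces. -/

theorem exists_mem_hull_of_isPreconnected {S : Finset (Finset E3)} {W : Set E3}
    (hW : IsPreconnected W) (hWS : W ⊆ dom S) {x y : E3} (hx : x ∈ W) (hy : y ∈ W)
    {p : Finset E3 → Prop} {K L : Finset E3} (hK : K ∈ S) (hL : L ∈ S) (hxK : x ∈ hull K)
    (hyL : y ∈ hull L) (hpK : p K) (hpL : ¬ p L) :
    ∃ w ∈ W, ∃ M, (M ∈ S ∧ p M) ∧ ∃ N, (N ∈ S ∧ ¬ p N) ∧ w ∈ hull M ∧ w ∈ hull N := by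
  -- The cells with `p` and the cells without `p` cover the connected set by two closed sets, which
  -- must therefore meet in it.
  have hclosed : ∀ q : Finset E3 → Prop, IsClosed (⋃ M ∈ {M | M ∈ S ∧ q M}, hull M) :=
    fun q => (S.finite_toSet.subset fun M hM => hM.1).isClosed_biUnion fun M _ => isClosed_hull M
  obtain ⟨w, hw, hwA, hwA'⟩ := isPreconnected_closed_iff.1 hW
    _ _ (hclosed p) (hclosed fun M => ¬ p M) (fun w hw => by
      obtain ⟨M, hM, hwM⟩ := Set.mem_iUnion₂.1 (dom_subset S (hWS hw))
      by_cases hpM : p M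
      · exact Or.inl (Set.mem_iUnion₂.2 ⟨M, ⟨hM, hpM⟩, hwM⟩)
      · exact Or.inr (Set.mem_iUnion₂.2 ⟨M, ⟨hM, hpM⟩, hwM⟩))
    ⟨x, hx, Set.mem_iUnion₂.2 ⟨K, ⟨hK, hpK⟩, hxK⟩⟩
    ⟨y, hy, Set.mem_iUnion₂.2 ⟨L, ⟨hL, hpL⟩, hyL⟩⟩
  obtain ⟨M, hM, hwM⟩ := Set.mem_iUnion₂.1 hwA
  obtain ⟨N, hN, hwN⟩ := Set.mem_iUnion₂.1 hwA'
  exact ⟨w, hw, M, hM, N, hN, hwM, hwN⟩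

namespace Conforming

variable {S : Finset (Finset E3)} (hS : Conforming S)
include hS

theorem exists_isOutwardNormal {K : Finset E3} (hK : K ∈ S) {b : E3} (hb : b ∈ K)
    (h : ∀ L ∈ S, K.erase b ⊆ L → L = K) {x : E3} (hx : x ∈ openFace K (K.erase b)) :
    IsOutwardNormal (dom S) x (-(‖glam K b‖⁻¹ • glam K b)) := by
  have hn : 0 < ‖glam K b‖ := norm_pos_iff.2 ((hS.tet K hK).glam_ne_zero hb)
  refine ⟨?_, ?_⟩
  · rw [norm_neg, norm_smul, norm_inv, norm_norm, inv_mul_cancel₀ hn.ne']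
  · obtain ⟨r, hr, hrb⟩ := Metric.eventually_nhds_iff_ball.1 (hS.eventually_mem_dom_iff hK hb h hx)
    refine ⟨r, hr, fun y hy => (hrb y hy).trans ?_⟩
    rw [lam_sub K b y x, hx.2 b hb (by simp), zero_add, inner_neg_right, inner_smul_right,
      real_inner_comm, neg_lt_zero, mul_pos_iff_of_pos_left (inv_pos.2 hn)]

theorem exists_erase_subset {K L : Finset E3} (hK : K ∈ S) (hL : L ∈ S) (hne : K ≠ L)
    (h : 3 ≤ (K ∩ L).card) : ∃ b ∈ K, K.erase b ⊆ L := by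
  obtain ⟨b, hb, hbL⟩ : ∃ b ∈ K, b ∉ L := by
    by_contra! hcon
    exact hne (hS.eq_of_subset hK hL hcon)
  refine ⟨b, hb, ?_⟩
  have h1 : K ∩ L ⊆ K.erase b := fun v hv => by
    rw [Finset.mem_inter] at hv
    refine Finset.mem_erase.2 ⟨?_, hv.1⟩
    rintro rfl; exact hbL hv.2
  rw [← Finset.eq_of_subset_of_card_le h1
    (by rw [Finset.card_erase_of_mem hb, (hS.tet K hK).card]; exact h)]
  exact Finset.inter_subset_right

/-- A generic segment from a cell to another crosses from one cell to the next only through faces,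
so a property passed on across faces is passed on along the segment. -/
theorem chain_of_convex {E : Finset E3} {p : Finset E3 → Prop}
    (hp : ∀ K ∈ S, ∀ L ∈ S, E ⊆ K → E ⊆ L → ∀ b ∈ K, K.erase b ⊆ L → p K → p L)
    {B : Set E3} (hBo : IsOpen B) (hBc : Convex ℝ B) (hBS : B ⊆ dom S)
    (hBE : ∀ L ∈ S, ∀ y ∈ B, y ∈ hull L → E ⊆ L) {K L : Finset E3} (hK : K ∈ S) (hL : L ∈ S)
    (hBK : (interior (hull K) ∩ B).Nonempty) (hBL : (interior (hull L) ∩ B).Nonempty)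
    (hpK : p K) : p L := by
  by_contra hpL
  obtain ⟨x, hxK, hxB⟩ := hBK
  -- The end points `y` for which the segment from `x` may hit an edge or a vertex shared by two
  -- cells.
  set bad : Set E3 := ⋃ M ∈ S, ⋃ N ∈ S, ⋃ (_ : (M ∩ N).card ≤ 2),
    (affineSpan ℝ ((insert x (M ∩ N) : Finset E3) : Set E3) : Set E3) with hbad
  have hnull : volume bad = 0 := by
    refine (measure_biUnion_null_iff S.countable_toSet).2 fun M _ =>
      (measure_biUnion_null_iff S.countable_toSet).2 fun N _ =>
      measure_iUnion_null_iff.2 fun hcard => ?_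
    -- At most two points span at most a line, and `x` enlarges it to at most a plane, which is a
    -- null set.
    refine Measure.addHaar_affineSubspace _ _ fun htop => ?_
    have h2 := finrank_vectorSpan_insert_le_set ℝ ((M ∩ N : Finset E3) : Set E3) x
    have h3 : Module.finrank ℝ (vectorSpan ℝ ((insert x (M ∩ N) : Finset E3) : Set E3)) = 3 := by
      rw [← direction_affineSpan, htop, AffineSubspace.direction_top, finrank_top]
      simp
    rw [Finset.coe_insert] at h3
    rcases (M ∩ N).eq_empty_or_nonempty with he | he
    · rw [he, Finset.coe_empty, insert_empty_eq, vectorSpan_singleton, finrank_bot] at h3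
      omega
    · have h4 := finrank_vectorSpan_image_finset_le ℝ (id : E3 → E3) (M ∩ N) (n := 1)
      have h5 : Module.finrank ℝ (vectorSpan ℝ ((M ∩ N : Finset E3) : Set E3)) ≤ 1 := by
        have h6 : (M ∩ N).card - 1 ≤ 1 := by omega
        refine le_trans ?_ h6
        have := finrank_vectorSpan_image_finset_le ℝ (id : E3 → E3) (M ∩ N)
          (n := (M ∩ N).card - 1) (by have := he.card_pos; omega)
        rwa [Finset.image_id] at this
      omega
  obtain ⟨y, ⟨hyL, hyB⟩, hyb⟩ : ((interior (hull L) ∩ B) \ bad).Nonempty := by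
    refine nonempty_of_measure_ne_zero (μ := volume) ?_
    rw [measure_sdiff_null hnull]
    exact ((isOpen_interior.inter hBo).measure_pos volume hBL).ne'
  have hseg : segment ℝ x y ⊆ B := hBc.segment_subset hxB hyB
  obtain ⟨w, hw, M, hM, N, hN, hwM, hwN⟩ := exists_mem_hull_of_isPreconnected
    (convex_segment x y).isPreconnected (hseg.trans hBS) (left_mem_segment ℝ x y)
    (right_mem_segment ℝ x y) hK hL (interior_subset hxK) (interior_subset hyL) hpK hpL
  have hwMN : w ∈ hull (M ∩ N) := hS.inter M hM.1 N hN.1 ▸ ⟨hwM, hwN⟩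
  have hcard : (M ∩ N).card ≤ 2 := by
    by_contra! hcon
    obtain ⟨b, hb, hbN⟩ := hS.exists_erase_subset hM.1 hN.1 (fun h => hN.2 (h ▸ hM.2)) hcon
    exact hN.2 (hp M hM.1 N hN.1 (hBE M hM.1 w (hseg hw) hwM) (hBE N hN.1 w (hseg hw) hwN)
      b hb hbN hM.2)
  -- The point `x` is interior to `K`, so a cell containing it has all four vertices of `K`, while
  -- `M` and `N` share at most two.
  have hwx : w ≠ x := by
    rintro rfl
    rw [← openFace_self (hS.tet K hK)] at hxK
    have h1 := hS.subset_of_mem_openFace hK hM.1 subset_rfl hxK hwM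
    have h2 := hS.subset_of_mem_openFace hK hN.1 subset_rfl hxK hwN
    have := Finset.card_le_card (Finset.subset_inter h1 h2)
    rw [(hS.tet K hK).card] at this
    omega
  refine hyb (Set.mem_iUnion₂.2 ⟨M, hM.1, Set.mem_iUnion₂.2 ⟨N, hN.1, Set.mem_iUnion.2
    ⟨hcard, ?_⟩⟩⟩)
  rw [segment_eq_image'] at hw
  obtain ⟨t, ht, rfl⟩ := hw
  have ht0 : t ≠ 0 := by rintro rfl; simp at hwx
  have hx1 : x ∈ affineSpan ℝ ((insert x (M ∩ N) : Finset E3) : Set E3) :=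
    subset_affineSpan _ _ (by simp)
  have hw1 : x + t • (y - x) ∈ affineSpan ℝ ((insert x (M ∩ N) : Finset E3) : Set E3) :=
    convexHull_subset_affineSpan _ (convexHull_mono (by simp) hwMN)
  -- The line through `x` and `w` reaches `y` at the parameter `t⁻¹`, which puts `y` into the bad
  -- set.
  have := AffineMap.lineMap_mem t⁻¹ hx1 hw1
  rwa [AffineMap.lineMap_apply_module', add_sub_cancel_left, smul_smul, inv_mul_cancel₀ ht0,
    one_smul, sub_add_cancel] at this

/-- Tetrahedra with a common vertex or edge are linked by a chain of tetrahedra with common faces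
that all share the vertex or edge. -/
theorem chain (hL : IsLipschitzDomain (dom S)) {E : Finset E3} (hE : E.Nonempty)
    {p : Finset E3 → Prop}
    (hp : ∀ K ∈ S, ∀ L ∈ S, E ⊆ K → E ⊆ L → ∀ b ∈ K, K.erase b ⊆ L → p K → p L)
    {K L : Finset E3} (hKS : K ∈ S) (hLS : L ∈ S) (hEK : E ⊆ K) (hEL : E ⊆ L) (hpK : p K) :
    p L := by
  obtain ⟨z, hz⟩ := openFace_nonempty (hS.tet K hKS) hEK hE
  have hzK : z ∈ hull K := hull_mono hEK (openFace_subset (hS.tet K hKS) hEK hz)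
  have hzL : z ∈ hull L := by
    rw [openFace_congr (hS.tet K hKS) (hS.tet L hLS) hEK hEL] at hz
    exact hull_mono hEL (openFace_subset (hS.tet L hLS) hEL hz)
  -- Since `z` is in the relative interior of the simplex `E`, every cell met close to `z` contains
  -- `E`; chains found there stay among those cells.
  have hU : ∀ᶠ y in 𝓝 z, ∀ M ∈ S, y ∈ hull M → E ⊆ M := by
    filter_upwards [eventually_mem_hull S z] with y hy M hM hyM
    exact hS.subset_of_mem_openFace hKS hM hEK hz (hy M hM hyM)
  obtain ⟨U, hUE, hUo, hzU⟩ := eventually_nhds_iff.1 hU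
  obtain ⟨x, hxc, hxK⟩ := mem_closure_iff_nhds.1 ((hS.tet K hKS).closure_interior ▸ hzK)
    _ (hL.exists_isPreconnected (hS.hull_subset_closure hKS hzK) (hUo.mem_nhds hzU))
  obtain ⟨y, hyc, hyL⟩ := mem_closure_iff_nhds.1 ((hS.tet L hLS).closure_interior ▸ hzL)
    _ (hxc (interior_hull_subset_dom hKS hxK))
  obtain ⟨W, hWU, hW, hxW, hyW⟩ := hyc (interior_hull_subset_dom hLS hyL)
  -- Connectedness only provides a common point `w` of two cells, which may touch there in an edge
  -- or a vertex. A ball around `w` inside the domain reduces this to the convex case.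
  by_contra hpL
  obtain ⟨w, hw, M, hM, N, hN, hwM, hwN⟩ := exists_mem_hull_of_isPreconnected hW
    (hWU.trans Set.inter_subset_right) hxW hyW hKS hLS (interior_subset hxK) (interior_subset hyL)
    hpK hpL
  obtain ⟨r, hr, hrb⟩ := Metric.mem_nhds_iff.1
    ((hUo.inter (isOpen_dom S)).mem_nhds ⟨(hWU hw).1, (hWU hw).2⟩)
  have hmeet : ∀ M ∈ S, w ∈ hull M → (interior (hull M) ∩ Metric.ball w r).Nonempty := by
    intro M hM hwM
    rw [Set.inter_comm]
    rw [← (hS.tet M hM).closure_interior] at hwM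
    exact mem_closure_iff_nhds.1 hwM _ (Metric.ball_mem_nhds w hr)
  exact hN.2 (hS.chain_of_convex hp Metric.isOpen_ball (convex_ball w r)
    (fun y hy => (hrb hy).2) (fun L hL y hy => hUE y (hrb hy).1 L hL) hM.1 hN.1
    (hmeet M hM.1 hwM) (hmeet N hN.1 hwN) hM.2)

/-- A piecewise affine function on a patch that is continuous across the faces that share the
common vertex is continuous. -/
theorem affine_agree (hL : IsLipschitzDomain (dom S)) {a : E3} {c : Finset E3 → ℝ}
    {d : Finset E3 → E3}
    (hface : ∀ K ∈ S, ∀ L ∈ S, a ∈ K → a ∈ L → ∀ b ∈ K, K.erase b ⊆ L →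
      ∀ v ∈ K.erase b, c K + inner ℝ (d K) v = c L + inner ℝ (d L) v)
    {K L : Finset E3} (hKS : K ∈ S) (hLS : L ∈ S) (haK : a ∈ K) (haL : a ∈ L) {x : E3}
    (hxK : x ∈ hull K) (hxL : x ∈ hull L) :
    c K + inner ℝ (d K) x = c L + inner ℝ (d L) x := by
  have hvert : ∀ v ∈ K ∩ L, c K + inner ℝ (d K) v = c L + inner ℝ (d L) v := by
    intro v hv
    rw [Finset.mem_inter] at hv
    -- All faces in a chain around the edge from `a` to `v` contain `v`, so the value at `v` is
    -- carried along the chain.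
    refine hS.chain hL (E := {a, v}) ⟨a, by simp⟩
      (p := fun M => c K + inner ℝ (d K) v = c M + inner ℝ (d M) v) ?_ hKS hLS
      (by simp [Finset.insert_subset_iff, haK, hv.1]) (by simp [Finset.insert_subset_iff, haL, hv.2])
      rfl
    intro M hM N hN hEM hEN b hb hMN hpM
    have hvM : v ∈ M := hEM (by simp)
    have hvN : v ∈ N := hEN (by simp)
    by_cases hMN' : M = N
    · rw [← hMN']; exact hpM
    · refine hpM.trans (hface M hM N hN (hEM (by simp)) (hEN (by simp)) b hb hMN v
        (Finset.mem_erase.2 ⟨?_, hvM⟩))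
      rintro rfl
      refine hMN' (hS.eq_of_subset hM hN fun u hu => ?_)
      by_cases huv : u = v
      · rwa [huv]
      · exact hMN (Finset.mem_erase.2 ⟨huv, hu⟩)
  have hx : x ∈ hull (K ∩ L) := hS.inter K hKS L hLS ▸ ⟨hxK, hxL⟩
  obtain ⟨w, -, w1, rfl⟩ := Finset.mem_convexHull'.1 hx
  have key : ∀ M : Finset E3, c M + inner ℝ (d M) (∑ v ∈ K ∩ L, w v • v)
      = ∑ v ∈ K ∩ L, w v * (c M + inner ℝ (d M) v) := by
    intro M
    simp only [inner_sum, inner_smul_right, mul_add, Finset.sum_add_distrib, ← Finset.sum_mul, w1,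
      one_mul]
  rw [key, key]
  exact Finset.sum_congr rfl fun v hv => by rw [hvert v hv]

end Conforming

/-! ### Affine charts of tetrahedra and faces -/

/-- An enumeration of the vertices of a tetrahedron that starts with a distinguished vertex. -/
structure IsFrame (K : Finset E3) (b w₀ w₁ w₂ : E3) : Prop where
  tet : IsTet K
  memb : b ∈ K
  mem₀ : w₀ ∈ K
  mem₁ : w₁ ∈ K
  mem₂ : w₂ ∈ K
  ne₀ : w₀ ≠ b
  ne₁ : w₁ ≠ b
  ne₂ : w₂ ≠ b
  ne₀₁ : w₀ ≠ w₁
  ne₀₂ : w₀ ≠ w₂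
  ne₁₂ : w₁ ≠ w₂
  erase : K.erase b = {w₀, w₁, w₂}

theorem IsTet.exists_isFrame {K : Finset E3} (hK : IsTet K) {b : E3} (hb : b ∈ K) :
    ∃ w₀ w₁ w₂, IsFrame K b w₀ w₁ w₂ := by
  obtain ⟨w₀, w₁, w₂, h01, h02, h12, he⟩ := Finset.card_eq_three.1
    (show (K.erase b).card = 3 by rw [Finset.card_erase_of_mem hb, hK.card])
  have hm : ∀ w ∈ ({w₀, w₁, w₂} : Finset E3), w ∈ K ∧ w ≠ b := fun w hw => by
    rw [← he] at hw
    exact ⟨Finset.mem_of_mem_erase hw, Finset.ne_of_mem_erase hw⟩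
  exact ⟨w₀, w₁, w₂, hK, hb, (hm w₀ (by simp)).1, (hm w₁ (by simp)).1, (hm w₂ (by simp)).1,
    (hm w₀ (by simp)).2, (hm w₁ (by simp)).2, (hm w₂ (by simp)).2, h01, h02, h12, he⟩

/-- The linear part of the chart of a tetrahedron. -/
def chartLin (b w₀ w₁ w₂ : E3) : ℝ × ℝ × ℝ →ₗ[ℝ] E3 :=
  (LinearMap.fst ℝ ℝ (ℝ × ℝ)).smulRight (b - w₀) +
    (((LinearMap.fst ℝ ℝ ℝ).smulRight (w₁ - w₀) +
      (LinearMap.snd ℝ ℝ ℝ).smulRight (w₂ - w₀)) ∘ₗ LinearMap.snd ℝ ℝ (ℝ × ℝ))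

theorem chartLin_apply (b w₀ w₁ w₂ : E3) (p : ℝ × ℝ × ℝ) :
    chartLin b w₀ w₁ w₂ p = p.1 • (b - w₀) + (p.2.1 • (w₁ - w₀) + p.2.2 • (w₂ - w₀)) := rfl

/-- The chart of a tetrahedron: the first coordinate is the barycentric coordinate of `b`, so that
it vanishes on the face opposite to `b`. -/
def chart (b w₀ w₁ w₂ : E3) (p : ℝ × ℝ × ℝ) : E3 := w₀ + chartLin b w₀ w₁ w₂ p

theorem continuous_chart (b w₀ w₁ w₂ : E3) : Continuous (chart b w₀ w₁ w₂) :=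
  continuous_const.add (LinearMap.continuous_of_finiteDimensional _)

namespace IsFrame

variable {K : Finset E3} {b w₀ w₁ w₂ : E3} (h : IsFrame K b w₀ w₁ w₂)
include h

omit h in
theorem inner_glam_chartLin (v : E3) (p : ℝ × ℝ × ℝ) :
    inner ℝ (glam K v) (chartLin b w₀ w₁ w₂ p) = p.1 * (lam K v b - lam K v w₀) +
      (p.2.1 * (lam K v w₁ - lam K v w₀) + p.2.2 * (lam K v w₂ - lam K v w₀)) := by
  simp only [chartLin_apply, inner_add_right, inner_smul_right, inner_glam_sub]

theorem inner_glam_chartLin_all (p : ℝ × ℝ × ℝ) :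
    inner ℝ (glam K b) (chartLin b w₀ w₁ w₂ p) = p.1 ∧
    inner ℝ (glam K w₁) (chartLin b w₀ w₁ w₂ p) = p.2.1 ∧
    inner ℝ (glam K w₂) (chartLin b w₀ w₁ w₂ p) = p.2.2 ∧
    inner ℝ (glam K w₀) (chartLin b w₀ w₁ w₂ p) = -p.1 - p.2.1 - p.2.2 := by
  have hK := h.tet
  simp only [inner_glam_chartLin, hK.lam_self h.memb, hK.lam_self h.mem₀, hK.lam_self h.mem₁,
    hK.lam_self h.mem₂, hK.lam_ne h.memb h.mem₀ h.ne₀.symm, hK.lam_ne h.memb h.mem₁ h.ne₁.symm,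
    hK.lam_ne h.memb h.mem₂ h.ne₂.symm, hK.lam_ne h.mem₀ h.memb h.ne₀,
    hK.lam_ne h.mem₁ h.memb h.ne₁, hK.lam_ne h.mem₂ h.memb h.ne₂, hK.lam_ne h.mem₀ h.mem₁ h.ne₀₁,
    hK.lam_ne h.mem₀ h.mem₂ h.ne₀₂, hK.lam_ne h.mem₁ h.mem₂ h.ne₁₂,
    hK.lam_ne h.mem₁ h.mem₀ h.ne₀₁.symm, hK.lam_ne h.mem₂ h.mem₀ h.ne₀₂.symm,
    hK.lam_ne h.mem₂ h.mem₁ h.ne₁₂.symm]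
  refine ⟨?_, ?_, ?_, ?_⟩ <;> ring

theorem lam_chart (p : ℝ × ℝ × ℝ) :
    lam K b (chart b w₀ w₁ w₂ p) = p.1 ∧ lam K w₁ (chart b w₀ w₁ w₂ p) = p.2.1 ∧
    lam K w₂ (chart b w₀ w₁ w₂ p) = p.2.2 ∧
    lam K w₀ (chart b w₀ w₁ w₂ p) = 1 - p.1 - p.2.1 - p.2.2 := by
  have hK := h.tet
  obtain ⟨h1, h2, h3, h4⟩ := h.inner_glam_chartLin_all p
  have key : ∀ v, lam K v (chart b w₀ w₁ w₂ p) =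
      lam K v w₀ + inner ℝ (glam K v) (chartLin b w₀ w₁ w₂ p) := fun v => by
    rw [lam_sub K v _ w₀, chart, add_sub_cancel_left]
  simp only [key, h1, h2, h3, h4, hK.lam_self h.mem₀, hK.lam_ne h.memb h.mem₀ h.ne₀.symm, hK.lam_ne h.mem₁ h.mem₀ h.ne₀₁.symm,
    hK.lam_ne h.mem₂ h.mem₀ h.ne₀₂.symm]
  refine ⟨?_, ?_, ?_, ?_⟩ <;> ring

theorem chartLin_injective : Function.Injective (chartLin b w₀ w₁ w₂) := by
  rw [← LinearMap.ker_eq_bot, LinearMap.ker_eq_bot']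
  intro p hp
  obtain ⟨h1, h2, h3, -⟩ := h.inner_glam_chartLin_all p
  rw [hp, inner_zero_right] at h1 h2 h3
  exact Prod.ext h1.symm (Prod.ext h2.symm h3.symm)

theorem forall_mem {q : E3 → Prop} : (∀ v ∈ K, q v) ↔ q b ∧ q w₀ ∧ q w₁ ∧ q w₂ := by
  rw [← Finset.insert_erase h.memb, h.erase]
  simp

theorem chart_mem_hull (p : ℝ × ℝ × ℝ) : chart b w₀ w₁ w₂ p ∈ hull K ↔
    0 ≤ p.1 ∧ 0 ≤ 1 - p.1 - p.2.1 - p.2.2 ∧ 0 ≤ p.2.1 ∧ 0 ≤ p.2.2 := by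
  obtain ⟨h1, h2, h3, h4⟩ := h.lam_chart p
  rw [h.tet.mem_hull_iff, h.forall_mem, h1, h2, h3, h4]

theorem chart_mem_face (p : ℝ × ℝ) : chart b w₀ w₁ w₂ (0, p) ∈ hull (K.erase b) ↔
    0 ≤ 1 - p.1 - p.2 ∧ 0 ≤ p.1 ∧ 0 ≤ p.2 := by
  obtain ⟨h1, -, -, -⟩ := h.lam_chart (0, p)
  rw [h.tet.mem_hull_subset_iff (Finset.erase_subset b K), ← h.tet.mem_hull_iff, h.chart_mem_hull]
  simp only [le_refl, true_and, sub_zero, and_iff_left_iff_imp]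
  intro _ v hv hvb
  rw [Finset.mem_erase, not_and_or, not_not] at hvb
  rw [hvb.resolve_right (not_not.2 hv), h1]

/-- The chart is affine, so it carries Lebesgue measure to a Haar measure, unique up to a factor;
the factor is not needed. -/
theorem exists_integral_chart : ∃ C : ℝ, 0 < C ∧
    ∀ f : E3 → ℝ, ∫ x, f x = C * ∫ p : ℝ × ℝ × ℝ, f (chart b w₀ w₁ w₂ p) := by
  set Ψ : (ℝ × ℝ × ℝ) ≃L[ℝ] E3 := (LinearMap.linearEquivOfInjective (chartLin b w₀ w₁ w₂)
    h.chartLin_injective (by simp)).toContinuousLinearEquiv with hΨ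
  have hv : Measure.IsAddHaarMeasure (volume : Measure (ℝ × ℝ × ℝ)) :=
    Measure.prod.instIsAddHaarMeasure (volume : Measure ℝ) (volume : Measure (ℝ × ℝ))
  have hm : Measure.IsAddHaarMeasure (Measure.map Ψ (volume : Measure (ℝ × ℝ × ℝ))) :=
    Ψ.isAddHaarMeasure_map _
  have hC := Measure.isAddLeftInvariant_eq_smul (volume : Measure E3)
    (Measure.map Ψ (volume : Measure (ℝ × ℝ × ℝ)))
  refine ⟨_, NNReal.coe_pos.2 (Measure.addHaarScalarFactor_pos_of_isAddHaarMeasure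
    (volume : Measure E3) (Measure.map Ψ (volume : Measure (ℝ × ℝ × ℝ)))), fun f => ?_⟩
  rw [← integral_add_left_eq_self f w₀]
  conv_lhs => rw [hC]
  have hΨe : MeasurableEmbedding Ψ := Ψ.toHomeomorph.isClosedEmbedding.measurableEmbedding
  rw [integral_smul_nnreal_measure, hΨe.integral_map]
  rfl

/-- Two-dimensional Hausdorff measure on the direction plane of the face is a Haar measure, hence a
multiple of the image of Lebesgue measure. The translation to the face is an isometry. -/
theorem exists_restrict_chart : ∃ C : NNReal, 0 < C ∧
    (Measure.hausdorffMeasure 2 : Measure E3).restrict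
        (Set.range fun p : ℝ × ℝ => chart b w₀ w₁ w₂ (0, p)) =
      C • Measure.map (fun p : ℝ × ℝ => chart b w₀ w₁ w₂ (0, p)) volume := by
  set β : ℝ × ℝ →ₗ[ℝ] E3 := chartLin b w₀ w₁ w₂ ∘ₗ LinearMap.inr ℝ ℝ (ℝ × ℝ) with hβ
  have hβi : Function.Injective β :=
    h.chartLin_injective.comp LinearMap.inr_injective
  set e : (ℝ × ℝ) ≃L[ℝ] (LinearMap.range β) :=
    (LinearEquiv.ofInjective β hβi).toContinuousLinearEquiv with he
  have hfin : Module.finrank ℝ (LinearMap.range β) = 2 := by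
    rw [LinearMap.finrank_range_of_inj hβi]; simp
  have hH : Measure.IsAddHaarMeasure (Measure.hausdorffMeasure 2 : Measure (LinearMap.range β)) := by
    have := isAddHaarMeasure_hausdorffMeasure (E := LinearMap.range β)
    rwa [hfin] at this
  have hm : Measure.IsAddHaarMeasure (Measure.map e (volume : Measure (ℝ × ℝ))) :=
    e.isAddHaarMeasure_map _
  have hC := Measure.isAddLeftInvariant_eq_smul
    (Measure.hausdorffMeasure 2 : Measure (LinearMap.range β)) (Measure.map e volume)
  refine ⟨_, Measure.addHaarScalarFactor_pos_of_isAddHaarMeasure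
    (Measure.hausdorffMeasure 2 : Measure (LinearMap.range β)) (Measure.map e volume), ?_⟩
  set ι : LinearMap.range β → E3 := fun y => w₀ + y with hι
  have hiso : Isometry ι := (isometry_add_left w₀).comp isometry_subtype_coe
  have hcomp : (fun p : ℝ × ℝ => chart b w₀ w₁ w₂ (0, p)) = ι ∘ e := rfl
  have hrange : Set.range (ι ∘ e) = Set.range ι := e.surjective.range_comp ι
  rw [hcomp, hrange, ← hiso.map_hausdorffMeasure (Or.inl (by norm_num)),
    ← Measure.map_map hiso.continuous.measurable e.continuous.measurable]
  conv_lhs => rw [hC]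
  rw [Measure.map_smul]

theorem hull_face_subset_range :
    hull (K.erase b) ⊆ Set.range fun p : ℝ × ℝ => chart b w₀ w₁ w₂ (0, p) := by
  intro x hx
  have hx' := (h.tet.mem_hull_subset_iff (Finset.erase_subset b K)).1 hx
  refine ⟨(lam K w₁ x, lam K w₂ x), ?_⟩
  have h1 := h.tet.sum_lam_smul x
  have h2 := h.tet.sum_lam x
  rw [← Finset.add_sum_erase K _ h.memb, h.erase, Finset.sum_insert (by simp [h.ne₀₁, h.ne₀₂]),
    Finset.sum_insert (by simp [h.ne₁₂]), Finset.sum_singleton] at h1 h2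
  rw [hx'.2 b h.memb (by simp)] at h1 h2
  conv_rhs => rw [← h1]
  simp only [chart, chartLin_apply]
  rw [show lam K w₀ x = 1 - lam K w₁ x - lam K w₂ x by linarith]
  module

omit h in
theorem measurable_chart_face : Measurable fun p : ℝ × ℝ => chart b w₀ w₁ w₂ (0, p) :=
  ((continuous_chart b w₀ w₁ w₂).comp (by fun_prop)).measurable

omit h in
theorem continuous_chart_face : Continuous fun p : ℝ × ℝ => chart b w₀ w₁ w₂ (0, p) :=
  (continuous_chart b w₀ w₁ w₂).comp (by fun_prop)

theorem injective_chart_face : Function.Injective fun p : ℝ × ℝ => chart b w₀ w₁ w₂ (0, p) := by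
  intro p q hpq
  have := h.chartLin_injective (add_left_cancel hpq)
  exact (Prod.mk.inj this).2

theorem hausdorffMeasure_face_lt_top :
    (Measure.hausdorffMeasure 2 : Measure E3) (hull (K.erase b)) < ⊤ := by
  obtain ⟨C, -, hC⟩ := h.exists_restrict_chart
  rw [← Set.inter_eq_left.2 h.hull_face_subset_range,
    ← Measure.restrict_apply (measurableSet_hull _), hC, Measure.smul_apply,
    Measure.map_apply measurable_chart_face (measurableSet_hull _)]
  refine ENNReal.mul_lt_top ENNReal.coe_lt_top ?_
  refine (measure_mono (fun p hp => ?_)).trans_lt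
    ((isCompact_Icc (a := ((0 : ℝ), (0 : ℝ))) (b := (1, 1))).measure_lt_top)
  have := (h.chart_mem_face p).1 hp
  exact ⟨⟨this.2.1, this.2.2⟩, ⟨by simp only; linarith, by simp only; linarith⟩⟩

theorem hausdorffMeasure_face_inter_pos {U : Set E3} (hU : IsOpen U) {x : E3} (hx : x ∈ U)
    (hxF : x ∈ openFace K (K.erase b)) :
    0 < (Measure.hausdorffMeasure 2 : Measure E3) (U ∩ hull (K.erase b)) := by
  obtain ⟨C, hC0, hC⟩ := h.exists_restrict_chart
  set φ := fun p : ℝ × ℝ => chart b w₀ w₁ w₂ (0, p) with hφ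
  obtain ⟨p, hp⟩ := h.hull_face_subset_range (openFace_subset h.tet (Finset.erase_subset b K) hxF)
  set V : Set E3 := U ∩ {y | ∀ v ∈ K.erase b, 0 < lam K v y} with hV
  have hVo : IsOpen V := by
    refine hU.inter ?_
    rw [isOpen_iff_mem_nhds]
    exact fun y hy => eventually_lam_pos hy
  have hpos : 0 < volume (φ ⁻¹' V) :=
    (hVo.preimage continuous_chart_face).measure_pos volume ⟨p, by
      change φ p ∈ V
      have hp : φ p = x := hp
      rw [hp]; exact ⟨hx, hxF.1⟩⟩
  have hsub : φ ⁻¹' V ⊆ φ ⁻¹' (U ∩ hull (K.erase b)) := by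
    intro q hq
    refine ⟨hq.1, openFace_subset h.tet (Finset.erase_subset b K) ⟨hq.2, fun v hv hvb => ?_⟩⟩
    rw [Finset.mem_erase, not_and_or, not_not] at hvb
    rw [hvb.resolve_right (not_not.2 hv)]
    exact (h.lam_chart (0, q)).1
  have hmeas : MeasurableSet (U ∩ hull (K.erase b)) := hU.measurableSet.inter (measurableSet_hull _)
  rw [← Set.inter_eq_left.2 (Set.inter_subset_right.trans h.hull_face_subset_range :
      U ∩ hull (K.erase b) ⊆ Set.range φ),
    ← Measure.restrict_apply hmeas, hC, Measure.smul_apply,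
    Measure.map_apply measurable_chart_face hmeas]
  exact ENNReal.mul_pos (by simpa using hC0.ne') (hpos.trans_le (measure_mono hsub)).ne'

/-- The face in the chart: the integral over the face as an integral over a triangle. -/
theorem exists_integral_face : ∃ C : ℝ, 0 < C ∧ ∀ f : E3 → ℝ,
    ∫ x in hull (K.erase b), f x ∂(Measure.hausdorffMeasure 2 : Measure E3) =
      C * ∫ p in {p : ℝ × ℝ | 0 < p.1 ∧ 0 < p.2 ∧ p.1 + p.2 < 1}, f (chart b w₀ w₁ w₂ (0, p)) := by
  obtain ⟨C, hC0, hC⟩ := h.exists_restrict_chart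
  refine ⟨C, NNReal.coe_pos.2 hC0, fun f => ?_⟩
  set φ := fun p : ℝ × ℝ => chart b w₀ w₁ w₂ (0, p) with hφ
  have hφe : MeasurableEmbedding φ :=
    continuous_chart_face.measurableEmbedding h.injective_chart_face
  -- Closed and open triangle differ by the boundary of a convex set, which is null.
  have hae : φ ⁻¹' (hull (K.erase b)) =ᵐ[volume]
      ({p : ℝ × ℝ | 0 < p.1 ∧ 0 < p.2 ∧ p.1 + p.2 < 1} : Set (ℝ × ℝ)) := by
    have hset : φ ⁻¹' (hull (K.erase b)) = {p : ℝ × ℝ | 0 ≤ 1 - p.1 - p.2 ∧ 0 ≤ p.1 ∧ 0 ≤ p.2} := by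
      ext p; exact h.chart_mem_face p
    have hconv : Convex ℝ {p : ℝ × ℝ | 0 ≤ 1 - p.1 - p.2 ∧ 0 ≤ p.1 ∧ 0 ≤ p.2} := by
      rintro ⟨p1, p2⟩ ⟨hp1, hp2, hp3⟩ ⟨q1, q2⟩ ⟨hq1, hq2, hq3⟩ s t hs ht hst
      simp only [Prod.smul_mk, Prod.mk_add_mk, smul_eq_mul, Set.mem_ofPred_eq] at *
      refine ⟨?_, by positivity, by positivity⟩
      have : 1 - (s * p1 + t * q1) - (s * p2 + t * q2)
        = s * (1 - p1 - p2) + t * (1 - q1 - q2) := by linear_combination -hst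
      rw [this]; positivity
    rw [hset]
    refine ((interior_ae_eq_of_null_frontier (hconv.addHaar_frontier volume)).symm).trans ?_
    refine EventuallyEq.of_eq (Set.Subset.antisymm (fun p hp => ?_) ?_)
    -- Shifting an interior point slightly both ways along the diagonal makes each of the three weak
    -- inequalities strict.
    · have hcont : ∀ c : ℝ, Tendsto (fun t : ℝ => p + (t * c) • ((1 : ℝ), (1 : ℝ))) (𝓝[>] 0) (𝓝 p) := by
        intro c
        have : Continuous fun t : ℝ => p + (t * c) • ((1 : ℝ), (1 : ℝ)) := by fun_prop
        simpa using (this.tendsto 0).mono_left nhdsWithin_le_nhds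
      have hmem := isOpen_interior.mem_nhds hp
      obtain ⟨t, ⟨ht1, ht2⟩, ht⟩ := (((hcont 1).eventually hmem).and
        ((hcont (-1)).eventually hmem) |>.and self_mem_nhdsWithin).exists
      have ht : 0 < t := ht
      have h1 := interior_subset ht1
      have h2 := interior_subset ht2
      simp only [Set.mem_ofPred_eq, Prod.fst_add, Prod.snd_add, Prod.smul_fst, Prod.smul_snd,
        smul_eq_mul] at h1 h2
      exact ⟨by linarith, by linarith, by linarith⟩
    · refine interior_maximal (fun p hp => ⟨?_, hp.1.le, hp.2.1.le⟩) ?_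
      · have := hp.2.2; linarith
      · exact (isOpen_lt continuous_const continuous_fst).inter
          ((isOpen_lt continuous_const continuous_snd).inter
            (isOpen_lt (continuous_fst.add continuous_snd) continuous_const))
  rw [← Set.inter_eq_left.2 h.hull_face_subset_range, ← Measure.restrict_restrict
    (measurableSet_hull _), hC, Measure.restrict_smul, integral_smul_nnreal_measure,
    hφe.setIntegral_map, setIntegral_congr_set hae]
  rfl

end IsFrame

/-! ### Smooth cut-off functions -/

/-- A smooth step function: zero up to `1` and one from `2` on. -/
def step (t : ℝ) : ℝ := Real.smoothTransition (t - 1)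

theorem contDiff_step : ContDiff ℝ ∞ step :=
  Real.smoothTransition.contDiff.comp (contDiff_id.sub contDiff_const)

theorem continuous_step : Continuous step := contDiff_step.continuous

theorem step_of_le {t : ℝ} (h : t ≤ 1) : step t = 0 :=
  Real.smoothTransition.zero_of_nonpos (by linarith)

theorem step_of_ge {t : ℝ} (h : 2 ≤ t) : step t = 1 :=
  Real.smoothTransition.one_of_one_le (by linarith)

theorem abs_step_le (t : ℝ) : |step t| ≤ 1 :=
  abs_le.2 ⟨by have := Real.smoothTransition.nonneg (t - 1); unfold step; linarith,
    Real.smoothTransition.le_one _⟩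

theorem hasDerivAt_step (t : ℝ) : HasDerivAt step (deriv step t) t :=
  ((contDiff_step.differentiable (by simp)) t).hasDerivAt

theorem continuous_deriv_step : Continuous (deriv step) :=
  contDiff_step.continuous_deriv (by simp)

theorem deriv_step_of_notMem {t : ℝ} (h : t ∉ Set.Icc (1 : ℝ) 2) : deriv step t = 0 := by
  rw [Set.mem_Icc, not_and_or, not_le, not_le] at h
  have key : ∀ c : ℝ, step =ᶠ[𝓝 t] (fun _ => c) → deriv step t = 0 := fun c hc => by
    rw [hc.deriv_eq, deriv_const]
  rcases h with h | h
  · exact key 0 (by filter_upwards [gt_mem_nhds h] with s hs; exact step_of_le hs.le)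
  · exact key 1 (by filter_upwards [lt_mem_nhds h] with s hs; exact step_of_ge hs.le)

theorem hasCompactSupport_deriv_step : HasCompactSupport (deriv step) :=
  HasCompactSupport.intro isCompact_Icc fun _ h => deriv_step_of_notMem h

theorem integral_deriv_step : ∫ t, deriv step t = 1 := by
  have h := integral_of_hasDerivAt_of_tendsto (f := step) (m := 0) (n := 1) hasDerivAt_step
    (continuous_deriv_step.integrable_of_hasCompactSupport hasCompactSupport_deriv_step)
    (tendsto_const_nhds.congr' ?_) (tendsto_const_nhds.congr' ?_)
  · simpa using h
  · filter_upwards [eventually_le_atBot 1] with t ht using (step_of_le ht).symm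
  · filter_upwards [eventually_ge_atTop 2] with t ht using (step_of_ge ht).symm

theorem exists_abs_deriv_step_le : ∃ M, 0 ≤ M ∧ ∀ t, |deriv step t| ≤ M := by
  obtain ⟨M, hM⟩ := continuous_deriv_step.bounded_above_of_compact_support
    hasCompactSupport_deriv_step
  exact ⟨M, (norm_nonneg _).trans (hM 0), hM⟩

theorem tendsto_step_div {c : ℝ} : Tendsto (fun δ : ℝ => step (c / δ)) (𝓝[>] 0)
    (𝓝 (if 0 < c then 1 else 0)) := by
  refine tendsto_const_nhds.congr' ?_
  split_ifs with hc
  · filter_upwards [Ioo_mem_nhdsGT (by positivity : (0 : ℝ) < c / 2)] with δ hδ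
    rw [step_of_ge]
    rw [le_div_iff₀ hδ.1]; linarith [hδ.2]
  · filter_upwards [self_mem_nhdsWithin] with δ hδ
    rw [step_of_le]
    exact (div_nonpos_of_nonpos_of_nonneg (not_lt.1 hc) (le_of_lt hδ)).trans zero_le_one

theorem step_div_eq_zero {c δ : ℝ} (hδ : 0 < δ) (hc : c ≤ 0) : step (c / δ) = 0 :=
  step_of_le ((div_nonpos_of_nonpos_of_nonneg hc hδ.le).trans zero_le_one)

/-! ### Concentration of the derivative of the cut-off function at the faces. -/

/-- The part of the derivative of the cut-off function of a tetrahedron that is due to the face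
opposite to `b`. -/
def layer (K : Finset E3) (b : E3) (δ : ℝ) (x : E3) : ℝ :=
  δ⁻¹ * deriv step (lam K b x / δ) * ∏ v ∈ K.erase b, step (lam K v x / δ)

/-- A cut-off function of a tetrahedron. -/
def cutoff (K : Finset E3) (δ : ℝ) (x : E3) : ℝ := ∏ v ∈ K, step (lam K v x / δ)

theorem continuous_layer (K : Finset E3) (b : E3) (δ : ℝ) : Continuous (layer K b δ) := by
  unfold layer
  refine (continuous_const.mul (continuous_deriv_step.comp ((continuous_lam K b).div_const δ))).mul
    (continuous_finsetProd _ fun v _ => continuous_step.comp ((continuous_lam K v).div_const δ))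

theorem contDiff_cutoff (K : Finset E3) (δ : ℝ) : ContDiff ℝ ∞ (cutoff K δ) :=
  contDiff_prod fun v _ => contDiff_step.comp ((contDiff_lam K v).div_const δ)

/-- It stretches the layer of thickness proportional to `δ` at a face to a fixed thickness. -/
theorem integral_comp_mul_fst {X : Type*} [MeasureSpace X] [SFinite (volume : Measure X)]
    {δ : ℝ} (hδ : 0 < δ) (f : ℝ × X → ℝ) :
    ∫ p : ℝ × X, f (δ * p.1, p.2) = δ⁻¹ * ∫ p : ℝ × X, f p := by
  set e : ℝ × X ≃ᵐ ℝ × X :=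
    (Homeomorph.mulLeft₀ δ hδ.ne').toMeasurableEquiv.prodCongr (MeasurableEquiv.refl X) with he
  have hmap : Measure.map e (volume : Measure (ℝ × X)) = ENNReal.ofReal δ⁻¹ • volume := by
    have h1 := Measure.map_prod_map (volume : Measure ℝ) (volume : Measure X)
      (measurable_const_mul δ) measurable_id
    rw [Real.map_volume_mul_left hδ.ne', Measure.map_id, Measure.prod_smul_left,
      abs_of_pos (inv_pos.2 hδ)] at h1
    exact h1.symm
  have := e.measurableEmbedding.integral_map (μ := volume) f
  rw [hmap, integral_smul_measure, ENNReal.toReal_ofReal (inv_pos.2 hδ).le] at this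
  rw [← smul_eq_mul, this]; rfl

theorem IsFrame.prod_erase {K : Finset E3} {b w₀ w₁ w₂ : E3} (h : IsFrame K b w₀ w₁ w₂)
    (f : E3 → ℝ) : ∏ v ∈ K.erase b, f v = f w₀ * (f w₁ * f w₂) := by
  rw [h.erase, Finset.prod_insert (by simp [h.ne₀₁, h.ne₀₂]),
    Finset.prod_insert (by simp [h.ne₁₂]), Finset.prod_singleton]

/-- In the chart, with `lam K b = δ t`, the layer has the density `deriv step t` in `t`, of total
mass one, while the other step factors tend to the indicator of the open triangle. Dominated
convergence leaves the integral over the face; `κ` is the ratio of the volume and surface constants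
of the chart. -/
theorem IsTet.exists_tendsto_layer {K : Finset E3} (hK : IsTet K) {b : E3} (hb : b ∈ K) :
    ∃ κ : ℝ, 0 < κ ∧ ∀ h : E3 → ℝ, Continuous h →
      Tendsto (fun δ => ∫ x, h x * layer K b δ x) (𝓝[>] 0)
        (𝓝 (κ * ∫ x in hull (K.erase b), h x ∂(Measure.hausdorffMeasure 2 : Measure E3))) := by
  obtain ⟨w₀, w₁, w₂, hf⟩ := hK.exists_isFrame hb
  obtain ⟨C, hC0, hC⟩ := hf.exists_integral_chart
  obtain ⟨C', hC0', hC'⟩ := hf.exists_integral_face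
  refine ⟨C / C', by positivity, fun h hh => ?_⟩
  set Φ := chart b w₀ w₁ w₂ with hΦ
  have hΦc : Continuous Φ := continuous_chart b w₀ w₁ w₂
  set Δ : Set (ℝ × ℝ) := {p : ℝ × ℝ | 0 < p.1 ∧ 0 < p.2 ∧ p.1 + p.2 < 1} with hΔ
  set G : ℝ → ℝ × ℝ × ℝ → ℝ := fun δ p => h (Φ (δ * p.1, p.2)) * (deriv step p.1 *
    (step ((1 - δ * p.1 - p.2.1 - p.2.2) / δ) * (step (p.2.1 / δ) * step (p.2.2 / δ)))) with hG
  have hI : ∀ δ > 0, ∫ x, h x * layer K b δ x = C * ∫ p, G δ p := by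
    intro δ hδ
    rw [hC]
    congr 1
    have h1 := integral_comp_mul_fst (X := ℝ × ℝ) hδ (fun p => h (Φ p) * layer K b δ (Φ p))
    rw [eq_inv_mul_iff_mul_eq₀ hδ.ne', ← integral_const_mul] at h1
    rw [← h1]
    refine integral_congr_ae (Eventually.of_forall fun p => ?_)
    obtain ⟨e1, e2, e3, e4⟩ := hf.lam_chart (δ * p.1, p.2)
    simp only [hG, layer, hf.prod_erase]
    rw [e1, e2, e3, e4]
    simp only
    rw [mul_div_cancel_left₀ _ hδ.ne']
    field_simp
  obtain ⟨M, hM0, hM⟩ := exists_abs_deriv_step_le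
  obtain ⟨H, hH⟩ := (isCompact_hull K).exists_bound_of_continuousOn hh.continuousOn
  -- After rescaling, all integrands vanish outside this box: `deriv step` lives on `[1, 2]` and the
  -- other coordinates on the triangle.
  set box : Set (ℝ × ℝ × ℝ) := Set.Icc (1, 0, 0) (2, 1, 1) with hbox
  -- Off the triangle one of the remaining step factors has a nonpositive argument.
  have hzero : ∀ δ > 0, ∀ p : ℝ × ℝ × ℝ, p.1 ∈ Set.Icc (1 : ℝ) 2 → p.2 ∉ Δ →
      step ((1 - δ * p.1 - p.2.1 - p.2.2) / δ) * (step (p.2.1 / δ) * step (p.2.2 / δ)) = 0 := by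
    intro δ hδ p hp1 hp
    by_cases h1 : 0 < p.2.1
    · by_cases h2 : 0 < p.2.2
      · rw [step_div_eq_zero hδ, zero_mul]
        have h3 : 1 ≤ p.2.1 + p.2.2 := by
          by_contra! hcon; exact hp ⟨h1, h2, hcon⟩
        have : 0 < δ * p.1 := mul_pos hδ (by linarith [hp1.1])
        linarith
      · rw [step_div_eq_zero hδ (not_lt.1 h2)]; ring
    · rw [step_div_eq_zero hδ (not_lt.1 h1)]; ring
  have hlim : Tendsto (fun δ => ∫ p, G δ p) (𝓝[>] 0)
      (𝓝 (∫ p : ℝ × ℝ × ℝ, deriv step p.1 * Δ.indicator (fun q => h (Φ (0, q))) p.2)) := by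
    refine tendsto_integral_filter_of_dominated_convergence
      (box.indicator fun _ => H * M) ?_ ?_ ?_ ?_
    · refine Eventually.of_forall fun δ => Continuous.aestronglyMeasurable ?_
      have := continuous_deriv_step
      have := continuous_step
      fun_prop
    · filter_upwards [self_mem_nhdsWithin] with δ hδ
      have hδ : 0 < δ := hδ
      refine Eventually.of_forall fun p => ?_
      by_cases hp1 : p.1 ∈ Set.Icc (1 : ℝ) 2
      swap
      · simp only [hG, deriv_step_of_notMem hp1, zero_mul, mul_zero, norm_zero]
        exact Set.indicator_nonneg (fun _ _ => mul_nonneg ((norm_nonneg _).trans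
          (hH b (mem_hull_of_mem hb))) hM0) p
      by_cases hp2 : p.2 ∈ Δ
      swap
      · simp only [hG, hzero δ hδ p hp1 hp2, mul_zero, norm_zero]
        exact Set.indicator_nonneg (fun _ _ => mul_nonneg ((norm_nonneg _).trans
          (hH b (mem_hull_of_mem hb))) hM0) p
      rw [Set.indicator_of_mem (by
        obtain ⟨a1, a2, a3⟩ := hp2
        exact ⟨⟨hp1.1, a1.le, a2.le⟩, ⟨hp1.2, by simp only; linarith, by simp only; linarith⟩⟩)]
      by_cases hp3 : 0 ≤ 1 - δ * p.1 - p.2.1 - p.2.2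
      · have hmem : Φ (δ * p.1, p.2) ∈ hull K := by
          rw [hΦ, hf.chart_mem_hull]
          exact ⟨mul_nonneg hδ.le (by linarith [hp1.1]), hp3, hp2.1.le, hp2.2.1.le⟩
        simp only [hG, norm_mul]
        refine mul_le_mul (hH _ hmem) ?_ (by positivity) ((norm_nonneg _).trans (hH _ hmem))
        have e1 := abs_step_le ((1 - δ * p.1 - p.2.1 - p.2.2) / δ)
        have e2 := abs_step_le (p.2.1 / δ)
        have e3 := abs_step_le (p.2.2 / δ)
        have e4 := hM p.1
        simp only [Real.norm_eq_abs]
        calc _ ≤ M * (1 * (1 * 1)) := by gcongr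
          _ = M := by ring
      · simp only [hG]
        rw [step_div_eq_zero hδ (not_le.1 hp3).le]
        simp only [zero_mul, mul_zero, norm_zero]
        exact mul_nonneg ((norm_nonneg _).trans (hH b (mem_hull_of_mem hb))) hM0
    · refine (integrable_indicator_iff measurableSet_Icc).2 ?_
      exact integrableOn_const isCompact_Icc.measure_lt_top.ne
    · refine Eventually.of_forall fun p => ?_
      by_cases hp1 : p.1 ∈ Set.Icc (1 : ℝ) 2
      swap
      · simp only [hG, deriv_step_of_notMem hp1, zero_mul, mul_zero]; exact tendsto_const_nhds
      by_cases hp2 : p.2 ∈ Δ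
      · rw [Set.indicator_of_mem hp2]
        have t1 : Tendsto (fun δ : ℝ => h (Φ (δ * p.1, p.2))) (𝓝[>] 0) (𝓝 (h (Φ (0, p.2)))) := by
          have : Continuous fun δ : ℝ => h (Φ (δ * p.1, p.2)) := by fun_prop
          simpa using (this.tendsto 0).mono_left nhdsWithin_le_nhds
        have t2 : Tendsto (fun δ : ℝ => step ((1 - δ * p.1 - p.2.1 - p.2.2) / δ)) (𝓝[>] 0)
            (𝓝 1) := by
          refine tendsto_const_nhds.congr' ?_
          have hpos : 0 < 1 - p.2.1 - p.2.2 := by linarith [hp2.2.2]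
          filter_upwards [Ioo_mem_nhdsGT (by positivity : (0 : ℝ) < (1 - p.2.1 - p.2.2) / 4)]
            with δ hδ
          rw [step_of_ge]
          rw [le_div_iff₀ hδ.1]
          nlinarith [hδ.1, hδ.2, hp1.2]
        have t3 := @tendsto_step_div p.2.1
        have t4 := @tendsto_step_div p.2.2
        rw [if_pos hp2.1] at t3
        rw [if_pos hp2.2.1] at t4
        have := t1.mul ((tendsto_const_nhds (x := deriv step p.1)).mul (t2.mul (t3.mul t4)))
        simpa [hG, mul_comm] using this
      · rw [Set.indicator_of_notMem hp2, mul_zero]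
        refine tendsto_const_nhds.congr' ?_
        filter_upwards [self_mem_nhdsWithin] with δ hδ
        simp only [hG, hzero δ hδ p hp1 hp2, mul_zero]
  have hval : ∫ p : ℝ × ℝ × ℝ, deriv step p.1 * Δ.indicator (fun q => h (Φ (0, q))) p.2 =
      ∫ q in Δ, h (Φ (0, q)) := by
    have hΔm : MeasurableSet Δ :=
      ((isOpen_lt continuous_const continuous_fst).inter
          ((isOpen_lt continuous_const continuous_snd).inter
            (isOpen_lt (continuous_fst.add continuous_snd) continuous_const))).measurableSet
    have := integral_prod_mul (μ := (volume : Measure ℝ)) (ν := (volume : Measure (ℝ × ℝ)))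
      (deriv step) (Δ.indicator (fun q => h (Φ (0, q))))
    rw [integral_deriv_step, one_mul, integral_indicator hΔm] at this
    exact this
  rw [hval] at hlim
  have := (hlim.const_mul C)
  refine (this.congr' ?_).trans (le_of_eq ?_)
  · filter_upwards [self_mem_nhdsWithin] with δ hδ using (hI δ hδ).symm
  · rw [hC']; congr 1; field_simp

/-! ### Partial derivatives -/

theorem pderiv_mul {f g : E3 → ℝ} {x : E3} (hf : DifferentiableAt ℝ f x)
    (hg : DifferentiableAt ℝ g x) (i : Fin 3) :
    pderiv i (fun y => f y * g y) x = f x * pderiv i g x + pderiv i f x * g x := by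
  unfold pderiv
  rw [fderiv_fun_mul hf hg]
  simp [mul_comm]

theorem pderiv_const (c : ℝ) (i : Fin 3) (x : E3) : pderiv i (fun _ => c) x = 0 := by
  simp [pderiv]

/-- The affine function with value `c` at the origin and gradient `d`. -/
def aff (c : ℝ) (d x : E3) : ℝ := c + inner ℝ d x

theorem contDiff_aff (c : ℝ) (d : E3) : ContDiff ℝ ∞ (aff c d) :=
  contDiff_const.add (contDiff_const.inner ℝ contDiff_id)

theorem hasFDerivAt_aff (c : ℝ) (d x : E3) :
    HasFDerivAt (aff c d) (innerSL ℝ d) x :=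
  (innerSL ℝ d).hasFDerivAt.const_add c

theorem inner_single (d : E3) (i : Fin 3) :
    inner ℝ d (EuclideanSpace.single i (1 : ℝ)) = d i := by
  simp [EuclideanSpace.inner_single_right]

theorem pderiv_aff (c : ℝ) (d : E3) (i : Fin 3) (x : E3) : pderiv i (aff c d) x = d i := by
  unfold pderiv
  rw [(hasFDerivAt_aff c d x).fderiv]
  exact inner_single d i

theorem lam_eq_aff (K : Finset E3) (v : E3) : lam K v = aff (lam K v 0) (glam K v) :=
  funext (lam_eq K v)

theorem continuous_pderiv {f : E3 → ℝ} (hf : ContDiff ℝ ∞ f) (i : Fin 3) :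
    Continuous (pderiv i f) :=
  (hf.continuous_fderiv (by simp)).clm_apply continuous_const

theorem _root_.ContDiff.diffAt {f : E3 → ℝ} (hf : ContDiff ℝ ∞ f) (x : E3) :
    DifferentiableAt ℝ f x := (hf.differentiable (by simp)) x

theorem pderiv_cutoff {K : Finset E3} (δ : ℝ) (i : Fin 3) (x : E3) :
    pderiv i (cutoff K δ) x = ∑ b ∈ K, glam K b i * layer K b δ x := by
  have h1 : ∀ v ∈ K, HasFDerivAt (fun y => step (lam K v y / δ))
      ((deriv step (lam K v x / δ) * δ⁻¹) • innerSL ℝ (glam K v)) x := by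
    intro v _
    have h2 : HasFDerivAt (fun y => lam K v y / δ) (δ⁻¹ • innerSL ℝ (glam K v)) x := by
      rw [lam_eq_aff]
      simpa [div_eq_inv_mul] using (hasFDerivAt_aff (lam K v 0) (glam K v) x).const_mul δ⁻¹
    have := (hasDerivAt_step (lam K v x / δ)).comp_hasFDerivAt x h2
    rwa [smul_smul] at this
  have h3 := HasFDerivAt.finsetProd h1
  unfold pderiv
  rw [show cutoff K δ = fun y => ∏ v ∈ K, step (lam K v y / δ) from rfl, h3.fderiv]
  simp only [ContinuousLinearMap.sum_apply, ContinuousLinearMap.smul_apply, innerSL_apply_apply,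
    inner_single, smul_eq_mul, layer]
  exact Finset.sum_congr rfl fun b _ => by ring

/-! ### The Gauss theorem on a tetrahedron -/

/-- The outward normal of the face opposite to `b`, scaled by the ratio of the surface measure to
the two-dimensional Hausdorff measure. -/
def faceNormal (K : Finset E3) (b : E3) : E3 :=
  if h : IsTet K ∧ b ∈ K then -((h.1.exists_tendsto_layer h.2).choose • glam K b) else 0

theorem IsTet.exists_faceNormal {K : Finset E3} (hK : IsTet K) {b : E3} (hb : b ∈ K) :
    ∃ κ : ℝ, 0 < κ ∧ faceNormal K b = -(κ • glam K b) ∧ ∀ h : E3 → ℝ, Continuous h →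
      Tendsto (fun δ => ∫ x, h x * layer K b δ x) (𝓝[>] 0)
        (𝓝 (κ * ∫ x in hull (K.erase b), h x ∂(Measure.hausdorffMeasure 2 : Measure E3))) := by
  have h : IsTet K ∧ b ∈ K := ⟨hK, hb⟩
  refine ⟨_, (h.1.exists_tendsto_layer h.2).choose_spec.1, ?_,
    (h.1.exists_tendsto_layer h.2).choose_spec.2⟩
  unfold faceNormal
  rw [dif_pos h]

/-- Surface integrals over the face of `K` opposite to `b`. -/
def faceInt (K : Finset E3) (b : E3) (f : E3 → ℝ) : ℝ :=
  ∫ x in hull (K.erase b), f x ∂(Measure.hausdorffMeasure 2 : Measure E3)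

theorem IsTet.cutoff_eq_zero {K : Finset E3} (hK : IsTet K) {δ : ℝ} (hδ : 0 < δ) {x : E3}
    (hx : ∃ v ∈ K, lam K v x ≤ δ) : cutoff K δ x = 0 := by
  obtain ⟨v, hv, hvx⟩ := hx
  exact Finset.prod_eq_zero hv (step_of_le ((div_le_one hδ).2 hvx))

theorem IsTet.layer_eq_zero {K : Finset E3} (hK : IsTet K) {b : E3} (hb : b ∈ K) {δ : ℝ}
    (hδ : 0 < δ) {x : E3} (hx : x ∉ hull K) : layer K b δ x = 0 := by
  rw [hK.mem_hull_iff] at hx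
  push Not at hx
  obtain ⟨v, hv, hvx⟩ := hx
  unfold layer
  by_cases hvb : v = b
  · rw [deriv_step_of_notMem, mul_zero, zero_mul]
    rw [← hvb]
    intro h
    have := div_neg_of_neg_of_pos hvx hδ
    linarith [h.1]
  · rw [Finset.prod_eq_zero (Finset.mem_erase.2 ⟨hvb, hv⟩) (step_div_eq_zero hδ hvx.le), mul_zero]

/-- Since `step` vanishes up to `1`, not only up to `0`, the support stays where every barycentric
coordinate is at least `δ`, which is compact in the open cell. -/
theorem IsTet.isTestFun_cutoff_mul {K : Finset E3} (hK : IsTet K) {δ : ℝ} (hδ : 0 < δ)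
    {P : E3 → ℝ} (hP : ContDiff ℝ ∞ P) :
    IsTestFun (interior (hull K)) (fun x => cutoff K δ x * P x) := by
  have hclosed : IsClosed {x : E3 | ∀ v ∈ K, δ ≤ lam K v x} := by
    simp only [Set.ofPred_forall]
    exact isClosed_biInter fun v _ => isClosed_le continuous_const (continuous_lam K v)
  have hsub : tsupport (fun x => cutoff K δ x * P x) ⊆ {x : E3 | ∀ v ∈ K, δ ≤ lam K v x} := by
    refine closure_minimal (fun x hx v hv => ?_) hclosed
    by_contra! hcon
    exact hx (by simp only [hK.cutoff_eq_zero hδ ⟨v, hv, hcon.le⟩, zero_mul])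
  have hint : {x : E3 | ∀ v ∈ K, δ ≤ lam K v x} ⊆ interior (hull K) := fun x hx =>
    hK.mem_interior_iff.2 fun v hv => hδ.trans_le (hx v hv)
  refine ⟨(contDiff_cutoff K δ).mul hP, ?_, hsub.trans hint⟩
  exact (isCompact_hull K).of_isClosed_subset (isClosed_tsupport _)
    ((hsub.trans hint).trans interior_subset)

theorem abs_cutoff_le (K : Finset E3) (δ : ℝ) (x : E3) : |cutoff K δ x| ≤ 1 := by
  unfold cutoff
  rw [Finset.abs_prod]
  exact Finset.prod_le_one (fun _ _ => abs_nonneg _) fun _ _ => abs_step_le _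

theorem IsTet.tendsto_integral_cutoff {K : Finset E3} (hK : IsTet K) {f : E3 → ℝ}
    (hf : IntegrableOn f (hull K)) :
    Tendsto (fun δ => ∫ x in hull K, cutoff K δ x * f x) (𝓝[>] 0) (𝓝 (∫ x in hull K, f x)) := by
  refine tendsto_integral_filter_of_dominated_convergence (fun x => ‖f x‖) ?_ ?_ hf.norm ?_
  · exact Eventually.of_forall fun δ =>
      (contDiff_cutoff K δ).continuous.aestronglyMeasurable.mul hf.aestronglyMeasurable
  · refine Eventually.of_forall fun δ => Eventually.of_forall fun x => ?_
    rw [norm_mul]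
    exact mul_le_of_le_one_left (norm_nonneg _) (abs_cutoff_le K δ x)
  · rw [← Measure.restrict_congr_set (interior_hull_ae_eq K)]
    refine (ae_restrict_iff' isOpen_interior.measurableSet).2 (Eventually.of_forall fun x hx => ?_)
    rw [hK.mem_interior_iff] at hx
    have h1 : Tendsto (fun δ => cutoff K δ x) (𝓝[>] 0) (𝓝 (∏ v ∈ K, (1 : ℝ))) :=
      tendsto_finsetProd _ fun v hv => by
        have := @tendsto_step_div (lam K v x)
        rwa [if_pos (hx v hv)] at this
    simpa using h1.mul_const (f x)

/-- The Gauss theorem on a tetrahedron for the product of a smooth function and a continuous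
function with an integrable weak partial derivative `g`. -/
theorem IsTet.gauss {K : Finset E3} (hK : IsTet K) {i : Fin 3} {u g P : E3 → ℝ}
    (hu : ContinuousOn u (hull K)) (hg : IntegrableOn g (hull K))
    (hw : ∀ φ : E3 → ℝ, IsTestFun (interior (hull K)) φ →
      ∫ x in hull K, u x * pderiv i φ x = -∫ x in hull K, g x * φ x)
    (hP : ContDiff ℝ ∞ P) :
    ∫ x in hull K, (u x * pderiv i P x + g x * P x) =
      ∑ b ∈ K, faceNormal K b i * faceInt K b fun x => u x * P x := by
  -- A Tietze extension, because the layer limit is about functions continuous on the whole space.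
  obtain ⟨U, hU⟩ := ContinuousMap.exists_restrict_eq (isClosed_hull K)
    ⟨(hull K).restrict u, continuousOn_iff_continuous_restrict.1 hu⟩
  have hUu : ∀ x ∈ hull K, U x = u x := fun x hx => congrArg (fun f => f ⟨x, hx⟩) hU
  have hint1 : IntegrableOn (fun x => u x * pderiv i P x) (hull K) :=
    (hu.mul (continuous_pderiv hP i).continuousOn).integrableOn_compact (isCompact_hull K)
  have hint2 : IntegrableOn (fun x => g x * P x) (hull K) :=
    hg.mul_continuousOn hP.continuous.continuousOn (isCompact_hull K)
  -- The weak derivative is tested with the product of cut-off function and `P`. As `δ` tends to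
  -- zero, the derivative of the cut-off function becomes the surface integrals.
  have hδ : ∀ δ > 0, (∫ x in hull K, cutoff K δ x * (u x * pderiv i P x)) +
      ∑ b ∈ K, glam K b i * ∫ x, (U x * P x) * layer K b δ x =
      -∫ x in hull K, cutoff K δ x * (g x * P x) := by
    intro δ hδ
    have h1 := hw _ (hK.isTestFun_cutoff_mul hδ hP)
    rw [show (∫ x in hull K, cutoff K δ x * (g x * P x)) =
      ∫ x in hull K, g x * (cutoff K δ x * P x) from
        integral_congr_ae (Eventually.of_forall fun x => by ring), ← h1]
    have h2 : ∀ b ∈ K, ∫ x, (U x * P x) * layer K b δ x =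
        ∫ x in hull K, (U x * P x) * layer K b δ x := fun b hb =>
      (setIntegral_eq_integral_of_forall_compl_eq_zero fun x hx => by
        rw [hK.layer_eq_zero hb hδ hx, mul_zero]).symm
    have h3 : ∀ b ∈ K, IntegrableOn (fun x => glam K b i * ((U x * P x) * layer K b δ x))
        (hull K) := fun b _ => by
      have := continuous_layer K b δ
      have := hP.continuous
      exact Continuous.continuousOn (by fun_prop) |>.integrableOn_compact (isCompact_hull K)
    rw [Finset.sum_congr rfl fun b hb => by rw [h2 b hb, ← integral_const_mul],
      ← integral_finsetSum K h3, ← integral_add ?_ (integrable_finsetSum K h3)]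
    · refine setIntegral_congr_fun (measurableSet_hull K) fun x hx => ?_
      simp only
      rw [pderiv_mul ((contDiff_cutoff K δ).diffAt x) (hP.diffAt x), pderiv_cutoff,
        hUu x hx, Finset.sum_mul, mul_add, Finset.mul_sum]
      congr 1
      · ring
      · exact Finset.sum_congr rfl fun b _ => by ring
    · exact ((contDiff_cutoff K δ).continuous.continuousOn.mul
        (hu.mul (continuous_pderiv hP i).continuousOn)).integrableOn_compact (isCompact_hull K)
  have hκ : ∀ b ∈ K, Tendsto (fun δ => glam K b i * ∫ x, (U x * P x) * layer K b δ x) (𝓝[>] 0)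
      (𝓝 (-(faceNormal K b i * faceInt K b fun x => u x * P x))) := by
    intro b hb
    obtain ⟨κ, -, hN, hlim⟩ := hK.exists_faceNormal hb
    have h1 := (hlim (fun x => U x * P x) (U.continuous.mul hP.continuous)).const_mul (glam K b i)
    have h2 : (∫ x in hull (K.erase b), U x * P x ∂(Measure.hausdorffMeasure 2 : Measure E3)) =
        faceInt K b fun x => u x * P x :=
      setIntegral_congr_fun (measurableSet_hull _) fun x hx => by
        simp only [hUu x (hull_mono (Finset.erase_subset b K) hx)]
    rw [h2] at h1
    convert h1 using 2
    rw [hN]; simp; ring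
  have hL := (hK.tendsto_integral_cutoff hint1).add (tendsto_finsetSum K hκ)
  have hR := (hK.tendsto_integral_cutoff hint2).neg
  have := tendsto_nhds_unique (hL.congr' (by
    filter_upwards [self_mem_nhdsWithin] with δ h using hδ δ h)) hR
  rw [integral_add hint1 hint2]
  rw [Finset.sum_neg_distrib] at this
  linarith

/-! ### Weak derivatives -/

theorem pderiv_eq_zero_of_notMem {f : E3 → ℝ} {x : E3} (hx : x ∉ tsupport f) (i : Fin 3) :
    pderiv i f x = 0 := by
  unfold pderiv
  rw [image_eq_zero_of_notMem_tsupport (fun h => hx (tsupport_fderiv_subset ℝ h))]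
  simp

theorem IsTestFun.mono {F : Type*} [NormedAddCommGroup F] [NormedSpace ℝ F] {Ω Ω' : Set E3}
    {f : E3 → F} (hf : IsTestFun Ω f) (h : Ω ⊆ Ω') : IsTestFun Ω' f :=
  ⟨hf.1, hf.2.1, hf.2.2.trans h⟩

theorem IsTestFun.setIntegral_eq {Ω Ω' : Set E3} {φ : E3 → ℝ} (hφ : IsTestFun Ω φ)
    (hΩ : MeasurableSet Ω') (h : Ω ⊆ Ω') {f : E3 → ℝ}
    (hf : ∀ x, x ∉ tsupport φ → f x = 0) : ∫ x in Ω', f x = ∫ x in Ω, f x :=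
  setIntegral_eq_of_subset_of_forall_sdiff_eq_zero hΩ h fun x hx =>
    hf x fun hx' => hx.2 (hφ.2.2 hx')

theorem hasCompactSupport_pderiv {f : E3 → ℝ} (hf : HasCompactSupport f) (i : Fin 3) :
    HasCompactSupport (pderiv i f) :=
  hf.mono' fun x hx => by
    by_contra hx'
    exact hx (pderiv_eq_zero_of_notMem hx' i)

theorem MemL2.integrable_mul {Ω : Set E3} {u v : E3 → ℝ} (hu : MemL2 Ω u) (hv : MemL2 Ω v) :
    IntegrableOn (fun x => u x * v x) Ω :=
  MemLp.integrable_mul hu hv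

theorem MemL2.apply {Ω : Set E3} {v : E3 → E3} (hv : MemL2 Ω v) (i : Fin 3) :
    MemL2 Ω fun x => v x i :=
  (MemLp.of_le hv ((EuclideanSpace.proj (𝕜 := ℝ) i).continuous.comp_aestronglyMeasurable
    hv.aestronglyMeasurable) (Eventually.of_forall fun x => PiLp.norm_apply_le (v x) i) : _)

theorem MemL2.of_apply {Ω : Set E3} {v : E3 → E3} (hv : ∀ i : Fin 3, MemL2 Ω fun x => v x i) :
    MemL2 Ω v := by
  have h : ∀ x, v x = ∑ i : Fin 3, v x i • EuclideanSpace.single i (1 : ℝ) := by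
    intro x
    ext j
    simp [Pi.single_apply]
  have h2 : MemLp (fun x => ∑ i : Fin 3, v x i • EuclideanSpace.single i (1 : ℝ) : E3 → E3) 2
      (volume.restrict Ω) := by
    refine memLp_finsetSum _ fun i _ => ?_
    have := (hv i : MemLp _ 2 _)
    exact ((ContinuousLinearMap.id ℝ ℝ).smulRight
      (EuclideanSpace.single i (1 : ℝ) : E3)).comp_memLp' this
  exact h2.ae_eq (Eventually.of_forall fun x => (h x).symm)

theorem MemL2.of_continuous {F : Type*} [NormedAddCommGroup F] {Ω : Set E3} {u : E3 → F}
    (hu : Continuous u)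
    (hc : HasCompactSupport u) : MemL2 Ω u :=
  (hu.memLp_of_hasCompactSupport (μ := volume) hc).restrict Ω

theorem IsTestFun.memL2 {Ω : Set E3} {φ : E3 → ℝ} (hφ : IsTestFun Ω φ) : MemL2 Ω φ :=
  MemL2.of_continuous hφ.1.continuous hφ.2.1

theorem IsTestFun.memL2_pderiv {Ω : Set E3} {φ : E3 → ℝ} (hφ : IsTestFun Ω φ) (i : Fin 3) :
    MemL2 Ω (pderiv i φ) :=
  MemL2.of_continuous (continuous_pderiv hφ.1 i) (hasCompactSupport_pderiv hφ.2.1 i)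

theorem MemL2.ae_eq_of_test {Ω : Set E3} (hΩ : IsOpen Ω) {f g : E3 → ℝ} (hf : MemL2 Ω f)
    (hg : MemL2 Ω g)
    (h : ∀ φ, IsTestFun Ω φ → ∫ x in Ω, f x * φ x = ∫ x in Ω, g x * φ x) :
    f =ᵐ[volume.restrict Ω] g := by
  have hfg : MemLp (f - g) 2 (volume.restrict Ω) := MemLp.sub hf hg
  have hloc : LocallyIntegrableOn (f - g) Ω := by
    rw [locallyIntegrableOn_iff hΩ.isLocallyClosed]
    intro k hk hkc
    have : MemLp (f - g) 2 (volume.restrict k) :=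
      hfg.mono_measure (Measure.restrict_mono hk le_rfl)
    have hfin : IsFiniteMeasure (volume.restrict k) := ⟨by simpa using hkc.measure_lt_top⟩
    exact this.integrable (by norm_num)
  have := hΩ.ae_eq_zero_of_integral_contDiff_smul_eq_zero hloc fun φ h1 h2 h3 => by
    have hφ : IsTestFun Ω φ := ⟨h1, h2, h3⟩
    rw [← setIntegral_eq_integral_of_forall_compl_eq_zero (s := Ω) fun x hx => by
      have h0 : φ x = 0 := image_eq_zero_of_notMem_tsupport fun hx' => hx (h3 hx')
      rw [h0, zero_smul]]
    have e := h φ hφ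
    rw [← sub_eq_zero, ← integral_sub (hf.integrable_mul hφ.memL2)
      (hg.integrable_mul hφ.memL2)] at e
    rw [← e]
    exact integral_congr_ae (Eventually.of_forall fun x => by
      change φ x * (f x - g x) = f x * φ x - g x * φ x; ring)
  filter_upwards [(ae_restrict_iff' hΩ.measurableSet).2 this] with x hx
  exact sub_eq_zero.1 hx

theorem ae_eq_of_apply {μ : Measure E3} {f g : E3 → E3}
    (h : ∀ i : Fin 3, (fun x => f x i) =ᵐ[μ] fun x => g x i) : f =ᵐ[μ] g := by
  filter_upwards [ae_all_iff.2 h] with x hx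
  ext i
  exact hx i

theorem HasWeakGrad.unique {Ω : Set E3} (hΩ : IsOpen Ω) {u : E3 → ℝ} {g g' : E3 → E3}
    (h : HasWeakGrad Ω u g) (h' : HasWeakGrad Ω u g') : g =ᵐ[volume.restrict Ω] g' :=
  ae_eq_of_apply fun i => MemL2.ae_eq_of_test hΩ (h.2.1.apply i) (h'.2.1.apply i) fun φ hφ => by
    have h1 := h.2.2 φ hφ i
    have h2 := h'.2.2 φ hφ i
    linarith

theorem HasWeakGrad.congr {Ω : Set E3} {u u' : E3 → ℝ} {g g' : E3 → E3} (h : HasWeakGrad Ω u g)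
    (hu : u =ᵐ[volume.restrict Ω] u') (hg : g =ᵐ[volume.restrict Ω] g') : HasWeakGrad Ω u' g' := by
  refine ⟨MemLp.ae_eq hu h.1, MemLp.ae_eq hg h.2.1, fun φ hφ i => ?_⟩
  have e1 : ∫ x in Ω, u x * pderiv i φ x = ∫ x in Ω, u' x * pderiv i φ x :=
    integral_congr_ae (hu.mono fun x hx => by simp only [hx])
  have e2 : ∫ x in Ω, g x i * φ x = ∫ x in Ω, g' x i * φ x :=
    integral_congr_ae (hg.mono fun x hx => by simp only [hx])
  rw [← e1, ← e2, h.2.2 φ hφ i]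

theorem HasWeakGrad.mono {Ω Ω' : Set E3} (hΩ' : MeasurableSet Ω') (hs : Ω ⊆ Ω') {u : E3 → ℝ}
    {g : E3 → E3} (h : HasWeakGrad Ω' u g) : HasWeakGrad Ω u g := by
  refine ⟨MemLp.mono_measure (Measure.restrict_mono hs le_rfl) h.1,
    MemLp.mono_measure (Measure.restrict_mono hs le_rfl) h.2.1, fun φ hφ i => ?_⟩
  have := h.2.2 φ (hφ.mono hs) i
  rwa [hφ.setIntegral_eq hΩ' hs fun x hx => by
      rw [pderiv_eq_zero_of_notMem hx, mul_zero],
    hφ.setIntegral_eq hΩ' hs fun x hx => by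
      rw [image_eq_zero_of_notMem_tsupport hx, mul_zero]] at this

theorem MemH1.hasWeakGrad {Ω : Set E3} {u : E3 → ℝ} (h : MemH1 Ω u) :
    HasWeakGrad Ω u (weakGrad Ω u) := by
  unfold weakGrad
  rw [dif_pos h]
  exact h.choose_spec

theorem HasWeakGrad.weakGrad_ae_eq {Ω : Set E3} (hΩ : IsOpen Ω) {u : E3 → ℝ} {g : E3 → E3}
    (h : HasWeakGrad Ω u g) : weakGrad Ω u =ᵐ[volume.restrict Ω] g :=
  MemH1.hasWeakGrad ⟨g, h⟩ |>.unique hΩ h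

theorem grad_apply (f : E3 → ℝ) (x : E3) (i : Fin 3) : grad f x i = pderiv i f x := by
  fin_cases i <;> rfl

theorem grad_aff (c : ℝ) (d x : E3) : grad (aff c d) x = d := by
  ext i; rw [grad_apply, pderiv_aff]

/-- The coordinate form of the definition of the weak curl. -/
theorem inner_cross_single (v g : E3) (k : Fin 3) :
    inner ℝ v (cross g (EuclideanSpace.single k 1)) = cross v g k := by
  fin_cases k <;> simp [inner_three, EuclideanSpace.single_apply] <;> ring

theorem curl_smul_single {φ : E3 → ℝ} (k : Fin 3) (x : E3) :
    curl (fun y => φ y • EuclideanSpace.single k (1 : ℝ)) x =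
      cross (grad φ x) (EuclideanSpace.single k 1) := by
  have h0 : pderiv 0 (fun _ : E3 => (0 : ℝ)) x = 0 := pderiv_const 0 0 x
  have h1 : pderiv 1 (fun _ : E3 => (0 : ℝ)) x = 0 := pderiv_const 0 1 x
  have h2 : pderiv 2 (fun _ : E3 => (0 : ℝ)) x = 0 := pderiv_const 0 2 x
  fin_cases k <;> apply ext_three <;>
    simp [curl, EuclideanSpace.single_apply, grad_apply, h0, h1, h2]

theorem inner_curl (v : E3) (Φ : E3 → E3) (x : E3) :
    inner ℝ v (curl Φ x) = ∑ k : Fin 3, cross v (grad (fun y => Φ y k) x) k := by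
  simp [Fin.sum_univ_three, inner_three, curl, grad_apply]
  ring

/-- Test fields `φ e_k` split the weak curl into scalar identities, the form matched by the Gauss
formulas. -/
theorem HasWeakCurl.integral_cross {Ω : Set E3} {v c : E3 → E3} (h : HasWeakCurl Ω v c)
    {φ : E3 → ℝ} (hφ : IsTestFun Ω φ) (k : Fin 3) :
    ∫ x in Ω, cross (v x) (grad φ x) k = ∫ x in Ω, c x k * φ x := by
  have hs : tsupport (fun y => φ y • (EuclideanSpace.single k (1 : ℝ) : E3)) ⊆ tsupport φ :=
    closure_mono fun x hx hx' => hx (by simp only [hx', zero_smul])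
  have := h.2.2 (fun y => φ y • EuclideanSpace.single k (1 : ℝ))
    ⟨hφ.1.smul contDiff_const, hφ.2.1.smul_right, hs.trans hφ.2.2⟩
  unfold ip at this
  simp only [curl_smul_single, inner_cross_single] at this
  rw [this]
  refine integral_congr_ae (Eventually.of_forall fun x => ?_)
  simp [inner_smul_right, EuclideanSpace.inner_single_right, mul_comm]

theorem MemL2.cross_grad {Ω : Set E3} {v : E3 → E3} (hv : MemL2 Ω v) {g : E3 → E3}
    (hg : MemL2 Ω g) (k : Fin 3) : IntegrableOn (fun x => cross (v x) (g x) k) Ω := by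
  have h : ∀ i j, Integrable (fun x => v x i * g x j) (volume.restrict Ω) := fun i j =>
    (hv.apply i).integrable_mul (hg.apply j)
  fin_cases k
  · exact ((h 1 2).sub (h 2 1)).congr (Eventually.of_forall fun x => by simp)
  · exact ((h 2 0).sub (h 0 2)).congr (Eventually.of_forall fun x => by simp)
  · exact ((h 0 1).sub (h 1 0)).congr (Eventually.of_forall fun x => by simp)

theorem IsTestFun.apply {Ω : Set E3} {Φ : E3 → E3} (h : IsTestFun Ω Φ) (k : Fin 3) :
    IsTestFun Ω fun x => Φ x k := by
  have hs : tsupport (fun x => Φ x k) ⊆ tsupport Φ :=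
    closure_mono fun x hx hx' => hx (by simp only [hx', PiLp.zero_apply])
  exact ⟨(EuclideanSpace.proj (𝕜 := ℝ) k).contDiff.comp h.1,
    h.2.1.of_isClosed_subset (isClosed_tsupport _) hs, hs.trans h.2.2⟩

theorem IsTestFun.memL2_grad {Ω : Set E3} {φ : E3 → ℝ} (hφ : IsTestFun Ω φ) :
    MemL2 Ω (grad φ) :=
  MemL2.of_apply fun i => by simpa only [grad_apply] using hφ.memL2_pderiv i

theorem hasWeakCurl_of_integral_cross {Ω : Set E3} {v c : E3 → E3} (hv : MemL2 Ω v)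
    (hc : MemL2 Ω c) (h : ∀ φ, IsTestFun Ω φ → ∀ k : Fin 3,
      ∫ x in Ω, cross (v x) (grad φ x) k = ∫ x in Ω, c x k * φ x) : HasWeakCurl Ω v c := by
  refine ⟨hv, hc, fun Φ hΦ => ?_⟩
  unfold ip
  simp only [inner_curl]
  rw [integral_finsetSum _ fun k _ => hv.cross_grad (hΦ.apply k).memL2_grad k]
  rw [Finset.sum_congr rfl fun k _ => h _ (hΦ.apply k) k,
    ← integral_finsetSum _ fun k _ => (hc.apply k).integrable_mul (hΦ.apply k).memL2]
  refine integral_congr_ae (Eventually.of_forall fun x => ?_)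
  simp [PiLp.inner_apply, mul_comm]

theorem HasWeakCurl.unique {Ω : Set E3} (hΩ : IsOpen Ω) {v c c' : E3 → E3}
    (h : HasWeakCurl Ω v c) (h' : HasWeakCurl Ω v c') : c =ᵐ[volume.restrict Ω] c' :=
  ae_eq_of_apply fun k => MemL2.ae_eq_of_test hΩ (h.2.1.apply k) (h'.2.1.apply k) fun φ hφ => by
    rw [← h.integral_cross hφ k, ← h'.integral_cross hφ k]

theorem MemHcurl.hasWeakCurl {Ω : Set E3} {v : E3 → E3} (h : MemHcurl Ω v) :
    HasWeakCurl Ω v (weakCurl Ω v) := by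
  unfold weakCurl
  rw [dif_pos h]
  exact h.choose_spec

theorem HasWeakCurl.weakCurl_ae_eq {Ω : Set E3} (hΩ : IsOpen Ω) {v c : E3 → E3}
    (h : HasWeakCurl Ω v c) : weakCurl Ω v =ᵐ[volume.restrict Ω] c :=
  MemHcurl.hasWeakCurl ⟨c, h⟩ |>.unique hΩ h

/-- The curl of a field whose components have the gradients `g 0`, `g 1`, `g 2`. -/
def curlOf (g : Fin 3 → E3 → E3) (x : E3) : E3 :=
  !₂[g 2 x 1 - g 1 x 2, g 0 x 2 - g 2 x 0, g 1 x 0 - g 0 x 1]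

theorem inner_curlOf (v : E3) (g : Fin 3 → E3 → E3) (x : E3) :
    inner ℝ v (curlOf g x) = ∑ k : Fin 3, cross v (g k x) k := by
  simp [Fin.sum_univ_three, inner_three, curlOf]
  ring

theorem hasWeakCurl_curlOf {Ω : Set E3} {Φ : E3 → E3} {g : Fin 3 → E3 → E3}
    (h : ∀ k, HasWeakGrad Ω (fun x => Φ x k) (g k)) : HasWeakCurl Ω Φ (curlOf g) := by
  have hΦ : MemL2 Ω Φ := MemL2.of_apply fun k => (h k).1
  refine hasWeakCurl_of_integral_cross hΦ (MemL2.of_apply fun k => ?_) fun φ hφ k => ?_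
  · have hm : ∀ i j, MemL2 Ω fun x => g i x j := fun i j => (h i).2.1.apply j
    fin_cases k
    · exact MemLp.sub (hm 2 1) (hm 1 2)
    · exact MemLp.sub (hm 0 2) (hm 2 0)
    · exact MemLp.sub (hm 1 0) (hm 0 1)
  · have h1 : ∀ i j, IntegrableOn (fun x => Φ x i * pderiv j φ x) Ω := fun i j =>
      (hΦ.apply i).integrable_mul (hφ.memL2_pderiv j)
    have h2 : ∀ i j, IntegrableOn (fun x => g i x j * φ x) Ω := fun i j =>
      ((h i).2.1.apply j).integrable_mul hφ.memL2
    have h3 := fun i j => (h i).2.2 φ hφ j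
    fin_cases k <;>
      simp only [curlOf, grad_apply, Fin.zero_eta, Fin.mk_one, Fin.reduceFinMk, cross_zero_apply,
        cross_one_apply, cross_two_apply, PiLp.toLp_apply, Matrix.cons_val_zero, Matrix.cons_val_one,
        Matrix.cons_val, sub_mul] <;>
      rw [integral_sub (h1 _ _) (h1 _ _), integral_sub (h2 _ _) (h2 _ _), h3, h3] <;> ring

theorem hasWeakGrad_of_contDiff {Ω : Set E3} (hΩ : MeasurableSet Ω) {f : E3 → ℝ}
    (hf : ContDiff ℝ ∞ f) (h1 : MemL2 Ω f) (h2 : MemL2 Ω (grad f)) : HasWeakGrad Ω f (grad f) := by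
  refine ⟨h1, h2, fun φ hφ i => ?_⟩
  simp only [grad_apply]
  rw [← hφ.setIntegral_eq MeasurableSet.univ (Set.subset_univ Ω) fun x hx => by
      rw [pderiv_eq_zero_of_notMem hx, mul_zero],
    ← hφ.setIntegral_eq MeasurableSet.univ (Set.subset_univ Ω) fun x hx => by
      rw [image_eq_zero_of_notMem_tsupport hx, mul_zero], setIntegral_univ, setIntegral_univ]
  refine integral_mul_fderiv_eq_neg_fderiv_mul_of_integrable ?_ ?_ ?_ ?_ ?_
  · exact ((continuous_pderiv hf i).mul hφ.1.continuous).integrable_of_hasCompactSupport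
      hφ.2.1.mul_left
  · exact (hf.continuous.mul (continuous_pderiv hφ.1 i)).integrable_of_hasCompactSupport
      (hasCompactSupport_pderiv hφ.2.1 i).mul_left
  · exact (hf.continuous.mul hφ.1.continuous).integrable_of_hasCompactSupport hφ.2.1.mul_left
  · exact fun x _ => hf.diffAt x
  · exact fun x _ => hφ.1.diffAt x

theorem hasWeakGrad_of_hasCompactSupport {Ω : Set E3} (hΩ : MeasurableSet Ω) {f : E3 → ℝ}
    (hf : ContDiff ℝ ∞ f) (hc : HasCompactSupport f) : HasWeakGrad Ω f (grad f) := by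
  refine hasWeakGrad_of_contDiff hΩ hf (MemL2.of_continuous hf.continuous hc)
    (MemL2.of_apply fun i => ?_)
  simp only [grad_apply]
  exact MemL2.of_continuous (continuous_pderiv hf i) (hasCompactSupport_pderiv hc i)

/-! ### Integrals over faces -/

theorem IsTet.integrable_face {K : Finset E3} (hK : IsTet K) {b : E3} (hb : b ∈ K) {f : E3 → ℝ}
    (hf : ContinuousOn f (hull (K.erase b))) :
    IntegrableOn f (hull (K.erase b)) (Measure.hausdorffMeasure 2 : Measure E3) := by
  obtain ⟨w₀, w₁, w₂, hfr⟩ := hK.exists_isFrame hb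
  obtain ⟨C, hC⟩ := (isCompact_hull (K.erase b)).exists_bound_of_continuousOn hf
  have hfin : IsFiniteMeasure
      ((Measure.hausdorffMeasure 2 : Measure E3).restrict (hull (K.erase b))) :=
    ⟨by simpa using hfr.hausdorffMeasure_face_lt_top⟩
  exact Integrable.of_bound (hf.aestronglyMeasurable (measurableSet_hull _)) C
    ((ae_restrict_iff' (measurableSet_hull _)).2 (Eventually.of_forall hC))

theorem faceInt_congr {K : Finset E3} {b : E3} {f g : E3 → ℝ}
    (h : ∀ x ∈ hull (K.erase b), f x = g x) : faceInt K b f = faceInt K b g :=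
  setIntegral_congr_fun (measurableSet_hull _) h

theorem faceInt_eq_zero {K : Finset E3} {b : E3} {f : E3 → ℝ}
    (h : ∀ x ∈ hull (K.erase b), f x = 0) : faceInt K b f = 0 := by
  rw [faceInt_congr h]; simp [faceInt]

theorem IsTet.faceInt_sub {K : Finset E3} (hK : IsTet K) {b : E3} (hb : b ∈ K) {f g : E3 → ℝ}
    (hf : ContinuousOn f (hull (K.erase b))) (hg : ContinuousOn g (hull (K.erase b))) :
    faceInt K b (fun x => f x - g x) = faceInt K b f - faceInt K b g :=
  integral_sub (hK.integrable_face hb hf) (hK.integrable_face hb hg)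

theorem IsTet.faceInt_add {K : Finset E3} (hK : IsTet K) {b : E3} (hb : b ∈ K) {f g : E3 → ℝ}
    (hf : ContinuousOn f (hull (K.erase b))) (hg : ContinuousOn g (hull (K.erase b))) :
    faceInt K b (fun x => f x + g x) = faceInt K b f + faceInt K b g :=
  integral_add (hK.integrable_face hb hf) (hK.integrable_face hb hg)

theorem faceInt_const_mul (K : Finset E3) (b : E3) (c : ℝ) (f : E3 → ℝ) :
    faceInt K b (fun x => c * f x) = c * faceInt K b f := integral_const_mul c f

theorem IsTet.faceNormal_ne_zero {K : Finset E3} (hK : IsTet K) {b : E3} (hb : b ∈ K) :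
    faceNormal K b ≠ 0 := by
  obtain ⟨κ, hκ, h, -⟩ := hK.exists_faceNormal hb
  rw [h]
  exact neg_ne_zero.2 (smul_ne_zero hκ.ne' (hK.glam_ne_zero hb))

theorem cross_smul_left (c : ℝ) (u v : E3) : cross (c • u) v = c • cross u v := by
  apply ext_three <;> simp <;> ring

theorem cross_neg_left (u v : E3) : cross (-u) v = -cross u v := by
  apply ext_three <;> simp <;> ring

theorem cross_sub_right (u v w : E3) : cross u (v - w) = cross u v - cross u w := by
  apply ext_three <;> simp <;> ring

theorem IsTet.cross_faceNormal_eq_zero_iff {K : Finset E3} (hK : IsTet K) {b : E3} (hb : b ∈ K)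
    {w : E3} : cross (faceNormal K b) w = 0 ↔ cross (glam K b) w = 0 := by
  obtain ⟨κ, hκ, h, -⟩ := hK.exists_faceNormal hb
  rw [h, cross_neg_left, cross_smul_left, neg_eq_zero, smul_eq_zero, or_iff_right hκ.ne']

/-! ### Gauss theorems on one tetrahedron -/

theorem MemL2.integrableOn_hull {K : Finset E3} {f : E3 → ℝ} (hf : MemL2 (interior (hull K)) f) :
    IntegrableOn f (hull K) := by
  unfold MemL2 at hf
  rw [Measure.restrict_congr_set (interior_hull_ae_eq K)] at hf
  have hfin : IsFiniteMeasure (volume.restrict (hull K)) :=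
    ⟨by simpa using (isCompact_hull K).measure_lt_top⟩
  exact hf.integrable (by norm_num)

theorem memL2_of_continuousOn {K : Finset E3} {F : Type*} [NormedAddCommGroup F]
    [SecondCountableTopology F] {f : E3 → F}
    (hf : ContinuousOn f (hull K)) : MemL2 (hull K) f := by
  obtain ⟨C, hC⟩ := (isCompact_hull K).exists_bound_of_continuousOn hf
  have hfin : IsFiniteMeasure (volume.restrict (hull K)) :=
    ⟨by simpa using (isCompact_hull K).measure_lt_top⟩
  exact MemLp.of_bound (hf.aestronglyMeasurable (measurableSet_hull K)) C
    ((ae_restrict_iff' (measurableSet_hull _)).2 (Eventually.of_forall hC))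

theorem hasWeakGrad_interior_hull (K : Finset E3) {f : E3 → ℝ} (hf : ContDiff ℝ ∞ f) :
    HasWeakGrad (interior (hull K)) f (grad f) := by
  refine hasWeakGrad_of_contDiff isOpen_interior.measurableSet hf ?_ (MemL2.of_apply fun i => ?_) <;>
    refine MemLp.mono_measure (Measure.restrict_mono interior_subset le_rfl)
      (memL2_of_continuousOn ?_ : MemL2 (hull K) _)
  · exact hf.continuous.continuousOn
  · simp only [grad_apply]; exact (continuous_pderiv hf i).continuousOn

theorem IsTet.gauss_grad {K : Finset E3} (hK : IsTet K) (i : Fin 3) {u P : E3 → ℝ} {g : E3 → E3}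
    (hu : ContinuousOn u (hull K)) (hg : HasWeakGrad (interior (hull K)) u g)
    (hP : ContDiff ℝ ∞ P) :
    ∫ x in hull K, (u x * pderiv i P x + g x i * P x) =
      ∑ b ∈ K, faceNormal K b i * faceInt K b fun x => u x * P x := by
  refine hK.gauss hu (hg.2.1.apply i).integrableOn_hull (fun φ hφ => ?_) hP
  rw [← setIntegral_congr_set (interior_hull_ae_eq K), hg.2.2 φ hφ i,
    setIntegral_congr_set (interior_hull_ae_eq K)]

/-- All components of the vector field are smooth. -/
def SmoothField (w : E3 → E3) : Prop := ∀ i : Fin 3, ContDiff ℝ ∞ fun x => w x i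

theorem SmoothField.continuous {w : E3 → E3} (hw : SmoothField w) : Continuous w :=
  (PiLp.continuous_toLp 2 _).comp (continuous_pi fun i => (hw i).continuous)

theorem SmoothField.continuous_cross {w : E3 → E3} (hw : SmoothField w) (N : E3) (k : Fin 3) :
    Continuous fun x => cross N (w x) k := by
  have := fun i => (hw i).continuous
  fin_cases k
  · exact (((this 2).const_mul (N 1)).sub ((this 1).const_mul (N 2))).congr fun x => by simp
  · exact (((this 0).const_mul (N 2)).sub ((this 2).const_mul (N 0))).congr fun x => by simp
  · exact (((this 1).const_mul (N 0)).sub ((this 0).const_mul (N 1))).congr fun x => by simp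

theorem curl_apply (w : E3 → E3) (x : E3) :
    curl w x 0 = pderiv 1 (fun y => w y 2) x - pderiv 2 (fun y => w y 1) x ∧
    curl w x 1 = pderiv 2 (fun y => w y 0) x - pderiv 0 (fun y => w y 2) x ∧
    curl w x 2 = pderiv 0 (fun y => w y 1) x - pderiv 1 (fun y => w y 0) x := ⟨rfl, rfl, rfl⟩

theorem SmoothField.continuous_curl {w : E3 → E3} (hw : SmoothField w) : Continuous (curl w) := by
  have h := fun i j => continuous_pderiv (hw i) j
  refine (PiLp.continuous_toLp 2 _).comp (continuous_pi fun k => ?_)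
  fin_cases k
  · exact (h 2 1).sub (h 1 2)
  · exact (h 0 2).sub (h 2 0)
  · exact (h 1 0).sub (h 0 1)

/-- Each component of `u curl w + ∇u × w` is a difference of two partial derivatives of products, so
two scalar Gauss formulas are subtracted. -/
theorem IsTet.gauss_curl {K : Finset E3} (hK : IsTet K) (k : Fin 3) {u : E3 → ℝ} {g w : E3 → E3}
    (hu : ContinuousOn u (hull K)) (hg : HasWeakGrad (interior (hull K)) u g)
    (hw : SmoothField w) :
    ∫ x in hull K, (u x * curl w x k - cross (w x) (g x) k) =
      ∑ b ∈ K, faceInt K b fun x => u x * cross (faceNormal K b) (w x) k := by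
  have key : ∀ i j l m : Fin 3,
      ∫ x in hull K, ((u x * pderiv i (fun y => w y j) x + g x i * w x j) -
        (u x * pderiv l (fun y => w y m) x + g x l * w x m)) =
      ∑ b ∈ K, faceInt K b fun x => u x *
        (faceNormal K b i * w x j - faceNormal K b l * w x m) := by
    intro i j l m
    have hint : ∀ i j, IntegrableOn (fun x => u x * pderiv i (fun y => w y j) x + g x i * w x j)
        (hull K) := fun i j =>
      ((hu.mul (continuous_pderiv (hw j) i).continuousOn).integrableOn_compact
        (isCompact_hull K)).add ((hg.2.1.apply i).integrableOn_hull.mul_continuousOn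
          (hw j).continuous.continuousOn (isCompact_hull K))
    rw [integral_sub (hint i j) (hint l m), hK.gauss_grad i hu hg (hw j),
      hK.gauss_grad l hu hg (hw m), ← Finset.sum_sub_distrib]
    refine Finset.sum_congr rfl fun b hb => ?_
    have hc : ∀ j, ContinuousOn (fun x => u x * w x j) (hull (K.erase b)) := fun j =>
      (hu.mono (hull_mono (Finset.erase_subset b K))).mul (hw j).continuous.continuousOn
    rw [← faceInt_const_mul, ← faceInt_const_mul, ← hK.faceInt_sub hb
      ((hc j).const_mul _) ((hc m).const_mul _)]
    exact faceInt_congr fun x _ => by ring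
  fin_cases k
  · simpa using (integral_congr_ae (Eventually.of_forall fun x => by
      simp [(curl_apply w x).1]; ring)).trans (key 1 2 2 1)
  · simpa using (integral_congr_ae (Eventually.of_forall fun x => by
      simp [(curl_apply w x).2.1]; ring)).trans (key 2 0 0 2)
  · simpa using (integral_congr_ae (Eventually.of_forall fun x => by
      simp [(curl_apply w x).2.2]; ring)).trans (key 0 1 1 0)

/-! ### Sums over the faces of a conforming family -/

/-- The face of `K` opposite to `b` belongs to no other tetrahedron of the family. -/
def IsOuter (S : Finset (Finset E3)) (K : Finset E3) (b : E3) : Prop :=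
  ∀ L ∈ S, K.erase b ⊆ L → L = K

namespace Conforming

variable {S : Finset (Finset E3)} (hS : Conforming S)
include hS

theorem not_mem_of_erase_eq {K L : Finset E3} (hK : K ∈ S) (hL : L ∈ S) (hne : K ≠ L) {b c : E3}
    (hc : c ∈ L) (h : L.erase c = K.erase b) : c ∉ K := by
  intro hcK
  refine hne (hS.eq_of_subset hL hK fun v hv => ?_).symm
  by_cases hvc : v = c
  · rwa [hvc]
  · exact Finset.mem_of_mem_erase (h ▸ Finset.mem_erase.2 ⟨hvc, hv⟩)

/-- With three cells at one face, the coordinates of the opposite vertices would be pairwise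
negative multiples of each other, but the product of two negative factors is positive. -/
theorem eq_of_erase_eq {K L M : Finset E3} (hK : K ∈ S) (hL : L ∈ S) (hM : M ∈ S) (hKL : K ≠ L)
    (hKM : K ≠ M) {b c d : E3} (hb : b ∈ K) (hc : c ∈ L) (hd : d ∈ M)
    (h : L.erase c = K.erase b) (h' : M.erase d = K.erase b) : L = M := by
  by_contra hLM
  obtain ⟨s, hs, e1⟩ := hS.exists_neg_lam_eq hK hL hb hc (hS.not_mem_of_erase_eq hK hL hKL hc h) h
  obtain ⟨t, ht, e2⟩ := hS.exists_neg_lam_eq hK hM hb hd (hS.not_mem_of_erase_eq hK hM hKM hd h') h'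
  obtain ⟨r, hr, e3⟩ := hS.exists_neg_lam_eq hL hM hc hd
    (hS.not_mem_of_erase_eq hL hM hLM hd (h'.trans h.symm)) (h'.trans h.symm)
  have h1 := e3 b
  rw [e1, e2, (hS.tet K hK).lam_self hb] at h1
  nlinarith [mul_pos_of_neg_of_neg hr hs]

theorem vertex_eq {K : Finset E3} (hK : K ∈ S) {b c : E3} (hb : b ∈ K) (hc : c ∈ K)
    (h : K.erase b = K.erase c) : b = c := by
  by_contra hbc
  have : b ∈ K.erase b := h ▸ Finset.mem_erase.2 ⟨hbc, hb⟩
  simp at this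

/-- Pairing each inner face with its copy in the neighbouring cell is an involution; outer faces are
its fixed points. -/
theorem sum_faces_eq_zero {X : Finset E3 → E3 → ℝ}
    (hout : ∀ K ∈ S, ∀ b ∈ K, IsOuter S K b → X K b = 0)
    (hin : ∀ K ∈ S, ∀ L ∈ S, K ≠ L → ∀ b ∈ K, ∀ c ∈ L, L.erase c = K.erase b →
      X K b + X L c = 0) :
    ∑ K ∈ S, ∑ b ∈ K, X K b = 0 := by
  rw [Finset.sum_sigma']
  set P : (Σ _ : Finset E3, E3) → (Σ _ : Finset E3, E3) → Prop := fun p q =>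
    q ∈ S.sigma (fun K => K) ∧ p.1 ≠ q.1 ∧ q.1.erase q.2 = p.1.erase p.2 with hP
  -- The partner face where one exists; outer faces are mapped to themselves.
  set τ : (Σ _ : Finset E3, E3) → (Σ _ : Finset E3, E3) := fun p =>
    if h : ∃ q, P p q then h.choose else p with hτ
  have hτP : ∀ p, (∃ q, P p q) → P p (τ p) := fun p h => by
    simp only [hτ]; rw [dif_pos h]; exact h.choose_spec
  have hout' : ∀ p ∈ S.sigma (fun K => K), ¬ (∃ q, P p q) → X p.1 p.2 = 0 := by
    intro p hp hno
    rw [Finset.mem_sigma] at hp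
    refine hout _ hp.1 _ hp.2 fun L hL hsub => ?_
    by_contra hne
    obtain ⟨c, hc, -, he⟩ := hS.exists_erase_eq hp.1 hL (Ne.symm hne) hp.2 hsub
    exact hno ⟨⟨L, c⟩, Finset.mem_sigma.2 ⟨hL, hc⟩, Ne.symm hne, he⟩
  refine Finset.sum_involution (fun p _ => τ p) ?_ ?_ ?_ ?_
  · intro p hp
    by_cases h : ∃ q, P p q
    · obtain ⟨h1, h2, h3⟩ := hτP p h
      rw [Finset.mem_sigma] at hp h1
      exact hin _ hp.1 _ h1.1 h2 _ hp.2 _ h1.2 h3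
    · have : τ p = p := dif_neg h
      rw [this, hout' p hp h, add_zero]
  · intro p hp hX heq
    by_cases h : ∃ q, P p q
    · have h2 := (hτP p h).2.1
      rw [heq] at h2
      exact h2 rfl
    · exact hX (hout' p hp h)
  · intro p hp
    by_cases h : ∃ q, P p q
    · exact (hτP p h).1
    · have : τ p = p := dif_neg h
      rwa [this]
  · intro p hp
    by_cases h : ∃ q, P p q
    · obtain ⟨h1, h2, h3⟩ := hτP p h
      have h' : ∃ q, P (τ p) q := ⟨p, hp, h2.symm, h3.symm⟩
      obtain ⟨k1, k2, k3⟩ := hτP _ h'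
      rw [Finset.mem_sigma] at hp h1 k1
      have e1 : (τ (τ p)).1 = p.1 := hS.eq_of_erase_eq h1.1 k1.1 hp.1 k2 h2.symm h1.2 k1.2 hp.2
        k3 h3.symm
      refine Sigma.ext e1 (heq_of_eq ?_)
      refine hS.vertex_eq hp.1 (e1 ▸ k1.2) hp.2 ?_
      rw [← h3, ← k3, e1]
    · have : τ p = p := dif_neg h
      rw [this, this]

/-! ### Localization of surface densities to a point of a face. -/

theorem erase_eq_of_mem {K L : Finset E3} (hK : K ∈ S) (hL : L ∈ S) {b c : E3} (hb : b ∈ K)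
    (hc : c ∈ L) {x : E3} (hx : x ∈ openFace K (K.erase b)) (hxL : x ∈ hull (L.erase c)) :
    L.erase c = K.erase b := by
  have hTK := hS.tet K hK
  have hTL := hS.tet L hL
  have hsub := hS.subset_of_mem_openFace hK hL (Finset.erase_subset b K) hx
    (hull_mono (Finset.erase_subset c L) hxL)
  rw [openFace_congr hTK hTL (Finset.erase_subset b K) hsub] at hx
  have h0 := ((hTL.mem_hull_subset_iff (Finset.erase_subset c L)).1 hxL).2 c hc (by simp)
  have hcK : c ∉ K.erase b := fun h => (hx.1 c h).ne' h0
  refine (Finset.eq_of_subset_of_card_le (fun v hv => Finset.mem_erase.2 ⟨?_, hsub hv⟩) ?_).symm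
  · rintro rfl; exact hcK hv
  · rw [Finset.card_erase_of_mem hb, Finset.card_erase_of_mem hc, hTK.card, hTL.card]

/-- A sum of surface densities that vanishes against all smooth functions supported near a point of
a face vanishes at this point. -/
theorem localize {h : Finset E3 → E3 → E3 → ℝ}
    (hh : ∀ K ∈ S, ∀ b ∈ K, ContinuousOn (h K b) (hull (K.erase b)))
    {K : Finset E3} (hK : K ∈ S) {b : E3} (hb : b ∈ K) {x : E3} (hx : x ∈ openFace K (K.erase b))
    {U : Set E3} (hU : U ∈ 𝓝 x)
    (hφ : ∀ φ : E3 → ℝ, IsTestFun U φ →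
      ∑ L ∈ S, ∑ c ∈ L, faceInt L c (fun y => φ y * h L c y) = 0) :
    ∑ p ∈ (S.sigma fun L => L).filter (fun p => p.1.erase p.2 = K.erase b), h p.1 p.2 x = 0 := by
  set F := K.erase b with hF
  set I := (S.sigma fun L => L).filter (fun p => p.1.erase p.2 = F) with hI
  set H : E3 → ℝ := fun y => ∑ p ∈ I, h p.1 p.2 y with hH
  have hIc : ∀ p ∈ I, ContinuousOn (h p.1 p.2) (hull F) := fun p hp => by
    rw [hI, Finset.mem_filter, Finset.mem_sigma] at hp
    rw [← hp.2]; exact hh _ hp.1.1 _ hp.1.2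
  have hHc : ContinuousOn H (hull F) := continuousOn_finsetSum I hIc
  have hTK := hS.tet K hK
  have hxF : x ∈ hull F := openFace_subset hTK (Finset.erase_subset b K) hx
  by_contra hne
  change H x ≠ 0 at hne
  have hev1 : ∀ᶠ y in 𝓝 x, y ∈ hull F → 0 < H y * H x := by
    have : Tendsto (fun y => H y * H x) (𝓝[hull F] x) (𝓝 (H x * H x)) :=
      (hHc x hxF).mul tendsto_const_nhds
    exact eventually_nhdsWithin_iff.1 (this.eventually (lt_mem_nhds (mul_self_pos.2 hne)))
  have hev2 : ∀ᶠ y in 𝓝 x, ∀ p ∈ S.sigma (fun L => L), y ∈ hull (p.1.erase p.2) →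
      x ∈ hull (p.1.erase p.2) := by
    rw [Filter.eventually_all_finset]
    intro p _
    by_cases hxp : x ∈ hull (p.1.erase p.2)
    · exact Eventually.of_forall fun _ _ => hxp
    · filter_upwards [(isClosed_hull (p.1.erase p.2)).isOpen_compl.mem_nhds hxp] with y hy hy'
      exact absurd hy' hy
  -- In this ball `H` keeps the sign of `H x` on the face, and only faces through `x` occur; these
  -- all have the vertices `F`, as `x` is in the relative interior.
  obtain ⟨r, hr, hrb⟩ := Metric.nhds_basis_closedBall.mem_iff.1
    (Filter.inter_mem hU (Filter.inter_mem hev1 hev2))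
  let φ : ContDiffBump x := ⟨r / 2, r, by positivity, by linarith⟩
  have hφt : IsTestFun U φ :=
    ⟨φ.contDiff, φ.hasCompactSupport, by
      rw [φ.tsupport_eq]; exact fun y hy => (hrb hy).1⟩
  have hzero := hφ φ hφt
  have hrest : ∑ p ∈ (S.sigma fun L => L).filter (fun p => ¬ p.1.erase p.2 = F),
      faceInt p.1 p.2 (fun y => φ y * h p.1 p.2 y) = 0 := by
    refine Finset.sum_eq_zero fun p hp => ?_
    rw [Finset.mem_filter] at hp
    refine faceInt_eq_zero fun y hy => ?_
    by_cases hyr : y ∈ Metric.closedBall x r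
    · exact absurd (hS.erase_eq_of_mem hK (Finset.mem_sigma.1 hp.1).1 hb (Finset.mem_sigma.1 hp.1).2
        hx ((hrb hyr).2.2 p hp.1 hy)) hp.2
    · rw [← φ.tsupport_eq] at hyr
      rw [image_eq_zero_of_notMem_tsupport hyr, zero_mul]
  rw [Finset.sum_sigma' S (fun L => L) (fun L c => faceInt L c fun y => φ y * h L c y),
    ← Finset.sum_filter_add_sum_filter_not _ (fun p => p.1.erase p.2 = F), hrest, add_zero] at hzero
  have hsum : ∑ p ∈ I, faceInt p.1 p.2 (fun y => φ y * h p.1 p.2 y) =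
      ∫ y in hull F, φ y * H y ∂(Measure.hausdorffMeasure 2 : Measure E3) := by
    simp only [hH, Finset.mul_sum]
    have hint : ∀ p ∈ I, Integrable (fun y => φ y * h p.1 p.2 y)
        ((Measure.hausdorffMeasure 2 : Measure E3).restrict (hull F)) := fun p hp =>
      hTK.integrable_face hb (φ.continuous.continuousOn.mul (hIc p hp))
    rw [integral_finsetSum I hint]
    refine Finset.sum_congr rfl fun p hp => ?_
    rw [hI, Finset.mem_filter] at hp
    simp only [faceInt, hp.2]
  rw [hsum] at hzero
  have hint : IntegrableOn (fun y => φ y * H y * H x) (hull F)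
      (Measure.hausdorffMeasure 2 : Measure E3) :=
    hTK.integrable_face hb ((φ.continuous.continuousOn.mul hHc).mul continuousOn_const)
  have hnonneg : ∀ y ∈ hull F, 0 ≤ φ y * H y * H x := by
    intro y hy
    by_cases hyr : y ∈ Metric.closedBall x r
    · rw [mul_assoc]; exact mul_nonneg φ.nonneg ((hrb hyr).2.1 hy).le
    · rw [← φ.tsupport_eq] at hyr
      rw [image_eq_zero_of_notMem_tsupport hyr]; simp
  -- The factor `H x` makes the integrand nonnegative whatever its sign, and positive on a part of
  -- the face of positive measure.
  have hpos : 0 < ∫ y in hull F, φ y * H y * H x ∂(Measure.hausdorffMeasure 2 : Measure E3) := by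
    rw [setIntegral_pos_iff_support_of_nonneg_ae
      ((ae_restrict_iff' (measurableSet_hull F)).2 (Eventually.of_forall hnonneg)) hint]
    obtain ⟨w₀, w₁, w₂, hfr⟩ := hTK.exists_isFrame hb
    refine (hfr.hausdorffMeasure_face_inter_pos Metric.isOpen_ball (Metric.mem_ball_self hr)
      hx).trans_le (measure_mono fun y hy => ⟨?_, hy.2⟩)
    have h1 : 0 < φ y := by
      rw [← φ.support_eq] at hy
      exact lt_of_le_of_ne φ.nonneg (Ne.symm hy.1)
    have h2 := (hrb (Metric.ball_subset_closedBall hy.1)).2.1 hy.2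
    rw [Function.mem_support, mul_assoc]
    exact (mul_pos h1 h2).ne'
  rw [integral_mul_const, hzero, zero_mul] at hpos
  exact lt_irrefl 0 hpos

theorem localize_outer {h : Finset E3 → E3 → E3 → ℝ}
    (hh : ∀ K ∈ S, ∀ b ∈ K, ContinuousOn (h K b) (hull (K.erase b)))
    {K : Finset E3} (hK : K ∈ S) {b : E3} (hb : b ∈ K) {x : E3} (hx : x ∈ openFace K (K.erase b))
    (ho : IsOuter S K b) {U : Set E3} (hU : U ∈ 𝓝 x)
    (hφ : ∀ φ : E3 → ℝ, IsTestFun U φ →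
      ∑ L ∈ S, ∑ c ∈ L, faceInt L c (fun y => φ y * h L c y) = 0) : h K b x = 0 := by
  have := hS.localize hh hK hb hx hU hφ
  rwa [Finset.sum_eq_single_of_mem ⟨K, b⟩ (by simp [hK, hb])] at this
  rintro ⟨L, c⟩ hp hne
  simp only [Finset.mem_filter, Finset.mem_sigma] at hp
  have e := ho L hp.1.1 (hp.2 ▸ Finset.erase_subset c L)
  subst e
  rw [hS.vertex_eq hK hp.1.2 hb hp.2] at hne
  exact absurd rfl hne

/-- Exactly two cells share an inner face, so the localized sum has two terms. -/
theorem localize_inner {h : Finset E3 → E3 → E3 → ℝ}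
    (hh : ∀ K ∈ S, ∀ b ∈ K, ContinuousOn (h K b) (hull (K.erase b)))
    {K L : Finset E3} (hK : K ∈ S) (hL : L ∈ S) (hne : K ≠ L) {b c : E3} (hb : b ∈ K) (hc : c ∈ L)
    (he : L.erase c = K.erase b) {x : E3} (hx : x ∈ openFace K (K.erase b))
    (hφ : ∀ φ : E3 → ℝ, IsTestFun (dom S) φ →
      ∑ L ∈ S, ∑ c ∈ L, faceInt L c (fun y => φ y * h L c y) = 0) :
    h K b x + h L c x = 0 := by
  have hxd := hS.mem_dom_of_mem_openFace hK hL hne hb (he ▸ Finset.erase_subset c L) hx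
  have := hS.localize hh hK hb hx ((isOpen_dom S).mem_nhds hxd) hφ
  have hset : (S.sigma fun L => L).filter (fun p => p.1.erase p.2 = K.erase b) =
      {⟨K, b⟩, ⟨L, c⟩} := by
    ext ⟨M, d⟩
    simp only [Finset.mem_filter, Finset.mem_sigma, Finset.mem_insert, Finset.mem_singleton]
    constructor
    · rintro ⟨⟨hM, hd⟩, hMK⟩
      by_cases hKM : K = M
      · subst hKM
        left; rw [hS.vertex_eq hK hd hb hMK]
      · right
        have := hS.eq_of_erase_eq hK hL hM hne hKM hb hc hd he hMK
        subst this
        rw [hS.vertex_eq hL hd hc (hMK.trans he.symm)]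
    · rintro (h | h) <;> cases h
      · exact ⟨⟨hK, hb⟩, rfl⟩
      · exact ⟨⟨hL, hc⟩, he⟩
  rwa [hset, Finset.sum_pair (by simp [hne])] at this

/-- The scaled normals contain unspecified constants, so they are not compared directly. The
integral of a partial derivative of a test function over the domain is zero; the cellwise Gauss
theorem writes it as a sum of surface densities, and localization isolates the two normals. -/
theorem faceNormal_add {K L : Finset E3} (hK : K ∈ S) (hL : L ∈ S) (hne : K ≠ L) {b c : E3}
    (hb : b ∈ K) (hc : c ∈ L) (he : L.erase c = K.erase b) :
    faceNormal K b + faceNormal L c = 0 := by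
  obtain ⟨x, hx⟩ := openFace_nonempty (hS.tet K hK) (Finset.erase_subset b K)
    ((hS.tet K hK).erase_nonempty b)
  ext i
  refine hS.localize_inner (h := fun K b _ => faceNormal K b i) (fun _ _ _ _ => continuousOn_const)
    hK hL hne hb hc he hx fun φ hφ => ?_
  have h1 : ∀ M ∈ S, ∫ x in hull M, pderiv i φ x =
      ∑ c ∈ M, faceInt M c (fun y => φ y * faceNormal M c i) := by
    intro M hM
    have := (hS.tet M hM).gauss_grad i (u := fun _ => 1) (P := φ) continuousOn_const
      (hasWeakGrad_interior_hull M contDiff_const) hφ.1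
    simp only [grad_apply, pderiv_const, one_mul, zero_mul, add_zero] at this
    rw [this]
    refine Finset.sum_congr rfl fun c _ => ?_
    rw [← faceInt_const_mul]
    exact faceInt_congr fun x _ => mul_comm _ _
  rw [← Finset.sum_congr rfl h1, ← hS.setIntegral_dom
    ((continuous_pderiv hφ.1 i).integrable_of_hasCompactSupport
      (hasCompactSupport_pderiv hφ.2.1 i)).integrableOn]
  have hfin : IsFiniteMeasure (volume.restrict (dom S)) := ⟨by simpa using volume_dom_lt_top S⟩
  have h2 := (hasWeakGrad_of_contDiff (Ω := dom S) (isOpen_dom S).measurableSet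
    (f := fun _ => (1 : ℝ)) contDiff_const (memLp_const 1) (by
      have : grad (fun _ : E3 => (1 : ℝ)) = fun _ => 0 := by
        funext x; ext j; rw [grad_apply, pderiv_const]; rfl
      rw [this]; exact memLp_const 0)).2.2 φ hφ i
  simpa [grad_apply, pderiv_const] using h2

end Conforming

/-! ### Piecewise smooth functions -/

/-- Almost everywhere on each tetrahedron `K` of the family, `u` equals `f K`. -/
def EqOnCells {F : Type*} (S : Finset (Finset E3)) (u : E3 → F) (f : Finset E3 → E3 → F) : Prop :=
  ∀ K ∈ S, ∀ᵐ x ∂(volume.restrict (hull K)), u x = f K x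

/-- The function that equals `f K` inside each tetrahedron `K` of the family. -/
def glue {F : Type*} [AddCommMonoid F] (S : Finset (Finset E3)) (f : Finset E3 → E3 → F)
    (x : E3) : F :=
  ∑ K ∈ S, (interior (hull K)).indicator (f K) x

theorem EqOnCells.ae_eq {F : Type*} {S : Finset (Finset E3)} {u v : E3 → F}
    {f : Finset E3 → E3 → F}
    (hu : EqOnCells S u f) (hv : EqOnCells S v f) : u =ᵐ[volume.restrict (dom S)] v :=
  ae_dom_iff.2 fun K hK => by
    filter_upwards [hu K hK, hv K hK] with x h1 h2
    rw [h1, h2]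

theorem Conforming.eqOnCells_glue {F : Type*} [AddCommMonoid F] {S : Finset (Finset E3)}
    (hS : Conforming S) (f : Finset E3 → E3 → F) : EqOnCells S (glue S f) f := by
  intro K hK
  rw [← Measure.restrict_congr_set (interior_hull_ae_eq K)]
  refine (ae_restrict_iff' isOpen_interior.measurableSet).2 (Eventually.of_forall fun x hx => ?_)
  unfold glue
  rw [Finset.sum_eq_single_of_mem K hK, Set.indicator_of_mem hx]
  exact fun L hL hne => Set.indicator_of_notMem
    (Set.disjoint_left.1 (hS.disjoint_interior hK hL hne.symm) hx) _

theorem Conforming.memL2_dom {F : Type*} [NormedAddCommGroup F] [SecondCountableTopology F]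
    {S : Finset (Finset E3)} (hS : Conforming S) {u : E3 → F} {f : Finset E3 → E3 → F}
    (hf : ∀ K ∈ S, Continuous (f K)) (hu : EqOnCells S u f) : MemL2 (dom S) u := by
  refine MemLp.ae_eq ((hS.eqOnCells_glue f).ae_eq hu) ?_
  refine MemLp.restrict (μ := volume) _ (memLp_finsetSum S fun K hK => ?_)
  rw [memLp_indicator_iff_restrict isOpen_interior.measurableSet]
  exact MemLp.mono_measure (Measure.restrict_mono interior_subset le_rfl)
    (memL2_of_continuousOn (hf K hK).continuousOn : MemL2 (hull K) _)

/-- `φ` has the smooth pieces `f K`. -/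
def SmoothPieces (S : Finset (Finset E3)) (f : Finset E3 → E3 → ℝ) : Prop :=
  ∀ K ∈ S, ContDiff ℝ ∞ (f K)

/-- The fields `w K` are smooth. -/
def SmoothFields (S : Finset (Finset E3)) (w : Finset E3 → E3 → E3) : Prop :=
  ∀ K ∈ S, SmoothField (w K)

theorem continuous_grad {f : E3 → ℝ} (hf : ContDiff ℝ ∞ f) : Continuous (grad f) := by
  refine (PiLp.continuous_toLp 2 _).comp (continuous_pi fun k => ?_)
  have := continuous_pderiv hf k
  fin_cases k <;> exact this

/-! ### Weak derivatives of piecewise smooth functions and continuity across inner faces. -/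

namespace Conforming

variable {S : Finset (Finset E3)} (hS : Conforming S)
include hS

theorem continuousOn_hull {u : E3 → ℝ} (hu : ContinuousOn u (closure (dom S))) {K : Finset E3}
    (hK : K ∈ S) : ContinuousOn u (hull K) := hu.mono (hS.hull_subset_closure hK)

theorem grad_green (i : Fin 3) {u q : E3 → ℝ} {g d : E3 → E3} {f : Finset E3 → E3 → ℝ}
    (hu : ContinuousOn u (closure (dom S))) (hg : HasWeakGrad (dom S) u g)
    (hf : SmoothPieces S f) (hq : EqOnCells S q f) (hd : EqOnCells S d fun K => grad (f K)) :
    ∫ x in dom S, (u x * d x i + g x i * q x) =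
      ∑ K ∈ S, ∑ b ∈ K, faceInt K b fun x => u x * (faceNormal K b i * f K x) := by
  have hqL := hS.memL2_dom (fun K hK => (hf K hK).continuous) hq
  have hdL := hS.memL2_dom (fun K hK => continuous_grad (hf K hK)) hd
  have hint : IntegrableOn (fun x => u x * d x i + g x i * q x) (dom S) :=
    (hg.1.integrable_mul (hdL.apply i)).add ((hg.2.1.apply i).integrable_mul hqL)
  rw [hS.setIntegral_dom hint]
  refine Finset.sum_congr rfl fun K hK => ?_
  have h1 : ∫ x in hull K, (u x * d x i + g x i * q x) =
      ∫ x in hull K, (u x * pderiv i (f K) x + g x i * f K x) := by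
    refine integral_congr_ae ?_
    filter_upwards [hq K hK, hd K hK] with x h1 h2
    rw [h1, h2, grad_apply]
  rw [h1, (hS.tet K hK).gauss_grad i (hS.continuousOn_hull hu hK)
    (hg.mono (isOpen_dom S).measurableSet (interior_hull_subset_dom hK)) (hf K hK)]
  refine Finset.sum_congr rfl fun b _ => ?_
  rw [← faceInt_const_mul]
  exact faceInt_congr fun x _ => by ring

theorem curl_green (k : Fin 3) {u : E3 → ℝ} {g v c : E3 → E3} {w : Finset E3 → E3 → E3}
    (hu : ContinuousOn u (closure (dom S))) (hg : HasWeakGrad (dom S) u g)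
    (hw : SmoothFields S w) (hv : EqOnCells S v w) (hc : EqOnCells S c fun K => curl (w K)) :
    ∫ x in dom S, (u x * c x k - cross (v x) (g x) k) =
      ∑ K ∈ S, ∑ b ∈ K, faceInt K b fun x => u x * cross (faceNormal K b) (w K x) k := by
  have hvL := hS.memL2_dom (fun K hK => (hw K hK).continuous) hv
  have hcL := hS.memL2_dom (fun K hK => (hw K hK).continuous_curl) hc
  have hint : IntegrableOn (fun x => u x * c x k - cross (v x) (g x) k) (dom S) :=
    (hg.1.integrable_mul (hcL.apply k)).sub (hvL.cross_grad hg.2.1 k)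
  rw [hS.setIntegral_dom hint]
  refine Finset.sum_congr rfl fun K hK => ?_
  have h1 : ∫ x in hull K, (u x * c x k - cross (v x) (g x) k) =
      ∫ x in hull K, (u x * curl (w K) x k - cross (w K x) (g x) k) := by
    refine integral_congr_ae ?_
    filter_upwards [hv K hK, hc K hK] with x h1 h2
    rw [h1, h2]
  rw [h1, (hS.tet K hK).gauss_curl k (hS.continuousOn_hull hu hK)
    (hg.mono (isOpen_dom S).measurableSet (interior_hull_subset_dom hK)) (hw K hK)]

theorem hasWeakGrad_test {φ : E3 → ℝ} (hφ : IsTestFun (dom S) φ) :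
    HasWeakGrad (dom S) φ (grad φ) :=
  hasWeakGrad_of_hasCompactSupport (isOpen_dom S).measurableSet hφ.1 hφ.2.1

theorem test_eq_zero {φ : E3 → ℝ} (hφ : IsTestFun (dom S) φ) {K : Finset E3} (hK : K ∈ S) {b : E3}
    (hb : b ∈ K) (ho : IsOuter S K b) {x : E3} (hx : x ∈ hull (K.erase b)) : φ x = 0 :=
  image_eq_zero_of_notMem_tsupport fun h => hS.notMem_dom_of_mem_hull hK hb ho hx (hφ.2.2 h)

/-- Continuity across the inner faces. -/
def _root_.MaxwellPatch.FaceAgree (S : Finset (Finset E3)) (f : Finset E3 → E3 → ℝ) : Prop :=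
  ∀ K ∈ S, ∀ L ∈ S, K ≠ L → ∀ b ∈ K, ∀ c ∈ L, L.erase c = K.erase b →
    ∀ x ∈ hull (K.erase b), f K x = f L x

/-- Continuity of the tangential components across the inner faces. -/
def _root_.MaxwellPatch.TangAgree (S : Finset (Finset E3)) (w : Finset E3 → E3 → E3) : Prop :=
  ∀ K ∈ S, ∀ L ∈ S, K ≠ L → ∀ b ∈ K, ∀ c ∈ L, L.erase c = K.erase b →
    ∀ x ∈ hull (K.erase b), cross (glam K b) (w K x - w L x) = 0

theorem faceInt_inner {K L : Finset E3} {b c : E3} (he : L.erase c = K.erase b) (f : E3 → ℝ) :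
    faceInt L c f = faceInt K b f := by
  unfold faceInt; rw [he]

/-- In the sum of the cellwise Gauss formulas the inner faces cancel because their normals are
opposite, and the test function vanishes on the outer faces. -/
theorem hasWeakGrad_of_faceAgree {u : E3 → ℝ} {g : E3 → E3} {f : Finset E3 → E3 → ℝ}
    (hf : SmoothPieces S f) (hu : EqOnCells S u f) (hg : EqOnCells S g fun K => grad (f K))
    (ha : FaceAgree S f) : HasWeakGrad (dom S) u g := by
  have huL := hS.memL2_dom (fun K hK => (hf K hK).continuous) hu
  have hgL := hS.memL2_dom (fun K hK => continuous_grad (hf K hK)) hg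
  refine ⟨huL, hgL, fun φ hφ i => ?_⟩
  have h1 := hS.grad_green i hφ.1.continuous.continuousOn (hS.hasWeakGrad_test hφ) hf hu hg
  rw [hS.sum_faces_eq_zero, integral_add (hφ.memL2.integrable_mul (hgL.apply i))
    ((hφ.memL2_grad.apply i).integrable_mul huL)] at h1
  · simp only [grad_apply] at h1
    rw [integral_congr_ae (Eventually.of_forall fun x => mul_comm (u x) (pderiv i φ x)),
      integral_congr_ae (Eventually.of_forall fun x => mul_comm (g x i) (φ x))]
    linarith
  · intro K hK b hb ho
    exact faceInt_eq_zero fun x hx => by rw [hS.test_eq_zero hφ hK hb ho hx, zero_mul]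
  · intro K hK L hL hne b hb c hc he
    rw [hS.faceInt_inner he, ← (hS.tet K hK).faceInt_add hb]
    · refine faceInt_eq_zero fun x hx => ?_
      have hN : faceNormal K b i + faceNormal L c i = 0 :=
        congrArg (fun v : E3 => v i) (hS.faceNormal_add hK hL hne hb hc he)
      rw [ha K hK L hL hne b hb c hc he x hx]
      linear_combination φ x * f L x * hN
    · exact (hφ.1.continuous.mul ((hf K hK).continuous.const_mul _)).continuousOn
    · exact (hφ.1.continuous.mul ((hf L hL).continuous.const_mul _)).continuousOn

theorem eqOnCells_grad {u : E3 → ℝ} {g : E3 → E3} {f : Finset E3 → E3 → ℝ}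
    (hf : SmoothPieces S f) (hu : EqOnCells S u f) (hg : HasWeakGrad (dom S) u g) :
    EqOnCells S g fun K => grad (f K) := by
  intro K hK
  have h1 := hg.mono (isOpen_dom S).measurableSet (interior_hull_subset_dom hK)
  have h2 : u =ᵐ[volume.restrict (interior (hull K))] f K := by
    rw [Measure.restrict_congr_set (interior_hull_ae_eq K)]; exact hu K hK
  have h3 := (h1.congr h2 EventuallyEq.rfl).unique isOpen_interior
    (hasWeakGrad_interior_hull K (hf K hK))
  rwa [Measure.restrict_congr_set (interior_hull_ae_eq K)] at h3

theorem eq_on_hull_of_openFace {K : Finset E3} (hK : K ∈ S) (b : E3) {F : Type*}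
    [TopologicalSpace F] [T2Space F] {f g : E3 → F} (hf : Continuous f) (hg : Continuous g)
    (h : ∀ x ∈ openFace K (K.erase b), f x = g x) : ∀ x ∈ hull (K.erase b), f x = g x := by
  intro x hx
  have := hull_subset_closure_openFace (hS.tet K hK) (Finset.erase_subset b K)
    ((hS.tet K hK).erase_nonempty b) hx
  exact (isClosed_eq hf hg).closure_subset_iff.2 h this

/-- The face terms of the Green formula must sum to zero for every test function; localization shows
that the jump times the normal vanishes. -/
theorem faceAgree_of_hasWeakGrad {u : E3 → ℝ} {g : E3 → E3} {f : Finset E3 → E3 → ℝ}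
    (hf : SmoothPieces S f) (hu : EqOnCells S u f) (hg : HasWeakGrad (dom S) u g) :
    FaceAgree S f := by
  intro K hK L hL hne b hb c hc he
  refine hS.eq_on_hull_of_openFace hK b (hf K hK).continuous (hf L hL).continuous fun x hx => ?_
  have hN := hS.faceNormal_add hK hL hne hb hc he
  have key : (f K x - f L x) • faceNormal K b = 0 := by
    ext i
    have h1 := hS.localize_inner (h := fun K b y => faceNormal K b i * f K y)
      (fun K hK b _ => ((hf K hK).continuous.const_mul _).continuousOn) hK hL hne hb hc he hx
      fun φ hφ => by
        rw [← hS.grad_green i hφ.1.continuous.continuousOn (hS.hasWeakGrad_test hφ) hf hu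
          (hS.eqOnCells_grad hf hu hg), integral_add (hφ.memL2.integrable_mul (hg.2.1.apply i))
          ((hφ.memL2_grad.apply i).integrable_mul hg.1)]
        simp only [grad_apply]
        rw [integral_congr_ae (Eventually.of_forall fun x => mul_comm (pderiv i φ x) (u x)),
          integral_congr_ae (Eventually.of_forall fun x => mul_comm (φ x) (g x i)), hg.2.2 φ hφ i]
        ring
    have h2 : faceNormal K b i + faceNormal L c i = 0 := congrArg (fun v : E3 => v i) hN
    simp only [PiLp.smul_apply, smul_eq_mul, PiLp.zero_apply] at h1 ⊢
    linear_combination h1 - f L x * h2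
  exact sub_eq_zero.1 ((smul_eq_zero.1 key).resolve_right ((hS.tet K hK).faceNormal_ne_zero hb))

theorem cross_faceNormal_inner {w : Finset E3 → E3 → E3} (ha : TangAgree S w) {K L : Finset E3}
    (hK : K ∈ S) (hL : L ∈ S) (hne : K ≠ L) {b c : E3} (hb : b ∈ K) (hc : c ∈ L)
    (he : L.erase c = K.erase b) {x : E3} (hx : x ∈ hull (K.erase b)) :
    cross (faceNormal K b) (w K x) + cross (faceNormal L c) (w L x) = 0 := by
  have h1 := ((hS.tet K hK).cross_faceNormal_eq_zero_iff hb).2 (ha K hK L hL hne b hb c hc he x hx)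
  rw [eq_neg_of_add_eq_zero_right (hS.faceNormal_add hK hL hne hb hc he), cross_neg_left,
    ← sub_eq_add_neg, ← cross_sub_right, h1]

/-- The counterpart of `hasWeakGrad_of_faceAgree`: only the vector product of the jump with the
normal appears on inner faces. -/
theorem hasWeakCurl_of_tangAgree {v c : E3 → E3} {w : Finset E3 → E3 → E3}
    (hw : SmoothFields S w) (hv : EqOnCells S v w) (hc : EqOnCells S c fun K => curl (w K))
    (ha : TangAgree S w) : HasWeakCurl (dom S) v c := by
  have hvL := hS.memL2_dom (fun K hK => (hw K hK).continuous) hv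
  have hcL := hS.memL2_dom (fun K hK => (hw K hK).continuous_curl) hc
  refine hasWeakCurl_of_integral_cross hvL hcL fun φ hφ k => ?_
  have h1 := hS.curl_green k hφ.1.continuous.continuousOn (hS.hasWeakGrad_test hφ) hw hv hc
  rw [hS.sum_faces_eq_zero, integral_sub (hφ.memL2.integrable_mul (hcL.apply k))
    (hvL.cross_grad hφ.memL2_grad k)] at h1
  · rw [integral_congr_ae (Eventually.of_forall fun x => mul_comm (c x k) (φ x))]
    linarith
  · intro K hK b hb ho
    exact faceInt_eq_zero fun x hx => by rw [hS.test_eq_zero hφ hK hb ho hx, zero_mul]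
  · intro K hK L hL hne b hb c hc he
    rw [hS.faceInt_inner he, ← (hS.tet K hK).faceInt_add hb]
    · refine faceInt_eq_zero fun x hx => ?_
      have := congrArg (fun v : E3 => v k) (hS.cross_faceNormal_inner ha hK hL hne hb hc he hx)
      simp only [PiLp.add_apply, PiLp.zero_apply] at this
      rw [← mul_add, this, mul_zero]
    · exact (hφ.1.continuous.mul ((hw K hK).continuous_cross _ k)).continuousOn
    · exact (hφ.1.continuous.mul ((hw L hL).continuous_cross _ k)).continuousOn

omit hS in
theorem _root_.MaxwellPatch.SmoothField.hasWeakCurl (K : Finset E3) {w : E3 → E3}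
    (hw : SmoothField w) : HasWeakCurl (interior (hull K)) w (curl w) := by
  have := hasWeakCurl_curlOf fun k => hasWeakGrad_interior_hull K (hw k)
  refine ⟨this.1, MemLp.ae_eq (Eventually.of_forall fun x => ?_) this.2.1, fun Φ hΦ => ?_⟩
  · rfl
  · exact this.2.2 Φ hΦ

omit hS in
theorem _root_.MaxwellPatch.HasWeakCurl.mono {Ω Ω' : Set E3} (hΩ' : MeasurableSet Ω')
    (hs : Ω ⊆ Ω') {v c : E3 → E3} (h : HasWeakCurl Ω' v c) : HasWeakCurl Ω v c := by
  refine hasWeakCurl_of_integral_cross (MemLp.mono_measure (Measure.restrict_mono hs le_rfl) h.1)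
    (MemLp.mono_measure (Measure.restrict_mono hs le_rfl) h.2.1) fun φ hφ k => ?_
  have := h.integral_cross (hφ.mono hs) k
  rwa [hφ.setIntegral_eq hΩ' hs fun x hx => by
      have hz : grad φ x = 0 := by
        ext i; rw [grad_apply, pderiv_eq_zero_of_notMem hx]; rfl
      rw [hz]; fin_cases k <;> simp,
    hφ.setIntegral_eq hΩ' hs fun x hx => by
      rw [image_eq_zero_of_notMem_tsupport hx, mul_zero]] at this

theorem eqOnCells_curl {v c : E3 → E3} {w : Finset E3 → E3 → E3}
    (hw : SmoothFields S w) (hv : EqOnCells S v w) (hc : HasWeakCurl (dom S) v c) :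
    EqOnCells S c fun K => curl (w K) := by
  intro K hK
  have h1 := hc.mono (isOpen_dom S).measurableSet (interior_hull_subset_dom hK)
  have h2 : v =ᵐ[volume.restrict (interior (hull K))] w K := by
    rw [Measure.restrict_congr_set (interior_hull_ae_eq K)]; exact hv K hK
  have h4 : HasWeakCurl (interior (hull K)) (w K) c := by
    refine ⟨MemLp.ae_eq h2 h1.1, h1.2.1, fun Φ hΦ => ?_⟩
    rw [← h1.2.2 Φ hΦ]
    exact integral_congr_ae (h2.mono fun x hx => by simp only [hx])
  have h3 := h4.unique isOpen_interior ((hw K hK).hasWeakCurl K)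
  rwa [Measure.restrict_congr_set (interior_hull_ae_eq K)] at h3

/-- The face terms of the curl Green formula are localized to the vector product of the normal with
the jump. -/
theorem tangAgree_of_hasWeakCurl {v c : E3 → E3} {w : Finset E3 → E3 → E3}
    (hw : SmoothFields S w) (hv : EqOnCells S v w) (hc : HasWeakCurl (dom S) v c) :
    TangAgree S w := by
  intro K hK L hL hne b hb c' hc' he
  have hcont : Continuous fun x => cross (glam K b) (w K x - w L x) :=
    (PiLp.continuous_toLp 2 _).comp (continuous_pi fun k => by
      have h1 := (hw K hK).continuous_cross (glam K b) k
      have h2 := (hw L hL).continuous_cross (glam K b) k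
      exact (h1.sub h2).congr fun x =>
        (congrArg (fun v : E3 => v k) (cross_sub_right (glam K b) (w K x) (w L x))).symm)
  refine hS.eq_on_hull_of_openFace hK b hcont continuous_const fun x hx => ?_
  have hN := hS.faceNormal_add hK hL hne hb hc' he
  rw [← (hS.tet K hK).cross_faceNormal_eq_zero_iff hb]
  ext k
  have h1 := hS.localize_inner (h := fun K b y => cross (faceNormal K b) (w K y) k)
      (fun K hK b _ => ((hw K hK).continuous_cross _ k).continuousOn) hK hL hne hb hc' he hx
      fun φ hφ => by
        rw [← hS.curl_green k hφ.1.continuous.continuousOn (hS.hasWeakGrad_test hφ) hw hv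
          (hS.eqOnCells_curl hw hv hc), integral_sub (hφ.memL2.integrable_mul (hc.2.1.apply k))
          (hc.1.cross_grad hφ.memL2_grad k), hc.integral_cross hφ k,
          integral_congr_ae (Eventually.of_forall fun x => mul_comm (φ x) (c x k)), sub_self]
  simp only at h1
  rw [eq_neg_of_add_eq_zero_right hN, cross_neg_left] at h1
  rw [cross_sub_right]
  simpa [sub_eq_add_neg] using h1

end Conforming

/-! ### Limits of `L²` products -/

section Limits

variable {F : Type*} [NormedAddCommGroup F] [InnerProductSpace ℝ F] {μ : Measure E3}

theorem _root_.MeasureTheory.MemLp.integrable_inner_two {u h : E3 → F} (hu : MemLp u 2 μ)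
    (hh : MemLp h 2 μ) : Integrable (fun x => (inner ℝ (u x) (h x) : ℝ)) μ := by
  refine memLp_one_iff_integrable.1 (MemLp.of_bilin (p := 2) (q := 2)
    (fun a b : F => (inner ℝ a b : ℝ)) 1 hu hh
    (hu.aestronglyMeasurable.inner hh.aestronglyMeasurable) (Eventually.of_forall fun x => ?_))
  have := norm_inner_le_norm (𝕜 := ℝ) (u x) (h x)
  rw [one_mul]
  exact_mod_cast this

theorem tendsto_integral_inner {u : ℕ → E3 → F} {γ h : E3 → F} (hu : ∀ n, MemLp (u n) 2 μ)
    (hγ : MemLp γ 2 μ) (hh : MemLp h 2 μ)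
    (hlim : Tendsto (fun n => eLpNorm (u n - γ) 2 μ) atTop (𝓝 0)) :
    Tendsto (fun n => ∫ x, (inner ℝ (u n x) (h x) : ℝ) ∂μ) atTop
      (𝓝 (∫ x, (inner ℝ (γ x) (h x) : ℝ) ∂μ)) := by
  refine tendsto_integral_of_L1' _ (hγ.integrable_inner_two hh).aestronglyMeasurable
    (Eventually.of_forall fun n => (hu n).integrable_inner_two hh) ?_
  have h0 : Tendsto (fun n => eLpNorm (u n - γ) 2 μ * eLpNorm h 2 μ) atTop (𝓝 0) := by
    simpa using ENNReal.Tendsto.mul_const hlim (Or.inr hh.eLpNorm_ne_top)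
  refine tendsto_of_tendsto_of_tendsto_of_le_of_le tendsto_const_nhds h0 (fun _ => zero_le)
    fun n => ?_
  have := eLpNorm_le_eLpNorm_mul_eLpNorm'_of_norm (r := 1) (p := 2) (q := 2)
    ((hu n).sub hγ).aestronglyMeasurable hh.aestronglyMeasurable
    (fun a b : F => (inner ℝ a b : ℝ)) 1 (Eventually.of_forall fun x => by
      rw [NNReal.coe_one, one_mul]; exact norm_inner_le_norm _ _)
  rw [ENNReal.coe_one, one_mul] at this
  refine (eLpNorm_congr_ae (Eventually.of_forall fun x => ?_)).trans_le this
  simp [inner_sub_left]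

theorem tendsto_integral_mul {u : ℕ → E3 → ℝ} {γ h : E3 → ℝ} (hu : ∀ n, MemLp (u n) 2 μ)
    (hγ : MemLp γ 2 μ) (hh : MemLp h 2 μ)
    (hlim : Tendsto (fun n => eLpNorm (u n - γ) 2 μ) atTop (𝓝 0)) :
    Tendsto (fun n => ∫ x, u n x * h x ∂μ) atTop (𝓝 (∫ x, γ x * h x ∂μ)) := by
  have := tendsto_integral_inner hu hγ hh hlim
  simpa [mul_comm] using this

end Limits

/-! ### The boundary of the domain -/

/-- A segment has finite one-dimensional measure. -/
theorem hausdorffMeasure_hull_edge {E : Finset E3} (hE : E.card = 2) :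
    (Measure.hausdorffMeasure 2 : Measure E3) (hull E) = 0 := by
  obtain ⟨u, v, -, rfl⟩ := Finset.card_eq_two.1 hE
  refine (Measure.hausdorffMeasure_zero_or_top (d₁ := 1) (by norm_num) _).resolve_right ?_
  have : hull {u, v} = segment ℝ u v := by
    unfold hull; rw [Finset.coe_pair, convexHull_pair]
  rw [this, hausdorffMeasure_segment]
  exact edist_ne_top u v

theorem measurableSet_openFace (K E : Finset E3) : MeasurableSet (openFace K E) := by
  have h1 : openFace K E =
      (⋂ v ∈ E, {x | 0 < lam K v x}) ∩ ⋂ v ∈ K \ E, {x | lam K v x = 0} := by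
    ext x; simp [openFace]
  rw [h1]
  refine (Finset.measurableSet_biInter _ fun v _ => ?_).inter
    (Finset.measurableSet_biInter _ fun v _ => ?_)
  · exact (isOpen_lt continuous_const (continuous_lam K v)).measurableSet
  · exact (isClosed_eq (continuous_lam K v) continuous_const).measurableSet

theorem IsTet.hausdorffMeasure_hull_sdiff_openFace {K : Finset E3} (hK : IsTet K) {b : E3}
    (hb : b ∈ K) : (Measure.hausdorffMeasure 2 : Measure E3)
      (hull (K.erase b) \ openFace K (K.erase b)) = 0 := by
  refine measure_mono_null (t := ⋃ v ∈ K.erase b, hull ((K.erase b).erase v)) (fun x hx => ?_)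
    ((measure_biUnion_null_iff (K.erase b).countable_toSet).2 fun v hv =>
      hausdorffMeasure_hull_edge ?_)
  · have h1 := (hK.mem_hull_subset_iff (Finset.erase_subset b K)).1 hx.1
    by_contra hcon
    refine hx.2 ⟨fun v hv => lt_of_le_of_ne (h1.1 v (Finset.mem_of_mem_erase hv)) fun h0 => ?_,
      h1.2⟩
    refine hcon (Set.mem_iUnion₂.2 ⟨v, hv, (hK.mem_hull_subset_iff
      ((Finset.erase_subset _ _).trans (Finset.erase_subset b K))).2 ⟨h1.1, fun w hw hwv => ?_⟩⟩)
    by_cases hwe : w = v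
    · rw [hwe, ← h0]
    · exact h1.2 w hw fun hwb => hwv (Finset.mem_erase.2 ⟨hwe, hwb⟩)
  · rw [Finset.card_erase_of_mem hv, Finset.card_erase_of_mem hb, hK.card]

namespace Conforming

variable {S : Finset (Finset E3)} (hS : Conforming S)
include hS

/-- The exceptional points lie on edges, which are null for the surface measure; a point in the
relative interior of an inner face is not on the frontier. -/
theorem ae_surf : ∀ᵐ x ∂(surf (dom S)), ∃ K ∈ S, ∃ b ∈ K, IsOuter S K b ∧
    x ∈ openFace K (K.erase b) := by
  unfold surf
  rw [ae_restrict_iff' isClosed_frontier.measurableSet]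
  refine measure_mono_null (t := ⋃ K ∈ S, ⋃ b ∈ K, hull (K.erase b) \ openFace K (K.erase b))
    (fun x hx => ?_) ((measure_biUnion_null_iff S.countable_toSet).2 fun K hK =>
      (measure_biUnion_null_iff K.countable_toSet).2 fun b hb =>
        (hS.tet K hK).hausdorffMeasure_hull_sdiff_openFace hb)
  simp only [Set.mem_compl_iff, Set.mem_setOf_eq, Classical.not_imp] at hx
  obtain ⟨hxf, hx⟩ := hx
  obtain ⟨K, hK, b, hb, hxK⟩ := hS.exists_mem_hull_erase hxf
  refine Set.mem_iUnion₂.2 ⟨K, hK, Set.mem_iUnion₂.2 ⟨b, hb, hxK, fun hxo => hx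
    ⟨K, hK, b, hb, fun L hL hsub => ?_, hxo⟩⟩⟩
  by_contra hne
  have := hS.mem_dom_of_mem_openFace hK hL (Ne.symm hne) hb hsub hxo
  rw [(isOpen_dom S).frontier_eq] at hxf
  exact hxf.2 this

theorem surf_univ_lt_top : surf (dom S) Set.univ < ⊤ := by
  unfold surf
  rw [Measure.restrict_apply_univ]
  refine (measure_mono (t := ⋃ K ∈ S, ⋃ b ∈ K, hull (K.erase b)) fun x hx => ?_).trans_lt
    (measure_biUnion_lt_top S.finite_toSet fun K hK => measure_biUnion_lt_top K.finite_toSet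
      fun b hb => ?_)
  · obtain ⟨K, hK, b, hb, hxK⟩ := hS.exists_mem_hull_erase hx
    exact Set.mem_iUnion₂.2 ⟨K, hK, Set.mem_iUnion₂.2 ⟨b, hb, hxK⟩⟩
  · obtain ⟨w₀, w₁, w₂, hfr⟩ := (hS.tet K hK).exists_isFrame hb
    exact hfr.hausdorffMeasure_face_lt_top

theorem restrict_hull_le_surf {K : Finset E3} (hK : K ∈ S) {b : E3} (hb : b ∈ K)
    (ho : IsOuter S K b) :
    (Measure.hausdorffMeasure 2 : Measure E3).restrict (hull (K.erase b)) ≤ surf (dom S) :=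
  Measure.restrict_mono (hS.hull_erase_subset_frontier hK hb ho) le_rfl

theorem openFace_subset_frontier {K : Finset E3} (hK : K ∈ S) {b : E3} (hb : b ∈ K)
    (ho : IsOuter S K b) : openFace K (K.erase b) ⊆ frontier (dom S) :=
  (openFace_subset (hS.tet K hK) (Finset.erase_subset b K)).trans
    (hS.hull_erase_subset_frontier hK hb ho)

theorem ae_face_of_ae_surf {K : Finset E3} (hK : K ∈ S) {b : E3} (hb : b ∈ K)
    (ho : IsOuter S K b) {Γ : Set E3} (hΓ : openFace K (K.erase b) ⊆ Γ) {p : E3 → Prop}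
    (h : ∀ᵐ x ∂((surf (dom S)).restrict Γ), p x) :
    ∀ᵐ x ∂((Measure.hausdorffMeasure 2 : Measure E3).restrict (hull (K.erase b))),
      x ∈ openFace K (K.erase b) ∧ p x := by
  have h1 : openFace K (K.erase b) =ᵐ[(Measure.hausdorffMeasure 2 : Measure E3)]
      hull (K.erase b) :=
    (openFace_subset (hS.tet K hK) (Finset.erase_subset b K)).eventuallyLE.antisymm
      (ae_le_set.2 ((hS.tet K hK).hausdorffMeasure_hull_sdiff_openFace hb))
  rw [← Measure.restrict_congr_set h1]
  have h2 := ae_restrict_of_ae_restrict_of_subset hΓ h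
  rw [surf, Measure.restrict_restrict (measurableSet_openFace _ _),
    Set.inter_eq_left.2 (hS.openFace_subset_frontier hK hb ho)] at h2
  exact (ae_restrict_mem (measurableSet_openFace _ _)).and h2

end Conforming

/-! ### Green formulas for functions with traces -/

/-- The sum of the integrals over the outer faces. -/
def outerSum (S : Finset (Finset E3)) (h : Finset E3 → E3 → E3 → ℝ) : ℝ :=
  ∑ K ∈ S, ∑ b ∈ K, if IsOuter S K b then faceInt K b (h K b) else 0

theorem outerSum_eq_zero {S : Finset (Finset E3)} {h : Finset E3 → E3 → E3 → ℝ}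
    (hh : ∀ K ∈ S, ∀ b ∈ K, IsOuter S K b → faceInt K b (h K b) = 0) : outerSum S h = 0 :=
  Finset.sum_eq_zero fun K hK => Finset.sum_eq_zero fun b hb => by
    split_ifs with ho
    · exact hh K hK b hb ho
    · rfl

namespace Conforming

variable {S : Finset (Finset E3)} (hS : Conforming S)
include hS

theorem sum_faces_eq_outerSum {u : E3 → ℝ} (hu : ContinuousOn u (closure (dom S)))
    {h : Finset E3 → E3 → E3 → ℝ} (hh : ∀ K ∈ S, ∀ b ∈ K, ContinuousOn (h K b) (hull (K.erase b)))
    (hin : ∀ K ∈ S, ∀ L ∈ S, K ≠ L → ∀ b ∈ K, ∀ c ∈ L, L.erase c = K.erase b →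
      ∀ x ∈ hull (K.erase b), h K b x + h L c x = 0) :
    ∑ K ∈ S, ∑ b ∈ K, faceInt K b (fun x => u x * h K b x) =
      outerSum S fun K b x => u x * h K b x := by
  rw [← sub_eq_zero, outerSum, ← Finset.sum_sub_distrib]
  simp only [← Finset.sum_sub_distrib]
  refine hS.sum_faces_eq_zero (fun K hK b hb ho => by rw [if_pos ho, sub_self]) ?_
  intro K hK L hL hne b hb c hc he
  have h1 : ¬IsOuter S K b := fun ho => hne (ho L hL (he ▸ Finset.erase_subset c L)).symm
  have h2 : ¬IsOuter S L c := fun ho => hne (ho K hK (he ▸ Finset.erase_subset b K))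
  have hc1 : ContinuousOn u (hull (K.erase b)) :=
    (hS.continuousOn_hull hu hK).mono (hull_mono (Finset.erase_subset b K))
  rw [if_neg h1, if_neg h2, sub_zero, sub_zero, hS.faceInt_inner he,
    ← (hS.tet K hK).faceInt_add hb]
  rotate_left
  · exact hc1.mul (hh K hK b hb)
  · exact hc1.mul (he ▸ hh L hL c hc)
  exact faceInt_eq_zero fun x hx => by
    rw [← mul_add, hin K hK L hL hne b hb c hc he x hx, mul_zero]

theorem memLp_face {K : Finset E3} (hK : K ∈ S) {b : E3} (hb : b ∈ K) {f : E3 → ℝ}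
    (hf : ContinuousOn f (hull (K.erase b))) :
    MemLp f 2 ((Measure.hausdorffMeasure 2 : Measure E3).restrict (hull (K.erase b))) := by
  rw [memLp_two_iff_integrable_sq (hf.aestronglyMeasurable (measurableSet_hull _))]
  exact (hS.tet K hK).integrable_face hb (hf.pow 2)

theorem memLp_surf {u : E3 → ℝ} (hu : ContinuousOn u (closure (dom S))) :
    MemLp u 2 (surf (dom S)) := by
  have hc : IsCompact (frontier (dom S)) :=
    (isCompact_biUnion_hull S).of_isClosed_subset isClosed_frontier
      (frontier_subset_closure.trans (closure_dom_subset S))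
  have hcu := hu.mono frontier_subset_closure
  obtain ⟨C, hC⟩ := hc.exists_bound_of_continuousOn hcu
  have hfin : IsFiniteMeasure (surf (dom S)) := ⟨hS.surf_univ_lt_top⟩
  exact MemLp.of_bound (hcu.aestronglyMeasurable isClosed_frontier.measurableSet) C
    ((ae_restrict_iff' isClosed_frontier.measurableSet).2 (Eventually.of_forall hC))

/-- The formula holds for the continuous functions that define the trace, and both sides pass to the
limit in `L²`. The inner faces have to cancel before the limit, since the approximants are
controlled only on the boundary. -/
theorem trace_green {u γ a : E3 → ℝ} {e : E3 → E3} {h : Finset E3 → E3 → E3 → ℝ}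
    (ht : HasTrace (dom S) u γ) (ha : MemL2 (dom S) a) (he : MemL2 (dom S) e)
    (hh : ∀ K ∈ S, ∀ b ∈ K, ContinuousOn (h K b) (hull (K.erase b)))
    (hin : ∀ K ∈ S, ∀ L ∈ S, K ≠ L → ∀ b ∈ K, ∀ c ∈ L, L.erase c = K.erase b →
      ∀ x ∈ hull (K.erase b), h K b x + h L c x = 0)
    (hgreen : ∀ u g, ContinuousOn u (closure (dom S)) → HasWeakGrad (dom S) u g →
      ∫ x in dom S, (u x * a x + inner ℝ (g x) (e x)) =
        ∑ K ∈ S, ∑ b ∈ K, faceInt K b fun x => u x * h K b x) :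
    ∫ x in dom S, (u x * a x + inner ℝ (weakGrad (dom S) u x) (e x)) =
      outerSum S fun K b x => γ x * h K b x := by
  obtain ⟨hu, hγ, U, hU, l1, l2, l3⟩ := ht
  have hg := hu.hasWeakGrad
  have hgU := fun n => (hU n).1.hasWeakGrad
  have hi1 : ∀ u, MemL2 (dom S) u → ∀ g : E3 → E3, MemL2 (dom S) g →
      ∫ x in dom S, (u x * a x + inner ℝ (g x) (e x)) =
        (∫ x in dom S, u x * a x) + ∫ x in dom S, inner ℝ (g x) (e x) := fun u hu g hg =>
    integral_add (hu.integrable_mul ha) (MemLp.integrable_inner_two hg he)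
  have L : Tendsto (fun n => ∫ x in dom S,
      (U n x * a x + inner ℝ (weakGrad (dom S) (U n) x) (e x))) atTop
      (𝓝 (∫ x in dom S, (u x * a x + inner ℝ (weakGrad (dom S) u x) (e x)))) := by
    rw [hi1 u hg.1 _ hg.2.1]
    simp only [fun n => hi1 (U n) (hgU n).1 _ (hgU n).2.1]
    exact (tendsto_integral_mul (fun n => (hgU n).1) hg.1 ha l1).add
      (tendsto_integral_inner (fun n => (hgU n).2.1) hg.2.1 he l2)
  have R : Tendsto (fun n => outerSum S fun K b x => U n x * h K b x) atTop
      (𝓝 (outerSum S fun K b x => γ x * h K b x)) := by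
    refine tendsto_finsetSum S fun K hK => tendsto_finsetSum K fun b hb => ?_
    split_ifs with ho
    · have hle := hS.restrict_hull_le_surf hK hb ho
      refine tendsto_integral_mul (fun n => (hS.memLp_surf (hU n).2).mono_measure hle)
        (hγ.mono_measure hle) (hS.memLp_face hK hb (hh K hK b hb)) ?_
      exact tendsto_of_tendsto_of_tendsto_of_le_of_le tendsto_const_nhds l3
        (fun _ => zero_le) fun n => eLpNorm_mono_measure _ hle
    · exact tendsto_const_nhds
  refine tendsto_nhds_unique L (R.congr fun n => ?_)
  rw [hgreen _ _ (hU n).2 (hgU n), hS.sum_faces_eq_outerSum (hU n).2 hh hin]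

theorem trace_grad_green (i : Fin 3) {u γ : E3 → ℝ} (ht : HasTrace (dom S) u γ) {φ : E3 → ℝ}
    (hφ : ContDiff ℝ ∞ φ) :
    ∫ x in dom S, (u x * pderiv i φ x + weakGrad (dom S) u x i * φ x) =
      outerSum S fun K b x => γ x * (faceNormal K b i * φ x) := by
  have hd : EqOnCells S (grad φ) fun _ => grad φ := fun K _ => Eventually.of_forall fun x => rfl
  have hq : EqOnCells S φ fun _ => φ := fun K _ => Eventually.of_forall fun x => rfl
  have hdL := hS.memL2_dom (fun _ _ => continuous_grad hφ) hd
  have hin : ∀ (g : E3 → E3) (x : E3),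
      inner ℝ (g x) (φ x • (EuclideanSpace.single i 1 : E3)) = g x i * φ x := fun g x => by
    rw [inner_smul_right, EuclideanSpace.inner_single_right]; simp [mul_comm]
  have := hS.trace_green (a := fun x => grad φ x i) (e := fun x => φ x • EuclideanSpace.single i 1)
    (h := fun K b x => faceNormal K b i * φ x) ht (hdL.apply i)
    (hS.memL2_dom (f := fun _ x => φ x • EuclideanSpace.single i 1)
      (fun _ _ => hφ.continuous.smul continuous_const)
      fun K _ => Eventually.of_forall fun x => rfl)
    (fun K _ b _ => (hφ.continuous.const_mul _).continuousOn)
    (fun K hK L hL hne b hb c hc he x hx => by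
      have hN : faceNormal K b i + faceNormal L c i = 0 :=
        congrArg (fun v : E3 => v i) (hS.faceNormal_add hK hL hne hb hc he)
      rw [← add_mul, hN, zero_mul])
    (fun u g hu hg => by
      simp only [hin]
      exact hS.grad_green i hu hg (f := fun _ => φ) (fun _ _ => hφ) hq hd)
  simpa only [hin, grad_apply] using this

theorem trace_curl_green (k : Fin 3) {u γ : E3 → ℝ} (ht : HasTrace (dom S) u γ) {v c : E3 → E3}
    {w : Finset E3 → E3 → E3} (hw : SmoothFields S w) (hv : EqOnCells S v w)
    (hc : EqOnCells S c fun K => curl (w K)) (ha : TangAgree S w) :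
    ∫ x in dom S, (u x * c x k - cross (v x) (weakGrad (dom S) u x) k) =
      outerSum S fun K b x => γ x * cross (faceNormal K b) (w K x) k := by
  have hvL := hS.memL2_dom (fun K hK => (hw K hK).continuous) hv
  have hcL := hS.memL2_dom (fun K hK => (hw K hK).continuous_curl) hc
  -- Pairing the gradient with `v × e_k` gives the component needed here as a scalar product.
  have hin : ∀ g v : E3, inner ℝ g (cross v (EuclideanSpace.single k 1)) = -cross v g k := by
    intro g v
    rw [inner_cross_single]
    fin_cases k <;> simp <;> ring
  have heL : MemL2 (dom S) fun x => cross (v x) (EuclideanSpace.single k 1) := by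
    refine hS.memL2_dom (f := fun K x => cross (w K x) (EuclideanSpace.single k 1)) ?_ ?_
    · refine fun K hK => (PiLp.continuous_toLp 2 _).comp (continuous_pi fun j => ?_)
      have := (hw K hK).continuous_cross (EuclideanSpace.single k 1) j
      exact this.neg.congr fun x => by
        change -(cross (EuclideanSpace.single k 1) (w K x) j) =
          cross (w K x) (EuclideanSpace.single k 1) j
        fin_cases j <;> simp
    · exact fun K hK => (hv K hK).mono fun x hx => by simp only [hx]
  have := hS.trace_green (a := fun x => c x k) (h := fun K b x => cross (faceNormal K b) (w K x) k)
    ht (hcL.apply k) heL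
    (fun K hK b _ => ((hw K hK).continuous_cross _ k).continuousOn)
    (fun K hK L hL hne b hb c hc he x hx =>
      congrArg (fun v : E3 => v k) (hS.cross_faceNormal_inner ha hK hL hne hb hc he hx))
    (fun u g hu hg => by
      simp only [hin, ← sub_eq_add_neg]
      exact hS.curl_green k hu hg hw hv hc)
  simpa only [hin, ← sub_eq_add_neg] using this

end Conforming

/-! ### Boundary conditions of piecewise smooth functions -/

namespace Conforming

variable {S : Finset (Finset E3)} (hS : Conforming S)
include hS

theorem exists_continuousOn {f : Finset E3 → E3 → ℝ} (hf : ∀ K ∈ S, Continuous (f K))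
    (hagree : ∀ K ∈ S, ∀ L ∈ S, ∀ x ∈ hull K, x ∈ hull L → f K x = f L x) :
    ∃ u : E3 → ℝ, ContinuousOn u (closure (dom S)) ∧ ∀ K ∈ S, ∀ x ∈ hull K, u x = f K x := by
  set u : E3 → ℝ := fun x => if h : ∃ K ∈ S, x ∈ hull K then f h.choose x else 0 with hu
  have huf : ∀ K ∈ S, ∀ x ∈ hull K, u x = f K x := by
    intro K hK x hx
    have h : ∃ K ∈ S, x ∈ hull K := ⟨K, hK, hx⟩
    simp only [hu]
    rw [dif_pos h]
    exact hagree _ h.choose_spec.1 K hK x h.choose_spec.2 hx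
  refine ⟨u, ?_, huf⟩
  have h1 : closure (dom S) = ⋃ K : S, hull K := by
    rw [hS.closure_dom]; exact Set.biUnion_eq_iUnion (S : Set (Finset E3)) fun K _ => hull K
  rw [h1]
  refine (locallyFinite_of_finite _).continuousOn_iUnion (fun K => isClosed_hull K) fun K => ?_
  exact (hf K K.2).continuousOn.congr fun x hx => huf K K.2 x hx

theorem faceAgree_of_agree {f : Finset E3 → E3 → ℝ}
    (hagree : ∀ K ∈ S, ∀ L ∈ S, ∀ x ∈ hull K, x ∈ hull L → f K x = f L x) : FaceAgree S f :=
  fun K hK L hL _ b _ c _ he x hx => hagree K hK L hL x (hull_mono (Finset.erase_subset b K) hx)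
    (hull_mono (he ▸ Finset.erase_subset c L) hx)

/-- The continuous representative on the closure serves as a constant approximating sequence and as
the trace. For this the pieces must agree at all common points, not only across faces. -/
theorem memH1Zero_of_agree {q : E3 → ℝ} {f : Finset E3 → E3 → ℝ} (hf : SmoothPieces S f)
    (hq : EqOnCells S q f)
    (hagree : ∀ K ∈ S, ∀ L ∈ S, ∀ x ∈ hull K, x ∈ hull L → f K x = f L x) {Γ : Set E3}
    (hΓ : MeasurableSet Γ)
    (hzero : ∀ K ∈ S, ∀ b ∈ K, IsOuter S K b → ∀ x ∈ openFace K (K.erase b), x ∈ Γ → f K x = 0) :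
    MemH1Zero (dom S) Γ q := by
  obtain ⟨u, hu, huf⟩ := hS.exists_continuousOn (fun K hK => (hf K hK).continuous) hagree
  have hgl := hS.eqOnCells_glue fun K => grad (f K)
  have huq : EqOnCells S u f := fun K hK =>
    (ae_restrict_iff' (measurableSet_hull K)).2 (Eventually.of_forall fun x hx => huf K hK x hx)
  have hgu := hS.hasWeakGrad_of_faceAgree hf huq hgl (hS.faceAgree_of_agree hagree)
  have hgq := hS.hasWeakGrad_of_faceAgree hf hq hgl (hS.faceAgree_of_agree hagree)
  refine ⟨u, ⟨⟨_, hgq⟩, hS.memLp_surf hu, fun _ => u, fun _ => ⟨⟨_, hgu⟩, hu⟩, ?_, ?_, ?_⟩, ?_⟩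
  · have h0 : (u - q) =ᵐ[volume.restrict (dom S)] 0 := by
      filter_upwards [huq.ae_eq hq] with x hx
      simp [hx]
    simp [eLpNorm_congr_ae h0]
  · have h0 : (weakGrad (dom S) u - weakGrad (dom S) q) =ᵐ[volume.restrict (dom S)] 0 := by
      filter_upwards [hgu.weakGrad_ae_eq (isOpen_dom S), hgq.weakGrad_ae_eq (isOpen_dom S)]
        with x h1 h2
      simp [h1, h2]
    simp [eLpNorm_congr_ae h0]
  · simp
  · filter_upwards [ae_restrict_of_ae hS.ae_surf, ae_restrict_mem hΓ] with x hx hxΓ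
    obtain ⟨K, hK, b, hb, ho, hxo⟩ := hx
    rw [huf K hK x (hull_mono (Finset.erase_subset b K)
      (openFace_subset (hS.tet K hK) (Finset.erase_subset b K) hxo))]
    exact hzero K hK b hb ho x hxo hxΓ

/-- The same volume integral is given by the cellwise Green formula, with the pieces `f`, and by the
Green formula for traces. For test functions supported near `x` the latter is zero, and localization
gives the value of `f K` at `x`. -/
theorem eq_zero_of_memH1Zero {q : E3 → ℝ} {f : Finset E3 → E3 → ℝ} (hf : SmoothPieces S f)
    (hq : EqOnCells S q f) {Γ : Set E3} (hq0 : MemH1Zero (dom S) Γ q) {K : Finset E3} (hK : K ∈ S)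
    {b : E3} (hb : b ∈ K) (ho : IsOuter S K b) {x : E3} (hx : x ∈ openFace K (K.erase b))
    {U : Set E3} (hU : U ∈ 𝓝 x) (hΓ : U ∩ frontier (dom S) ⊆ Γ) : f K x = 0 := by
  obtain ⟨γ, ht, hγ⟩ := hq0
  have hg := ht.1.hasWeakGrad
  have key : ∀ i, faceNormal K b i * f K x = 0 := by
    intro i
    refine hS.localize_outer (h := fun K b y => faceNormal K b i * f K y)
      (fun K hK b _ => ((hf K hK).continuous.const_mul _).continuousOn) hK hb hx ho
      (interior_mem_nhds.2 hU) fun φ hφ => ?_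
    have hφ' := hasWeakGrad_of_hasCompactSupport (isOpen_dom S).measurableSet hφ.1 hφ.2.1
    rw [← hS.grad_green i hφ.1.continuous.continuousOn hφ' hf hq (hS.eqOnCells_grad hf hq hg)]
    have h1 := hS.trace_grad_green i ht hφ.1
    rw [outerSum_eq_zero fun L hL c hc hoL => ?_] at h1
    · rw [← h1]
      exact integral_congr_ae (Eventually.of_forall fun y => by simp only [grad_apply]; ring)
    · have h2 : ∀ᵐ y ∂(surf (dom S)), φ y * γ y = 0 := by
        have hmeas : MeasurableSet (interior U ∩ frontier (dom S)) :=
          isOpen_interior.measurableSet.inter isClosed_frontier.measurableSet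
        have h3 := ae_restrict_of_ae_restrict_of_subset
          ((Set.inter_subset_inter_left _ interior_subset).trans hΓ) hγ
        rw [ae_restrict_iff' hmeas] at h3
        filter_upwards [h3, ae_restrict_mem isClosed_frontier.measurableSet] with y hy hyf
        by_cases hyU : y ∈ interior U
        · rw [hy ⟨hyU, hyf⟩, mul_zero]
        · rw [image_eq_zero_of_notMem_tsupport fun h => hyU (hφ.2.2 h), zero_mul]
      refine integral_eq_zero_of_ae ?_
      filter_upwards [ae_mono (hS.restrict_hull_le_surf hL hc hoL) h2] with y hy
      rw [Pi.zero_apply]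
      linear_combination faceNormal L c i * hy
  by_contra hne
  refine (hS.tet K hK).faceNormal_ne_zero hb ?_
  ext i
  exact (mul_eq_zero.1 (key i)).resolve_right hne

theorem memHcurl_of_tangAgree {v : E3 → E3} {w : Finset E3 → E3 → E3} (hw : SmoothFields S w)
    (hv : EqOnCells S v w) (ha : TangAgree S w) :
    MemHcurl (dom S) v ∧ EqOnCells S (weakCurl (dom S) v) fun K => curl (w K) := by
  have h := hS.hasWeakCurl_of_tangAgree hw hv (hS.eqOnCells_glue fun K => curl (w K)) ha
  exact ⟨⟨_, h⟩, hS.eqOnCells_curl hw hv (MemHcurl.hasWeakCurl ⟨_, h⟩)⟩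

/-- The boundary term is the integral of the scalar product of the trace of the test field with `n ×
w`. On an outer face either `n × w` is zero, or the face avoids `Γ` and the trace is parallel to
`n`. -/
theorem memHcurlZero_of_tangAgree {v : E3 → E3} {w : Finset E3 → E3 → E3} (hw : SmoothFields S w)
    (hv : EqOnCells S v w) (ha : TangAgree S w) {Γ : Set E3}
    (hout : ∀ K ∈ S, ∀ b ∈ K, IsOuter S K b →
      (∀ x ∈ hull (K.erase b), cross (glam K b) (w K x) = 0) ∨
        Disjoint (openFace K (K.erase b)) Γ) : MemHcurlZero (dom S) Γ v := by
  obtain ⟨hvc, hc⟩ := hS.memHcurl_of_tangAgree hw hv ha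
  refine ⟨hvc, fun Φ hΦ => ?_⟩
  obtain ⟨g, hg, hgν⟩ := hΦ
  have hvc' := hvc.hasWeakCurl
  have hΦg := fun k => (hg k).1.hasWeakGrad
  have hΦc := hasWeakCurl_curlOf hΦg
  have hint : ∀ k, IntegrableOn (fun x => Φ x k * weakCurl (dom S) v x k -
      cross (v x) (weakGrad (dom S) (fun x => Φ x k) x) k) (dom S) := fun k =>
    ((hΦg k).1.integrable_mul (hvc'.2.1.apply k)).sub (hvc'.1.cross_grad (hΦg k).2.1 k)
  have h1 : ip (dom S) (weakCurl (dom S) v) Φ - ip (dom S) v (weakCurl (dom S) Φ) =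
      ∑ k : Fin 3, ∫ x in dom S, (Φ x k * weakCurl (dom S) v x k -
        cross (v x) (weakGrad (dom S) (fun x => Φ x k) x) k) := by
    rw [← integral_finsetSum _ fun k _ => hint k]
    unfold ip
    rw [← integral_sub (hvc'.2.1.integrable_inner_two hΦc.1)
      (hvc'.1.integrable_inner_two (MemHcurl.hasWeakCurl ⟨_, hΦc⟩).2.1)]
    refine integral_congr_ae ?_
    filter_upwards [hΦc.weakCurl_ae_eq (isOpen_dom S)] with x hx
    rw [hx, inner_curlOf, Finset.sum_sub_distrib, inner_three]
    simp only [Fin.sum_univ_three]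
    ring
  rw [h1, Finset.sum_congr rfl fun k _ => hS.trace_curl_green k (hg k) hw hv hc ha]
  unfold outerSum
  rw [Finset.sum_comm]
  refine Finset.sum_eq_zero fun K hK => ?_
  rw [Finset.sum_comm]
  refine Finset.sum_eq_zero fun b hb => ?_
  by_cases ho : IsOuter S K b
  · simp only [if_pos ho]
    have hle := hS.restrict_hull_le_surf hK hb ho
    unfold faceInt
    rw [← integral_finsetSum]
    · refine integral_eq_zero_of_ae ?_
      rcases hout K hK b hb ho with h0 | hdisj
      · filter_upwards [ae_restrict_mem (measurableSet_hull _)] with x hx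
        rw [((hS.tet K hK).cross_faceNormal_eq_zero_iff hb).2 (h0 x hx)]
        simp
      · have hsub : openFace K (K.erase b) ⊆ frontier (dom S) \ Γ := fun x hx =>
          ⟨hS.openFace_subset_frontier hK hb ho hx, Set.disjoint_left.1 hdisj hx⟩
        filter_upwards [hS.ae_face_of_ae_surf hK hb ho hsub hgν] with x hx
        -- The boundary condition of the test field is evaluated at the actual outward normal; it
        -- makes the trace a multiple of `glam K b`, which is orthogonal to its vector product with
        -- `w`.
        have h2 := hx.2 _ (hS.exists_isOutwardNormal hK hb ho hx.1)
        obtain ⟨κ, -, hN, -⟩ := (hS.tet K hK).exists_faceNormal hb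
        have hn : ‖glam K b‖ ≠ 0 := norm_ne_zero_iff.2 ((hS.tet K hK).glam_ne_zero hb)
        have h3 : cross (glam K b) (g x) = 0 := by
          have h4 : cross (g x) (-(‖glam K b‖⁻¹ • glam K b)) =
              ‖glam K b‖⁻¹ • cross (glam K b) (g x) := by
            apply ext_three <;> simp <;> ring
          rw [h4] at h2
          exact (smul_eq_zero.1 h2).resolve_left (inv_ne_zero hn)
        obtain ⟨t, ht⟩ := exists_smul_of_cross_eq_zero ((hS.tet K hK).glam_ne_zero hb) h3
        rw [Pi.zero_apply, hN, ht]
        simp [Fin.sum_univ_three]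
        ring
    · exact fun k _ => ((hg k).2.1.mono_measure hle).integrable_mul
        (hS.memLp_face hK hb ((hw K hK).continuous_cross _ k).continuousOn)
  · simp [ho]

/-- A bump function times a coordinate vector, supported near `x`, vanishes on the boundary outside
`Γ`. It is therefore an admissible test field, and localization applies. -/
theorem cross_eq_zero_of_memHcurlZero {v : E3 → E3} {w : Finset E3 → E3 → E3}
    (hw : SmoothFields S w) (hv : EqOnCells S v w) {Γ : Set E3} (hΓm : MeasurableSet Γ)
    (hv0 : MemHcurlZero (dom S) Γ v) {K : Finset E3} (hK : K ∈ S) {b : E3} (hb : b ∈ K)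
    (ho : IsOuter S K b) {x : E3} (hx : x ∈ openFace K (K.erase b)) {U : Set E3} (hU : U ∈ 𝓝 x)
    (hΓ : U ∩ frontier (dom S) ⊆ Γ) : cross (glam K b) (w K x) = 0 := by
  rw [← (hS.tet K hK).cross_faceNormal_eq_zero_iff hb]
  have hc := hv0.1.hasWeakCurl
  ext k
  refine hS.localize_outer (h := fun K b y => cross (faceNormal K b) (w K y) k)
    (fun K hK b _ => ((hw K hK).continuous_cross _ k).continuousOn) hK hb hx ho hU fun φ hφ => ?_
  have hφ' := hasWeakGrad_of_hasCompactSupport (isOpen_dom S).measurableSet hφ.1 hφ.2.1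
  rw [← hS.curl_green k hφ.1.continuous.continuousOn hφ' hw hv (hS.eqOnCells_curl hw hv hc)]
  set Φ : E3 → E3 := fun y => φ y • EuclideanSpace.single k 1 with hΦ
  have hΦs : ∀ i, ContDiff ℝ ∞ fun y => Φ y i := fun i =>
    hφ.1.mul contDiff_const
  have hΦg : ∀ i, HasWeakGrad (dom S) (fun y => Φ y i) (grad fun y => Φ y i) := fun i =>
    hasWeakGrad_of_hasCompactSupport (isOpen_dom S).measurableSet (hΦs i)
      (hφ.2.1.mul_right)
  have htan : MemH1TangZero (dom S) (frontier (dom S) \ Γ) Φ := by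
    refine ⟨Φ, fun i => ?_, ?_⟩
    · refine ⟨⟨_, hΦg i⟩, hS.memLp_surf (hΦs i).continuous.continuousOn, fun _ y => Φ y i,
        fun _ => ⟨⟨_, hΦg i⟩, (hΦs i).continuous.continuousOn⟩, ?_, ?_, ?_⟩ <;> simp
    · filter_upwards [ae_restrict_mem (isClosed_frontier.measurableSet.diff hΓm)] with y hy ν _
      have : φ y = 0 := image_eq_zero_of_notMem_tsupport fun h => hy.2 (hΓ ⟨hφ.2.2 h, hy.1⟩)
      simp only [hΦ]
      rw [this, zero_smul]
      apply ext_three <;> simp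
  have h1 := hv0.2 Φ htan
  have hcurl : weakCurl (dom S) Φ =ᵐ[volume.restrict (dom S)] curl Φ :=
    HasWeakCurl.weakCurl_ae_eq (isOpen_dom S) (by
      have := hasWeakCurl_curlOf hΦg
      exact this)
  have e1 : ip (dom S) (weakCurl (dom S) v) Φ = ∫ y in dom S, φ y * weakCurl (dom S) v y k :=
    integral_congr_ae (Eventually.of_forall fun y => by
      simp only [hΦ]
      rw [inner_smul_right, EuclideanSpace.inner_single_right]; simp)
  have e2 : ip (dom S) v (weakCurl (dom S) Φ) = ∫ y in dom S, cross (v y) (grad φ y) k :=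
    integral_congr_ae (hcurl.mono fun y hy => by
      simp only
      rw [hy, curl_smul_single, inner_cross_single])
  rw [integral_sub (hφ'.1.integrable_mul (hc.2.1.apply k)) (hc.1.cross_grad hφ'.2.1 k), ← e1, ← e2,
    h1]

end Conforming

/-! ### Polynomials of low degree -/

theorem exists_polyEval_eq_aff {P : MvPolynomial (Fin 3) ℝ} (hP : P.totalDegree ≤ 1) :
    ∃ c d, polyEval P = aff c d := by
  have key : ∀ s : Finset (Fin 3 →₀ ℕ), (∀ m ∈ s, m 0 + m 1 + m 2 ≤ 1) →
      ∃ (c : ℝ) (d : E3), ∀ x : E3, ∑ m ∈ s, P.coeff m * ∏ i, (x i) ^ (m i) = aff c d x := by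
    intro s
    induction s using Finset.induction_on with
    | empty => exact fun _ => ⟨0, 0, fun x => by simp [aff]⟩
    | insert m s hm ih =>
      intro h
      obtain ⟨c, d, hcd⟩ := ih fun m hm => h m (Finset.mem_insert_of_mem hm)
      have h1 := h m (Finset.mem_insert_self m s)
      have h2 : ∃ (c' : ℝ) (d' : E3), ∀ x : E3, P.coeff m * ∏ i, (x i) ^ (m i) = aff c' d' x := by
        have h3 : (m 0 = 0 ∧ m 1 = 0 ∧ m 2 = 0) ∨ (m 0 = 1 ∧ m 1 = 0 ∧ m 2 = 0) ∨
            (m 0 = 0 ∧ m 1 = 1 ∧ m 2 = 0) ∨ (m 0 = 0 ∧ m 1 = 0 ∧ m 2 = 1) := by omega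
        rcases h3 with h3 | h3 | h3 | h3
        · exact ⟨P.coeff m, 0, fun x => by simp [Fin.prod_univ_three, h3, aff]⟩
        -- The exponents of a monomial of degree one are themselves the coordinates of its gradient.
        all_goals refine ⟨0, P.coeff m • !₂[(m 0 : ℝ), m 1, m 2], fun x => ?_⟩
        all_goals simp [Fin.prod_univ_three, h3, aff, inner_smul_left, inner_three]
      obtain ⟨c', d', hcd'⟩ := h2
      refine ⟨c' + c, d' + d, fun x => ?_⟩
      rw [Finset.sum_insert hm, hcd, hcd']
      simp only [aff, inner_add_left]; ring
  obtain ⟨c, d, h⟩ := key P.support fun m hm => by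
    have := (MvPolynomial.le_totalDegree hm).trans hP
    rwa [Finsupp.sum_fintype _ _ fun _ => rfl, Fin.sum_univ_three] at this
  exact ⟨c, d, funext fun x => by rw [polyEval, MvPolynomial.eval_eq', h]⟩

theorem isPolyOn_aff {K : Finset E3} {v : E3 → ℝ} {c : ℝ} {d : E3}
    (h : ∀ᵐ x ∂(volume.restrict (hull K)), v x = aff c d x) : IsPolyOn 1 K v := by
  refine ⟨MvPolynomial.C c + ∑ i : Fin 3, MvPolynomial.C (d i) * MvPolynomial.X i, ?_,
    h.mono fun x hx => ?_⟩
  · refine (MvPolynomial.totalDegree_add _ _).trans (max_le (by simp) ?_)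
    refine MvPolynomial.totalDegree_finsetSum_le fun i _ => ?_
    refine (MvPolynomial.totalDegree_mul _ _).trans ?_
    simp
  · rw [hx]
    simp [polyEval, aff, inner_three, Fin.sum_univ_three]

/-- The lowest-order Nédélec field with coefficients `α` and `β`. -/
def ned (α β x : E3) : E3 := α + cross x β

theorem isNedelecOn_ned {K : Finset E3} {v : E3 → E3} {α β : E3}
    (h : ∀ᵐ x ∂(volume.restrict (hull K)), v x = ned α β x) : IsNedelecOn 0 K v := by
  refine ⟨fun i => MvPolynomial.C (α i), fun i => MvPolynomial.C (β i), fun i => by simp,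
    fun i => by simp, h.mono fun x hx => ?_⟩
  have : ∀ γ : E3, polyField (fun i => MvPolynomial.C (γ i)) x = γ := fun γ => by
    ext i; simp [polyField, polyEval]
  rw [hx, this, this, ned]

theorem IsNedelecOn.exists_ned {K : Finset E3} {v : E3 → E3} (h : IsNedelecOn 0 K v) :
    ∃ α β, ∀ᵐ x ∂(volume.restrict (hull K)), v x = ned α β x := by
  obtain ⟨P, Q, hP, hQ, h⟩ := h
  have key : ∀ P : Fin 3 → MvPolynomial (Fin 3) ℝ, (∀ i, (P i).totalDegree ≤ 0) →
      ∃ α : E3, ∀ x, polyField P x = α := fun P hP => by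
    refine ⟨WithLp.toLp 2 fun i => (P i).coeff 0, fun x => ?_⟩
    ext i
    have := MvPolynomial.totalDegree_eq_zero_iff_eq_C.1 (Nat.le_zero.1 (hP i))
    simp only [polyField, polyEval]
    rw [this]; simp
  obtain ⟨α, hα⟩ := key P hP
  obtain ⟨β, hβ⟩ := key Q hQ
  exact ⟨α, β, h.mono fun x hx => by rw [hx, hα, hβ, ned]⟩

theorem ned_apply (α β x : E3) :
    ned α β x 0 = aff (α 0) !₂[0, β 2, -β 1] x ∧ ned α β x 1 = aff (α 1) !₂[-β 2, 0, β 0] x ∧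
      ned α β x 2 = aff (α 2) !₂[β 1, -β 0, 0] x := by
  refine ⟨?_, ?_, ?_⟩ <;> simp [ned, aff, inner_three] <;> ring

theorem smoothField_ned (α β : E3) : SmoothField (ned α β) := by
  intro i
  have h := ned_apply α β
  fin_cases i
  · exact funext (fun x => (h x).1) ▸ contDiff_aff _ _
  · exact funext (fun x => (h x).2.1) ▸ contDiff_aff _ _
  · exact funext (fun x => (h x).2.2) ▸ contDiff_aff _ _

theorem curl_ned (α β x : E3) : curl (ned α β) x = (-2 : ℝ) • β := by
  have h := ned_apply α β
  unfold curl
  rw [funext fun y => (h y).1, funext fun y => (h y).2.1, funext fun y => (h y).2.2]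
  simp only [pderiv_aff]
  apply ext_three <;> simp <;> ring

/-- The field `ψ ∇q - q ∇ψ` for affine functions is a lowest-order Nédélec field. -/
theorem aff_smul_sub (l c : ℝ) (g d x : E3) :
    aff l g x • d - aff c d x • g = ned (l • d - c • g) (cross d g) x := by
  apply ext_three <;> simp [ned, aff, inner_three] <;> ring

/-- The sum of `a ⊗ ∇λ_a` over the vertices is the identity matrix. -/
theorem IsTet.sum_glam_apply_mul {K : Finset E3} (hK : IsTet K) (i j : Fin 3) :
    ∑ a ∈ K, a j * glam K a i = if i = j then 1 else 0 := by
  have := congrArg (fun v : E3 => v i) (hK.sum_inner_smul_glam (EuclideanSpace.single j 1))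
  simp only [EuclideanSpace.inner_single_left, WithLp.ofLp_sum, Finset.sum_apply, PiLp.smul_apply,
    smul_eq_mul, map_one, one_mul] at this
  rw [this]; simp [Pi.single_apply]

/-- The field is affine, hence equal to the sum of `λ_a` times its value at `a`; the left-hand side
is the curl of this sum. -/
theorem IsTet.sum_cross_glam_ned {K : Finset E3} (hK : IsTet K) (α β : E3) :
    ∑ a ∈ K, cross (glam K a) (ned α β a) = (-2 : ℝ) • β := by
  have hs : ∀ i, ∑ a ∈ K, glam K a i = 0 := fun i => by
    have := congrArg (fun v : E3 => v i) hK.sum_glam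
    simpa using this
  have h := hK.sum_glam_apply_mul
  apply ext_three <;> simp only [WithLp.ofLp_sum, Finset.sum_apply]
  · have : ∀ a ∈ K, cross (glam K a) (ned α β a) 0 = glam K a 1 * α 2 - glam K a 2 * α 1 +
        a 0 * glam K a 1 * β 1 - a 1 * glam K a 1 * β 0 - a 2 * glam K a 2 * β 0 +
        a 0 * glam K a 2 * β 2 := fun a _ => by simp [ned]; ring
    rw [Finset.sum_congr rfl this]
    simp only [Finset.sum_add_distrib, Finset.sum_sub_distrib, ← Finset.sum_mul, hs, h]
    simp; ring
  · have : ∀ a ∈ K, cross (glam K a) (ned α β a) 1 = glam K a 2 * α 0 - glam K a 0 * α 2 +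
        a 1 * glam K a 2 * β 2 - a 2 * glam K a 2 * β 1 - a 0 * glam K a 0 * β 1 +
        a 1 * glam K a 0 * β 0 := fun a _ => by simp [ned]; ring
    rw [Finset.sum_congr rfl this]
    simp only [Finset.sum_add_distrib, Finset.sum_sub_distrib, ← Finset.sum_mul, hs, h]
    simp; ring
  · have : ∀ a ∈ K, cross (glam K a) (ned α β a) 2 = glam K a 0 * α 1 - glam K a 1 * α 0 +
        a 2 * glam K a 0 * β 0 - a 0 * glam K a 0 * β 2 - a 1 * glam K a 1 * β 2 +
        a 2 * glam K a 1 * β 1 := fun a _ => by simp [ned]; ring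
    rw [Finset.sum_congr rfl this]
    simp only [Finset.sum_add_distrib, Finset.sum_sub_distrib, ← Finset.sum_mul, hs, h]
    simp; ring

/-! ### Meshes -/

namespace TetMesh

variable {Ω : Set E3} (T : TetMesh Ω)

theorem conforming : Conforming T.cells :=
  ⟨fun K hK => ⟨T.card_cell K hK, T.indep K hK⟩, fun K hK L hL => by
    rw [T.inter K hK L hL, hull, Finset.coe_inter]⟩

theorem dom_cells (hΩ : IsLipschitzDomain Ω) : dom T.cells = Ω := by
  rw [dom, T.cover, hΩ.interior_closure]

/-- The tetrahedra that share the vertex `a`, as a finite set. -/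
def star (a : E3) : Finset (Finset E3) := T.cells.filter fun K => a ∈ K

theorem mem_star {a : E3} {K : Finset E3} : K ∈ T.star a ↔ K ∈ T.cells ∧ a ∈ K :=
  Finset.mem_filter

theorem conforming_star (a : E3) : Conforming (T.star a) :=
  T.conforming.mono (Finset.filter_subset _ _)

theorem patchDomain_eq (a : E3) : T.patchDomain a = dom (T.star a) := by
  unfold patchDomain dom patch
  simp only [mem_star, Set.mem_setOf_eq]

/-- The restrictions of the hat function to the tetrahedra. -/
def hatPiece (a : E3) (K : Finset E3) : E3 → ℝ := if a ∈ K then lam K a else fun _ => 0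

theorem hat_eq_hatPiece (a : E3) {K : Finset E3} (hK : K ∈ T.cells) {x : E3} (hx : x ∈ hull K) :
    T.hat a x = hatPiece a K x := by
  have hT := T.conforming.tet K hK
  have hb : T.IsBary x fun v => if v ∈ K then lam K v x else 0 := by
    refine ⟨K, hK, fun v hv => ?_, fun v hv => if_neg hv, ?_, ?_⟩
    · simp only [if_pos hv]; exact hT.mem_hull_iff.1 hx v hv
    · rw [← hT.sum_lam x]
      exact Finset.sum_congr rfl fun v hv => if_pos hv
    · conv_rhs => rw [← hT.sum_lam_smul x]
      exact Finset.sum_congr rfl fun v hv => by simp only [if_pos hv]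
  rw [T.hat_eq hb, hatPiece]
  split_ifs <;> rfl

theorem smoothPieces_hatPiece (a : E3) : SmoothPieces T.cells (hatPiece a) := fun K _ => by
  unfold hatPiece
  split_ifs
  · exact contDiff_lam K a
  · exact contDiff_const

theorem eqOnCells_hat (a : E3) : EqOnCells T.cells (T.hat a) (hatPiece a) := fun K hK =>
  (ae_restrict_iff' (measurableSet_hull K)).2 (Eventually.of_forall fun _ hx =>
    T.hat_eq_hatPiece a hK hx)

theorem hatPiece_agree (a : E3) {K L : Finset E3} (hK : K ∈ T.cells) (hL : L ∈ T.cells) {x : E3}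
    (hxK : x ∈ hull K) (hxL : x ∈ hull L) : hatPiece a K x = hatPiece a L x := by
  rw [← T.hat_eq_hatPiece a hK hxK, T.hat_eq_hatPiece a hL hxL]

theorem weakGrad_hat (hΩ : IsLipschitzDomain Ω) (a : E3) {K : Finset E3} (hK : K ∈ T.cells)
    (ha : a ∈ K) : ∀ᵐ x ∂(volume.restrict (hull K)), weakGrad Ω (T.hat a) x = glam K a := by
  have hS := T.conforming
  have h1 := hS.hasWeakGrad_of_faceAgree (T.smoothPieces_hatPiece a) (T.eqOnCells_hat a)
    (hS.eqOnCells_glue _) (hS.faceAgree_of_agree fun K hK L hL x => T.hatPiece_agree a hK hL)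
  have h2 := hS.eqOnCells_grad (T.smoothPieces_hatPiece a) (T.eqOnCells_hat a)
    (MemH1.hasWeakGrad ⟨_, h1⟩) K hK
  rw [T.dom_cells hΩ] at h2
  filter_upwards [h2] with x hx
  rw [hx, hatPiece, if_pos ha, lam_eq_aff, grad_aff]

/-! ### The boundary partition -/

theorem isBoundaryFace_erase (hΩ : IsLipschitzDomain Ω) {K : Finset E3} (hK : K ∈ T.cells) {b : E3}
    (hb : b ∈ K) (ho : IsOuter T.cells K b) : T.IsBoundaryFace (K.erase b) := by
  refine ⟨by rw [Finset.card_erase_of_mem hb, T.card_cell K hK], ⟨K, hK, Finset.erase_subset b K⟩,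
    ?_⟩
  have := T.conforming.hull_erase_subset_frontier hK hb ho
  rwa [T.dom_cells hΩ] at this

variable {T}

theorem IsBoundaryFace.exists_erase {F : Finset E3} (hF : T.IsBoundaryFace F) :
    ∃ K ∈ T.cells, ∃ b ∈ K, F = K.erase b := by
  obtain ⟨h3, ⟨K, hK, hFK⟩, -⟩ := hF
  obtain ⟨b, hb, hbF⟩ : ∃ b ∈ K, b ∉ F := by
    by_contra! hcon
    have := Finset.card_le_card hcon
    rw [T.card_cell K hK, h3] at this
    omega
  refine ⟨K, hK, b, hb, Finset.eq_of_subset_of_card_le (fun v hv => Finset.mem_erase.2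
    ⟨?_, hFK hv⟩) (by rw [Finset.card_erase_of_mem hb, T.card_cell K hK, h3])⟩
  rintro rfl; exact hbF hv

variable {ΓD ΓN : Set E3}

theorem IsBoundaryPartition.measurableSet (hΓ : T.IsBoundaryPartition ΓD ΓN) :
    MeasurableSet ΓD := by
  obtain ⟨U, hU, rfl⟩ := hΓ.openD
  exact hU.measurableSet.inter isClosed_frontier.measurableSet

theorem IsBoundaryPartition.subset_frontier (hΓ : T.IsBoundaryPartition ΓD ΓN) :
    ΓD ⊆ frontier Ω := by
  obtain ⟨U, hU, rfl⟩ := hΓ.openD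
  exact Set.inter_subset_right

/-- Relative openness of `ΓD` upgrades disjointness from `ΓN` to disjointness from its closure. -/
theorem IsBoundaryPartition.disjoint_closure (hΓ : T.IsBoundaryPartition ΓD ΓN) :
    Disjoint (closure ΓN) ΓD := by
  obtain ⟨U, hU, hUD⟩ := hΓ.openD
  obtain ⟨V, -, hVN⟩ := hΓ.openN
  rw [Set.disjoint_left]
  intro x hxN hxD
  rw [hUD] at hxD
  obtain ⟨y, hyU, hyN⟩ := mem_closure_iff.1 hxN U hU hxD.1
  refine Set.disjoint_left.1 hΓ.disj ?_ hyN
  rw [hUD]; rw [hVN] at hyN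
  exact ⟨hyU, hyN.2⟩

theorem IsBoundaryPartition.face_cases (hΓ : T.IsBoundaryPartition ΓD ΓN)
    {F : Finset E3} (hF : T.IsBoundaryFace F) : hull F ⊆ closure ΓD ∨ Disjoint (hull F) ΓD :=
  (hΓ.faces F hF).imp_right fun h => hΓ.disjoint_closure.mono_left h

end TetMesh

/-- The boundary is flat near a point in the relative interior of an outer face. -/
theorem Conforming.eventually_mem_openFace_of_frontier {S : Finset (Finset E3)} (hS : Conforming S)
    {K : Finset E3} (hK : K ∈ S) {b : E3} (hb : b ∈ K) (ho : IsOuter S K b) {x : E3}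
    (hx : x ∈ openFace K (K.erase b)) :
    ∀ᶠ y in 𝓝 x, y ∈ frontier (dom S) → y ∈ openFace K (K.erase b) := by
  filter_upwards [(hS.eventually_mem_dom_iff hK hb ho hx).eventually_nhds, eventually_lam_pos hx.1]
    with y hy hyK hyf
  refine ⟨hyK, fun v hv hvb => ?_⟩
  have : v = b := by by_contra hne; exact hvb (Finset.mem_erase.2 ⟨hne, hv⟩)
  rw [this]
  rw [(isOpen_dom S).frontier_eq] at hyf
  refine le_antisymm (not_lt.1 fun h => hyf.2 (hy.self_of_nhds.2 h)) (not_lt.1 fun h => ?_)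
  have h1 : ∀ᶠ z in 𝓝 y, z ∉ dom S := by
    filter_upwards [hy, (continuous_lam K b).continuousAt.eventually (gt_mem_nhds h)] with z hz hz0
    rw [hz]; exact not_lt.2 hz0.le
  obtain ⟨z, hz, hzd⟩ := mem_closure_iff_nhds.1 hyf.1 _ h1
  exact hz hzd

namespace TetMesh

variable {Ω : Set E3} (T : TetMesh Ω) {ΓD ΓN : Set E3}

/-- Inclusion in the closure of `ΓD` only gives points of `ΓD` nearby, but near the relative
interior of an outer face the boundary consists of that face alone. -/
theorem exists_openFace_inter (hΩ : IsLipschitzDomain Ω) (hΓ : T.IsBoundaryPartition ΓD ΓN)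
    {K : Finset E3} (hK : K ∈ T.cells) {b : E3} (hb : b ∈ K) (ho : IsOuter T.cells K b)
    (hF : hull (K.erase b) ⊆ closure ΓD) : ∃ x ∈ openFace K (K.erase b), x ∈ ΓD := by
  have hS := T.conforming
  have hT := hS.tet K hK
  obtain ⟨x, hx⟩ := openFace_nonempty hT (Finset.erase_subset b K) (hT.erase_nonempty b)
  have h1 := hS.eventually_mem_openFace_of_frontier hK hb ho hx
  obtain ⟨y, hy, hyD⟩ := mem_closure_iff_nhds.1
    (hF (openFace_subset hT (Finset.erase_subset b K) hx)) _ h1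
  refine ⟨y, hy ?_, hyD⟩
  rw [T.dom_cells hΩ]
  exact hΓ.subset_frontier hyD

/-- `ΓD` need not contain the whole face. An affine quantity that vanishes at `x` and at a second
point of the segment to `y` also vanishes at `y`; this carries conditions from `ΓD` to the full
closed face. -/
theorem exists_lineMap_mem (hΩ : IsLipschitzDomain Ω) (hΓ : T.IsBoundaryPartition ΓD ΓN)
    {K : Finset E3} (hK : K ∈ T.cells) {b : E3} (hb : b ∈ K) (ho : IsOuter T.cells K b) {x y : E3}
    (hx : x ∈ openFace K (K.erase b)) (hxD : x ∈ ΓD) (hy : y ∈ hull (K.erase b)) :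
    ∃ t : ℝ, t ≠ 0 ∧ x + t • (y - x) ∈ openFace K (K.erase b) ∧ x + t • (y - x) ∈ ΓD := by
  obtain ⟨U, hU, hUD⟩ := hΓ.openD
  have hT := T.conforming.tet K hK
  rw [hUD] at hxD
  obtain ⟨t, ht1, ht0, ht2⟩ := (((tendsto_lineMap_zero x y).eventually (hU.mem_nhds hxD.1)).and
    (Ioo_mem_nhdsGT (zero_lt_one : (0 : ℝ) < 1))).exists
  have hmem := openFace_lineMap hT (Finset.erase_subset b K) hx hy ht0.le ht2
  refine ⟨t, ht0.ne', hmem, ?_⟩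
  rw [hUD]
  refine ⟨ht1, ?_⟩
  have := T.conforming.openFace_subset_frontier hK hb ho hmem
  rwa [T.dom_cells hΩ] at this

end TetMesh

theorem aff_lineMap (c : ℝ) (d x y : E3) (t : ℝ) :
    aff c d (x + t • (y - x)) = (1 - t) * aff c d x + t * aff c d y := by
  simp only [aff, inner_add_right, inner_smul_right, inner_sub_right]; ring

theorem cross_inner_triple (g C d : E3) : inner ℝ (cross g C) d = -inner ℝ C (cross g d) := by
  simp [inner_three]; ring

theorem smoothPieces_aff (S : Finset (Finset E3)) (c : Finset E3 → ℝ) (d : Finset E3 → E3) :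
    SmoothPieces S fun K => aff (c K) (d K) := fun _ _ => contDiff_aff _ _

theorem Conforming.integrableOn_inner {S : Finset (Finset E3)} (hS : Conforming S) {j : E3 → E3}
    (hj : MemL2 (dom S) j) {K : Finset E3} (hK : K ∈ S) {f : E3 → E3} (hf : Continuous f) :
    IntegrableOn (fun x => inner ℝ (j x) (f x)) (hull K) := by
  have h1 : MemL2 (interior (hull K)) j :=
    MemLp.mono_measure (Measure.restrict_mono (interior_hull_subset_dom hK) le_rfl) hj
  unfold MemL2 at h1
  rw [Measure.restrict_congr_set (interior_hull_ae_eq K)] at h1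
  exact h1.integrable_inner_two (memL2_of_continuousOn hf.continuousOn)

theorem Conforming.setIntegral_dom_eq_sum {S : Finset (Finset E3)} (hS : Conforming S) {f : E3 → ℝ}
    {g : Finset E3 → E3 → ℝ} (hg : ∀ K ∈ S, IntegrableOn (g K) (hull K)) (h : EqOnCells S f g) :
    ∫ x in dom S, f x = ∑ K ∈ S, ∫ x in hull K, g K x := by
  have hf : IntegrableOn f (dom S) := (integrableOn_finset_iUnion.2 fun K hK =>
    (hg K hK).congr ((h K hK).mono fun x hx => hx.symm)).mono_set (dom_subset S)
  rw [hS.setIntegral_dom hf]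
  exact Finset.sum_congr rfl fun K hK => integral_congr_ae (h K hK)

/-- Scalar products on the domain as sums over the tetrahedra. -/
theorem Conforming.ip_eq_sum {S : Finset (Finset E3)} (hS : Conforming S) {j v : E3 → E3}
    (hj : MemL2 (dom S) j) {f : Finset E3 → E3 → E3} (hf : ∀ K ∈ S, Continuous (f K))
    (hv : EqOnCells S v f) :
    ip (dom S) j v = ∑ K ∈ S, ∫ x in hull K, inner ℝ (j x) (f K x) :=
  hS.setIntegral_dom_eq_sum (fun K hK => hS.integrableOn_inner hj hK (hf K hK)) fun K hK =>
    (hv K hK).mono fun x hx => by simp only [hx]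

namespace TetMesh

variable {Ω : Set E3} (T : TetMesh Ω) {ΓD ΓN : Set E3} {a : E3} {c : Finset E3 → ℝ}
  {d : Finset E3 → E3}

theorem sum_star {a : E3} (f : Finset E3 → ℝ) :
    ∑ K ∈ T.star a, f K = ∑ K ∈ T.cells, if a ∈ K then f K else 0 :=
  Finset.sum_filter _ _

/-- Agreement of the pieces of a piecewise function on the patch of `a`. -/
def PatchAgree (a : E3) (f : Finset E3 → E3 → ℝ) : Prop :=
  ∀ K ∈ T.star a, ∀ L ∈ T.star a, ∀ x ∈ hull K, x ∈ hull L → f K x = f L x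

variable {T}

theorem patchAgree_of_faceAgree (hΩ : IsLipschitzDomain Ω)
    (h : FaceAgree (T.star a) fun K => aff (c K) (d K)) :
    T.PatchAgree a fun K => aff (c K) (d K) := by
  intro K hK L hL x hxK hxL
  rw [mem_star] at hK hL
  refine T.conforming.affine_agree (T.dom_cells hΩ |>.symm ▸ hΩ) ?_ hK.1 hL.1 hK.2 hL.2 hxK hxL
  intro M hM N hN haM haN b hb hsub v hv
  by_cases hne : M = N
  · rw [hne]
  · obtain ⟨e, he, -, hMN⟩ := T.conforming.exists_erase_eq hM hN hne hb hsub
    exact h M (T.mem_star.2 ⟨hM, haM⟩) N (T.mem_star.2 ⟨hN, haN⟩) hne b hb e he hMN v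
      (mem_hull_of_mem hv)

theorem isOuter_star {K : Finset E3} {b : E3} (ho : IsOuter T.cells K b) :
    IsOuter (T.star a) K b := fun L hL => ho L (T.mem_star.1 hL).1

/-- Near a point of `ΓD` in the relative interior of the face, the boundary of the patch is this
face and is contained in `gammaD`, so the trace condition becomes pointwise. Affinity extends it to
the whole face. -/
theorem eq_zero_of_gammaD (hΩ : IsLipschitzDomain Ω) (hΓ : T.IsBoundaryPartition ΓD ΓN) {q : E3 → ℝ}
    (hq : EqOnCells (T.star a) q fun K => aff (c K) (d K))
    (hq0 : MemH1Zero (dom (T.star a)) (T.gammaD ΓD a) q) {K : Finset E3} (hK : K ∈ T.cells) {b : E3}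
    (hb : b ∈ K) (haF : a ∈ K.erase b) (ho : IsOuter T.cells K b)
    (hF : hull (K.erase b) ⊆ closure ΓD) {x : E3} (hx : x ∈ hull (K.erase b)) :
    aff (c K) (d K) x = 0 := by
  have hKs : K ∈ T.star a := T.mem_star.2 ⟨hK, Finset.mem_of_mem_erase haF⟩
  obtain ⟨U, hU, hUD⟩ := id hΓ.openD
  have key : ∀ y ∈ openFace K (K.erase b), y ∈ ΓD → aff (c K) (d K) y = 0 := by
    intro y hy hyD
    have hev := (T.conforming_star a).eventually_mem_openFace_of_frontier hKs hb
      (isOuter_star ho) hy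
    rw [hUD] at hyD
    refine (T.conforming_star a).eq_zero_of_memH1Zero (smoothPieces_aff _ c d) hq hq0 hKs hb
      (isOuter_star ho) hy (inter_mem (hU.mem_nhds hyD.1) hev) ?_
    rintro z ⟨⟨hzU, hz⟩, hzf⟩
    have hzo := hz hzf
    have hzf' := T.conforming.openFace_subset_frontier hK hb ho hzo
    rw [T.dom_cells hΩ] at hzf'
    refine ⟨hUD ▸ ⟨hzU, hzf'⟩, Set.mem_iUnion₂.2 ⟨K.erase b,
      ⟨T.isBoundaryFace_erase hΩ hK hb ho, haF, hF⟩,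
      openFace_subset (T.conforming.tet K hK) (Finset.erase_subset b K) hzo⟩⟩
  obtain ⟨y, hy, hyD⟩ := T.exists_openFace_inter hΩ hΓ hK hb ho hF
  obtain ⟨t, ht, h1, h2⟩ := T.exists_lineMap_mem hΩ hΓ hK hb ho hy hyD hx
  have h3 := key _ h1 h2
  rw [aff_lineMap, key y hy hyD, mul_zero, zero_add] at h3
  exact (mul_eq_zero.1 h3).resolve_left ht

/-- The pieces vanish on the boundary faces at `a` on the Dirichlet part. -/
def VanishesOn (T : TetMesh Ω) (ΓD : Set E3) (a : E3) (f : Finset E3 → E3 → ℝ) : Prop :=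
  ∀ K ∈ T.cells, ∀ b ∈ K, a ∈ K.erase b → IsOuter T.cells K b → ¬Disjoint (hull (K.erase b)) ΓD →
    ∀ x ∈ hull (K.erase b), f K x = 0

/-- A boundary face at `a` that meets `ΓD` lies in its closure, and so does `a`. Hence the Dirichlet
alternative of the local space applies whenever there is something to prove. -/
theorem vanishesOn_of_memH1Star (hΩ : IsLipschitzDomain Ω) (hΓ : T.IsBoundaryPartition ΓD ΓN)
    {q : E3 → ℝ} (hq : EqOnCells (T.star a) q fun K => aff (c K) (d K))
    (hq0 : T.MemH1Star ΓD a q) : T.VanishesOn ΓD a fun K => aff (c K) (d K) := by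
  intro K hK b hb haF ho hdisj x hx
  have hF := (hΓ.face_cases (T.isBoundaryFace_erase hΩ hK hb ho)).resolve_right hdisj
  have h0 := hq0.1 (hF (mem_hull_of_mem haF))
  rw [T.patchDomain_eq] at h0
  exact eq_zero_of_gammaD hΩ hΓ hq h0 hK hb haF ho hF hx

theorem MemH1Star.hasWeakGrad {q : E3 → ℝ} (hq : T.MemH1Star ΓD a q) :
    HasWeakGrad (dom (T.star a)) q (weakGrad (dom (T.star a)) q) := by
  rw [← T.patchDomain_eq]
  by_cases ha : a ∈ closure ΓD
  · obtain ⟨g, hg, -⟩ := hq.1 ha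
    exact hg.1.hasWeakGrad
  · exact (hq.2 ha).1.hasWeakGrad

theorem MemPolyPatch.exists_aff {q : E3 → ℝ} (hq : T.MemPolyPatch 1 a q) :
    ∃ (c : Finset E3 → ℝ) (d : Finset E3 → E3),
      EqOnCells (T.star a) q fun K => aff (c K) (d K) := by
  have : ∀ K, ∃ (c : ℝ) (d : E3), K ∈ T.star a →
      ∀ᵐ x ∂(volume.restrict (hull K)), q x = aff c d x := by
    intro K
    by_cases hK : K ∈ T.star a
    · obtain ⟨P, hP, h⟩ := hq.2 K (T.mem_star.1 hK)
      obtain ⟨c, d, hcd⟩ := exists_polyEval_eq_aff hP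
      exact ⟨c, d, fun _ => hcd ▸ h⟩
    · exact ⟨0, 0, fun h => absurd h hK⟩
  choose c d h using this
  exact ⟨c, d, h⟩

/-! ### The products of hat functions and affine functions -/

/-- The extension by zero is continuous because the hat function vanishes on common points with
cells that do not contain `a`. On the Dirichlet boundary, it vanishes on the faces opposite to `a`,
and the affine factor on the faces at `a`. -/
theorem memH1Zero_hat_mul (hΓ : T.IsBoundaryPartition ΓD ΓN)
    (hΩ : IsLipschitzDomain Ω) (hagree : T.PatchAgree a fun K => aff (c K) (d K))
    (hvan : T.VanishesOn ΓD a fun K => aff (c K) (d K)) :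
    ∃ u, MemH1Zero Ω ΓD u ∧ EqOnCells T.cells (weakGrad Ω u) fun K x =>
      if a ∈ K then lam K a x • d K + aff (c K) (d K) x • glam K a else 0 := by
  have hS := T.conforming
  set f : Finset E3 → E3 → ℝ := fun K x => hatPiece a K x * aff (c K) (d K) x with hf
  have hfs : SmoothPieces T.cells f := fun K hK =>
    (T.smoothPieces_hatPiece a K hK).mul (contDiff_aff _ _)
  have hfa : ∀ K ∈ T.cells, ∀ L ∈ T.cells, ∀ x ∈ hull K, x ∈ hull L → f K x = f L x := by
    intro K hK L hL x hxK hxL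
    have h1 := T.hatPiece_agree a hK hL hxK hxL
    simp only [hf]
    by_cases haK : a ∈ K
    · by_cases haL : a ∈ L
      · have h2 : aff (c K) (d K) x = aff (c L) (d L) x :=
          hagree K (T.mem_star.2 ⟨hK, haK⟩) L (T.mem_star.2 ⟨hL, haL⟩) x hxK hxL
        rw [h1, h2]
      · have h0 : hatPiece a L x = 0 := by rw [hatPiece, if_neg haL]
        rw [h1, h0]; simp
    · have h0 : hatPiece a K x = 0 := by rw [hatPiece, if_neg haK]
      rw [← h1, h0]; simp
  have hu := hS.eqOnCells_glue f
  refine ⟨glue T.cells f, ?_, ?_⟩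
  · have := hS.memH1Zero_of_agree hfs hu hfa hΓ.measurableSet ?_
    · rwa [T.dom_cells hΩ] at this
    · intro K hK b hb ho x hx hxD
      have hxF := openFace_subset (hS.tet K hK) (Finset.erase_subset b K) hx
      simp only [hf, hatPiece]
      split_ifs with haK
      · by_cases hba : a = b
        · rw [hba, hx.2 b hb (by simp), zero_mul]
        · have := hvan K hK b hb (Finset.mem_erase.2 ⟨hba, haK⟩) ho
            (fun h => Set.disjoint_left.1 h hxF hxD) x hxF
          simp only at this
          rw [this, mul_zero]
      · exact zero_mul _
  · have h1 := hS.hasWeakGrad_of_faceAgree hfs hu (hS.eqOnCells_glue _) (hS.faceAgree_of_agree hfa)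
    have h2 := hS.eqOnCells_grad hfs hu (MemH1.hasWeakGrad ⟨_, h1⟩)
    rw [T.dom_cells hΩ] at h2
    refine fun K hK => (h2 K hK).mono fun x hx => ?_
    rw [hx]
    ext i
    rw [grad_apply]
    simp only [hf, hatPiece]
    split_ifs with haK
    · rw [pderiv_mul ((contDiff_lam K a).diffAt x) ((contDiff_aff _ _).diffAt x), pderiv_aff,
        lam_eq_aff, pderiv_aff]
      simp only [PiLp.add_apply, PiLp.smul_apply, smul_eq_mul]
      ring
    · simp [pderiv_const]

/-- The pieces of the field `ψ ∇q - q ∇ψ`, with `ψ` the hat function of `a`. -/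
def whitney (a : E3) (c : Finset E3 → ℝ) (d : Finset E3 → E3) (K : Finset E3) : E3 → E3 :=
  if a ∈ K then
    ned (lam K a 0 • d K - c K • glam K a) (cross (d K) (glam K a))
  else ned 0 0

theorem whitney_of_mem {K : Finset E3} (ha : a ∈ K) (x : E3) :
    whitney a c d K x = lam K a x • d K - aff (c K) (d K) x • glam K a := by
  rw [whitney, if_pos ha, lam_eq_aff K a, aff_smul_sub]
  simp [aff]

theorem whitney_of_notMem {K : Finset E3} (ha : a ∉ K) (x : E3) : whitney a c d K x = 0 := by
  rw [whitney, if_neg ha]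
  apply ext_three <;> simp [ned]

theorem smoothFields_whitney (S : Finset (Finset E3)) : SmoothFields S (whitney a c d) :=
  fun K _ => by
    unfold whitney
    split_ifs <;> exact smoothField_ned _ _

theorem curl_whitney (K : Finset E3) (x : E3) :
    curl (whitney a c d K) x = if a ∈ K then (2 : ℝ) • cross (glam K a) (d K) else 0 := by
  unfold whitney
  split_ifs
  · rw [curl_ned]
    apply ext_three <;> simp <;> ring
  · rw [curl_ned, smul_zero]

/-- The tangential component at `x` along `u - v` depends only on the values of the hat function and
of `q` at `x`, `u` and `v`. Continuity of these two functions thus gives tangential continuity, and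
their zeros on a face give the boundary condition. -/
theorem inner_whitney {K : Finset E3} (x u v : E3) :
    inner ℝ (whitney a c d K x) u - inner ℝ (whitney a c d K x) v =
      hatPiece a K x * (aff (c K) (d K) u - aff (c K) (d K) v) -
        (if a ∈ K then aff (c K) (d K) x else 0) * (hatPiece a K u - hatPiece a K v) := by
  by_cases ha : a ∈ K
  · rw [whitney_of_mem ha]
    simp only [hatPiece, if_pos ha]
    rw [lam_eq K a u, lam_eq K a v]
    simp only [inner_sub_left, inner_smul_left, aff, RCLike.conj_to_real]
    ring
  · rw [whitney_of_notMem ha]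
    simp [hatPiece, if_neg ha]

theorem tangAgree_whitney (hagree : T.PatchAgree a fun K => aff (c K) (d K)) :
    TangAgree T.cells (whitney a c d) := by
  have hS := T.conforming
  intro K hK L hL hne b hb e he hLK x hx
  rw [(hS.tet K hK).cross_glam_eq_zero_iff hb]
  intro u hu v hv hub hvb
  have hF : ∀ {y}, y ∈ hull (K.erase b) → y ∈ hull K ∧ y ∈ hull L := fun hy =>
    ⟨hull_mono (Finset.erase_subset b K) hy, hull_mono (hLK ▸ Finset.erase_subset e L) hy⟩
  have hu' : u ∈ hull (K.erase b) := mem_hull_of_mem (Finset.mem_erase.2 ⟨hub, hu⟩)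
  have hv' : v ∈ hull (K.erase b) := mem_hull_of_mem (Finset.mem_erase.2 ⟨hvb, hv⟩)
  have hhat : ∀ {y}, y ∈ hull (K.erase b) → hatPiece a K y = hatPiece a L y := fun hy =>
    T.hatPiece_agree a hK hL (hF hy).1 (hF hy).2
  have h1 := inner_whitney (a := a) (c := c) (d := d) (K := K) x u v
  have h2 := inner_whitney (a := a) (c := c) (d := d) (K := L) x u v
  have h3 : inner ℝ (whitney a c d K x) u - inner ℝ (whitney a c d K x) v =
      inner ℝ (whitney a c d L x) u - inner ℝ (whitney a c d L x) v := by
    by_cases haK : a ∈ K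
    · by_cases haL : a ∈ L
      · have hq : ∀ {y}, y ∈ hull (K.erase b) → aff (c K) (d K) y = aff (c L) (d L) y := fun hy =>
          hagree K (T.mem_star.2 ⟨hK, haK⟩) L (T.mem_star.2 ⟨hL, haL⟩) _ (hF hy).1 (hF hy).2
        rw [h1, h2, hhat hx, hhat hu', hhat hv', if_pos haK, if_pos haL, hq hx, hq hu', hq hv']
      · have h0 : ∀ y, hatPiece a L y = 0 := fun y => by rw [hatPiece, if_neg haL]
        rw [h1, h2, hhat hx, hhat hu', hhat hv', h0, h0, h0]; ring
    · have h0 : ∀ y, hatPiece a K y = 0 := fun y => by rw [hatPiece, if_neg haK]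
      rw [h1, h2, ← hhat hx, ← hhat hu', ← hhat hv', h0, h0, h0]; ring
  rw [inner_sub_left, inner_sub_left]
  linarith

/-- On an outer face of a cell at `a` that meets `ΓD`, the hat function vanishes if the face is
opposite to `a`, and `q` vanishes otherwise. -/
theorem memHcurlZero_whitney (hΓ : T.IsBoundaryPartition ΓD ΓN) (hΩ : IsLipschitzDomain Ω)
    (hagree : T.PatchAgree a fun K => aff (c K) (d K))
    (hvan : T.VanishesOn ΓD a fun K => aff (c K) (d K)) {v : E3 → E3}
    (hv : EqOnCells T.cells v (whitney a c d)) : MemHcurlZero Ω ΓD v := by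
  have hS := T.conforming
  rw [← T.dom_cells hΩ]
  refine hS.memHcurlZero_of_tangAgree (smoothFields_whitney _) hv (tangAgree_whitney hagree) ?_
  intro K hK b hb ho
  rw [or_iff_not_imp_right]
  intro hdisj x hx
  have hdisj' : ¬Disjoint (hull (K.erase b)) ΓD := fun h =>
    hdisj (h.mono_left (openFace_subset (hS.tet K hK) (Finset.erase_subset b K)))
  rw [(hS.tet K hK).cross_glam_eq_zero_iff hb]
  intro u hu v hv hub hvb
  have hu' : u ∈ hull (K.erase b) := mem_hull_of_mem (Finset.mem_erase.2 ⟨hub, hu⟩)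
  have hv' : v ∈ hull (K.erase b) := mem_hull_of_mem (Finset.mem_erase.2 ⟨hvb, hv⟩)
  rw [← sub_eq_zero, inner_whitney]
  by_cases haK : a ∈ K
  · by_cases hab : a = b
    · have h0 : ∀ {y}, y ∈ hull (K.erase b) → hatPiece a K y = 0 := fun hy => by
        rw [hatPiece, if_pos haK, hab]
        exact (((hS.tet K hK).mem_hull_subset_iff (Finset.erase_subset b K)).1 hy).2 b hb (by simp)
      rw [h0 hx, h0 hu', h0 hv']; ring
    · have h0 := hvan K hK b hb (Finset.mem_erase.2 ⟨hab, haK⟩) ho hdisj'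
      simp only at h0
      rw [if_pos haK, h0 x hx, h0 u hu', h0 v hv']; ring
  · have h0 : ∀ y, hatPiece a K y = 0 := fun y => by rw [hatPiece, if_neg haK]
    rw [h0, h0, h0]; ring

end TetMesh

/-- Lowest-order Nédélec fields are affine, so barycentric interpolation of their vertex values
reproduces them. -/
theorem IsTet.sum_lam_smul_ned {K : Finset E3} (hK : IsTet K) (α β x : E3) :
    ∑ a ∈ K, lam K a x • ned α β a = ned α β x := by
  have h1 := hK.sum_lam x
  have h2 : ∀ i, ∑ a ∈ K, lam K a x * a i = x i := fun i => by
    have := congrArg (fun v : E3 => v i) (hK.sum_lam_smul x)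
    simpa using this
  have key : ∀ (i : Fin 3) (c : ℝ) (d : E3), (∀ y, ned α β y i = aff c d y) →
      (∑ a ∈ K, lam K a x • ned α β a) i = ned α β x i := by
    intro i c d h
    simp only [WithLp.ofLp_sum, Finset.sum_apply, PiLp.smul_apply, smul_eq_mul, h, aff, inner_three]
    rw [← h2 0, ← h2 1, ← h2 2]
    conv_rhs => rw [← mul_one c, ← h1]
    simp only [Finset.mul_sum, ← Finset.sum_add_distrib]
    exact Finset.sum_congr rfl fun a _ => by ring
  have h := ned_apply α β
  exact ext_three (key 0 _ _ fun y => (h y).1) (key 1 _ _ fun y => (h y).2.1)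
    (key 2 _ _ fun y => (h y).2.2)

theorem cross_ned_lineMap (g α β x y : E3) (t : ℝ) :
    cross g (ned α β (x + t • (y - x))) =
      (1 - t) • cross g (ned α β x) + t • cross g (ned α β y) := by
  apply ext_three <;> simp [ned] <;> ring

theorem integral_inner_sum {K : Finset E3} {j : E3 → E3} {s : Finset E3} {f : E3 → E3 → E3}
    (hf : ∀ a ∈ s, IntegrableOn (fun x => inner ℝ (j x) (f a x)) (hull K)) :
    ∑ a ∈ s, ∫ x in hull K, inner ℝ (j x) (f a x) =
      ∫ x in hull K, inner ℝ (j x) (∑ a ∈ s, f a x) := by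
  rw [← integral_finsetSum s hf]
  simp only [inner_sum]

/-! ### The two implications, as sums over the cells. -/

namespace TetMesh

variable {Ω : Set E3} {T : TetMesh Ω} {ΓD ΓN : Set E3} {a : E3} {c : Finset E3 → ℝ}
  {d : Finset E3 → E3} {j A : E3 → E3}

theorem integrableOn_inner (hΩ : IsLipschitzDomain Ω) (hj : MemL2 Ω j) {K : Finset E3}
    (hK : K ∈ T.cells) {f : E3 → E3} (hf : Continuous f) :
    IntegrableOn (fun x => inner ℝ (j x) (f x)) (hull K) := by
  rw [← T.dom_cells hΩ] at hj
  exact T.conforming.integrableOn_inner hj hK hf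

theorem ip_eq_sum (hΩ : IsLipschitzDomain Ω) (hj : MemL2 Ω j) {v : E3 → E3}
    {f : Finset E3 → E3 → E3} (hf : ∀ K ∈ T.cells, Continuous (f K)) (hv : EqOnCells T.cells v f) :
    ip Ω j v = ∑ K ∈ T.cells, ∫ x in hull K, inner ℝ (j x) (f K x) := by
  rw [← T.dom_cells hΩ] at hj
  rw [← T.conforming.ip_eq_sum hj hf hv, T.dom_cells hΩ]

theorem eqOnCells_weakCurl (hΩ : IsLipschitzDomain Ω) {v : E3 → E3} {w : Finset E3 → E3 → E3}
    (hw : SmoothFields T.cells w) (hv : EqOnCells T.cells v w) (hvc : MemHcurl Ω v) :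
    EqOnCells T.cells (weakCurl Ω v) fun K => curl (w K) := by
  have := hvc.hasWeakCurl
  rw [← T.dom_cells hΩ] at this
  have h := T.conforming.eqOnCells_curl hw hv this
  rwa [T.dom_cells hΩ] at h

theorem memL2_of_eqOnCells (hΩ : IsLipschitzDomain Ω) {F : Type*} [NormedAddCommGroup F]
    [SecondCountableTopology F] {u : E3 → F} {f : Finset E3 → E3 → F}
    (hf : ∀ K ∈ T.cells, Continuous (f K)) (hu : EqOnCells T.cells u f) : MemL2 Ω u := by
  rw [← T.dom_cells hΩ]
  exact T.conforming.memL2_dom hf hu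

/-- The left-hand side of the orthogonality on the patch of `a`. -/
def patchForm (T : TetMesh Ω) (j A : E3 → E3) (a : E3) (q : E3 → ℝ) : ℝ :=
  ip (T.patchDomain a) (fun x => T.hat a x • j x) (weakGrad (T.patchDomain a) q) +
    ip (T.patchDomain a) (fun x => cross (weakGrad Ω (T.hat a) x) (weakCurl Ω A x))
      (weakGrad (T.patchDomain a) q)

theorem patchForm_eq_sum (hΩ : IsLipschitzDomain Ω) (hj : MemL2 Ω j) (hA : MemHcurl Ω A) {q : E3 → ℝ}
    (hq : EqOnCells (T.star a) q fun K => aff (c K) (d K))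
    (hg : HasWeakGrad (dom (T.star a)) q (weakGrad (dom (T.star a)) q)) :
    T.patchForm j A a q =
      ∑ K ∈ T.star a, ((∫ x in hull K, inner ℝ (j x) (lam K a x • d K)) -
        ∫ x in hull K, inner ℝ (weakCurl Ω A x) (cross (glam K a) (d K))) := by
  have hC := hA.hasWeakCurl.2.1
  have hg' := (T.conforming_star a).eqOnCells_grad (smoothPieces_aff _ c d) hq hg
  unfold patchForm ip
  rw [T.patchDomain_eq,
    (T.conforming_star a).setIntegral_dom_eq_sum (g := fun K x => inner ℝ (j x) (lam K a x • d K)),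
    (T.conforming_star a).setIntegral_dom_eq_sum
      (g := fun K x => -inner ℝ (weakCurl Ω A x) (cross (glam K a) (d K))),
    ← Finset.sum_add_distrib]
  · exact Finset.sum_congr rfl fun K _ => by rw [integral_neg, sub_eq_add_neg]
  · exact fun K hK => (integrableOn_inner hΩ hC (T.mem_star.1 hK).1
      continuous_const).neg
  · intro K hK
    obtain ⟨hKc, haK⟩ := T.mem_star.1 hK
    filter_upwards [hg' K hK, T.weakGrad_hat hΩ a hKc haK] with x h1 h2
    rw [h1, h2, grad_aff, cross_inner_triple]
  · exact fun K hK => integrableOn_inner hΩ hj (T.mem_star.1 hK).1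
      ((continuous_lam K a).smul continuous_const)
  · intro K hK
    obtain ⟨hKc, haK⟩ := T.mem_star.1 hK
    filter_upwards [hg' K hK, T.eqOnCells_hat a K hKc] with x h1 h2
    rw [h1, h2, grad_aff, hatPiece, if_pos haK, inner_smul_left, inner_smul_right]
    simp

theorem integral_weakDiv_mul {q : E3 → ℝ} (hj : weakDiv Ω j =ᵐ[volume.restrict Ω] 0) :
    ∫ x in Ω, weakDiv Ω j x * q x = 0 :=
  integral_eq_zero_of_ae (hj.mono fun x hx => by simp [hx])

/-- The Galerkin orthogonality implies the orthogonality on the patches. -/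
theorem patchForm_eq_zero (hΩ : IsLipschitzDomain Ω) (hΓ : T.IsBoundaryPartition ΓD ΓN)
    (hj : IsCurrentDensity Ω ΓD j) (hA : MemHcurl Ω A)
    (hgal : ∀ v, T.MemNedelec 0 v → MemHcurlZero Ω ΓD v →
      ip Ω (weakCurl Ω A) (weakCurl Ω v) = ip Ω j v) {q : E3 → ℝ} (hqP : T.MemPolyPatch 1 a q)
    (hq0 : T.MemH1Star ΓD a q) : T.patchForm j A a q = 0 := by
  have hS := T.conforming
  obtain ⟨c, d, hq⟩ := hqP.exists_aff
  have hg := hq0.hasWeakGrad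
  have hagree := patchAgree_of_faceAgree hΩ
    ((T.conforming_star a).faceAgree_of_hasWeakGrad (smoothPieces_aff _ c d) hq hg)
  have hvan := vanishesOn_of_memH1Star hΩ hΓ hq hq0
  have hjL : MemL2 Ω j := hj.1.1.choose_spec.1
  have hC : MemL2 Ω (weakCurl Ω A) := hA.hasWeakCurl.2.1
  rw [patchForm_eq_sum hΩ hjL hA hq hg]
  set P : Finset E3 → ℝ := fun K => ∫ x in hull K, inner ℝ (j x) (lam K a x • d K) with hP
  set Q : Finset E3 → ℝ := fun K => ∫ x in hull K, inner ℝ (j x) (aff (c K) (d K) x • glam K a)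
    with hQ
  set R : Finset E3 → ℝ := fun K =>
    ∫ x in hull K, inner ℝ (weakCurl Ω A x) (cross (glam K a) (d K)) with hR
  have hcP : ∀ K, Continuous fun x => lam K a x • d K := fun K =>
    (continuous_lam K a).smul continuous_const
  have hcQ : ∀ K, Continuous fun x => aff (c K) (d K) x • glam K a := fun K =>
    (contDiff_aff _ _).continuous.smul continuous_const
  have hiP := fun (K) (hK : K ∈ T.cells) => integrableOn_inner hΩ hjL hK (hcP K)
  have hiQ := fun (K) (hK : K ∈ T.cells) => integrableOn_inner hΩ hjL hK (hcQ K)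
  -- The current density is orthogonal to the gradient of the hat function times `q`.
  have e1 : ∑ K ∈ T.star a, (P K + Q K) = 0 := by
    obtain ⟨u, hu, hgu⟩ := memH1Zero_hat_mul hΓ hΩ hagree hvan
    have h1 := hj.1.2 u hu
    rw [integral_weakDiv_mul hj.2.1, add_zero, ip_eq_sum hΩ hjL (fun K _ => ?_) hgu] at h1
    · rw [← h1, T.sum_star]
      refine Finset.sum_congr rfl fun K hK => ?_
      split_ifs with ha
      · simp only [inner_add_right]
        exact (integral_add (hiP K hK) (hiQ K hK)).symm
      · simp
    · split_ifs
      · exact (hcP K).add (hcQ K)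
      · exact continuous_const
  -- The Galerkin identity for the field `ψ ∇q - q ∇ψ`; the factor `2` comes from its curl.
  have e2 : ∑ K ∈ T.star a, (2 * R K) = ∑ K ∈ T.star a, (P K - Q K) := by
    have hw := smoothFields_whitney (a := a) (c := c) (d := d) T.cells
    have hwc := fun K hK => (hw K hK).continuous
    have hv := hS.eqOnCells_glue (whitney a c d)
    have hv0 := memHcurlZero_whitney hΓ hΩ hagree hvan hv
    have h1 := hgal _ ⟨memL2_of_eqOnCells hΩ hwc hv, fun K hK => ?_⟩ hv0
    · rw [ip_eq_sum hΩ hjL hwc hv, ip_eq_sum hΩ hC (fun K hK => (hw K hK).continuous_curl)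
        (eqOnCells_weakCurl hΩ hw hv hv0.1)] at h1
      rw [T.sum_star, T.sum_star]
      refine Eq.trans (Finset.sum_congr rfl fun K hK => ?_) (h1.trans
        (Finset.sum_congr rfl fun K hK => ?_))
      · simp only [curl_whitney]
        split_ifs with ha
        · simp only [inner_smul_right]
          exact (integral_const_mul _ _).symm
        · simp
      · split_ifs with ha
        · simp only [whitney_of_mem ha, inner_sub_right]
          exact integral_sub (hiP K hK) (hiQ K hK)
        · simp [whitney_of_notMem ha]
    · have := hv K hK
      unfold whitney at this
      split_ifs at this <;> exact isNedelecOn_ned this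
  -- Adding both relations eliminates the terms with `q ∇ψ`.
  simp only [Finset.sum_add_distrib, Finset.sum_sub_distrib, ← Finset.mul_sum] at e1 e2 ⊢
  linarith

/-! ### The local test functions of a Nédélec field -/

theorem measurableSet_gammaD (hΓ : T.IsBoundaryPartition ΓD ΓN) (a : E3) :
    MeasurableSet (T.gammaD ΓD a) := by
  refine hΓ.measurableSet.inter (Set.Finite.measurableSet_biUnion ?_ fun F _ =>
    measurableSet_hull F)
  refine ((T.cells.biUnion Finset.powerset).finite_toSet).subset fun F hF => ?_
  obtain ⟨K, hK, hFK⟩ := hF.1.2.1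
  exact Finset.mem_biUnion.2 ⟨K, hK, Finset.mem_powerset.2 hFK⟩

/-- Turns compatible affine pieces into an admissible local function without changing the gradients,
which are all that the patch identity sees. -/
theorem exists_memH1Star (hΩ : IsLipschitzDomain Ω) (hΓ : T.IsBoundaryPartition ΓD ΓN)
    (ha : a ∈ T.vertices) (hagree : T.PatchAgree a fun K => aff (c K) (d K))
    (hvan : T.VanishesOn ΓD a fun K => aff (c K) (d K)) :
    ∃ (q : E3 → ℝ) (m : ℝ), T.MemPolyPatch 1 a q ∧ T.MemH1Star ΓD a q ∧
      EqOnCells (T.star a) q fun K => aff (c K - m) (d K) := by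
  have hS := T.conforming_star a
  set q₀ := glue (T.star a) fun K => aff (c K) (d K) with hq₀
  have h0 : EqOnCells (T.star a) q₀ fun K => aff (c K) (d K) := hS.eqOnCells_glue _
  -- The mean value, subtracted only where the local space prescribes mean zero; at Dirichlet
  -- vertices a shift would destroy the boundary values.
  set m : ℝ := if a ∈ closure ΓD then 0 else
    (∫ x in dom (T.star a), q₀ x) / volume.real (dom (T.star a)) with hm
  have hq : EqOnCells (T.star a) (fun x => q₀ x - m) fun K => aff (c K - m) (d K) :=
    fun K hK => (h0 K hK).mono fun x hx => by simp only [hx, aff]; ring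
  have hsm := smoothPieces_aff (T.star a) (fun K => c K - m) d
  have hqL := hS.memL2_dom (fun K hK => (hsm K hK).continuous) hq
  have hag : ∀ K ∈ T.star a, ∀ L ∈ T.star a, ∀ x ∈ hull K, x ∈ hull L →
      aff (c K - m) (d K) x = aff (c L - m) (d L) x := fun K hK L hL x hxK hxL => by
    have := hagree K hK L hL x hxK hxL
    simp only [aff] at this ⊢
    linarith
  refine ⟨_, m, ⟨by rwa [T.patchDomain_eq], fun K hK => isPolyOn_aff (hq K (T.mem_star.2 hK))⟩,
    ⟨fun haD => ?_, fun haD => ⟨?_, ?_⟩⟩, hq⟩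
  · have hm0 : m = 0 := if_pos haD
    rw [T.patchDomain_eq]
    refine hS.memH1Zero_of_agree hsm hq hag (measurableSet_gammaD hΓ a) ?_
    intro K hK b hb _ x hx hxΓ
    obtain ⟨hxD, hxF⟩ := hxΓ
    obtain ⟨F, ⟨hF, haF, hFD⟩, hxF⟩ := Set.mem_iUnion₂.1 hxF
    obtain ⟨L, hL, e, he, rfl⟩ := hF.exists_erase
    obtain ⟨hKc, haK⟩ := T.mem_star.1 hK
    -- An outer face of the patch need not lie on the boundary of `Ω`. Here `x` is in its relative
    -- interior and on a boundary face of the mesh, so the two faces coincide.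
    have hFK := T.conforming.erase_eq_of_mem hKc hL hb he hx hxF
    rw [hFK] at hxF hF haF
    have ho : IsOuter T.cells K b := fun M hM hsub => by
      by_contra hne
      have h1 := T.conforming.mem_dom_of_mem_openFace hKc hM (Ne.symm hne) hb hsub hx
      have h2 := hF.2.2 hxF
      rw [T.dom_cells hΩ] at h1
      rw [hΩ.1.frontier_eq] at h2
      exact h2.2 h1
    have := hvan K hKc b hb haF ho (fun h => Set.disjoint_left.1 h hxF hxD) x hxF
    rwa [hm0, sub_zero]
  · rw [T.patchDomain_eq]
    exact ⟨_, hS.hasWeakGrad_of_faceAgree hsm hq (hS.eqOnCells_glue _) (hS.faceAgree_of_agree hag)⟩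
  · have hm0 : m = (∫ x in dom (T.star a), q₀ x) / volume.real (dom (T.star a)) := if_neg haD
    obtain ⟨K, hK, haK⟩ := ha
    have hfin : IsFiniteMeasure (volume.restrict (dom (T.star a))) :=
      ⟨by simpa using volume_dom_lt_top (T.star a)⟩
    have hpos : volume.real (dom (T.star a)) ≠ 0 := by
      refine (ENNReal.toReal_pos (((isOpen_dom _).measure_pos volume ?_).ne')
        (volume_dom_lt_top _).ne).ne'
      exact (T.conforming.tet K hK).nonempty_interior.mono
        (interior_hull_subset_dom (T.mem_star.2 ⟨hK, haK⟩))
    have hq₀L := hS.memL2_dom (fun K _ => (contDiff_aff (c K) (d K)).continuous) h0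
    rw [T.patchDomain_eq, integral_sub (hq₀L.integrable (by norm_num)) (integrable_const m),
      integral_const, hm0]
    simp only [measureReal_restrict_apply_univ, smul_eq_mul]
    field_simp
    ring

variable {α β : Finset E3 → E3} {v : E3 → E3}

/-- The pieces are `v_K(a) · (x - a)`. At a common face through `a` the jump of `v(a)` is normal to
the face, hence orthogonal to `x - a`. -/
theorem patchAgree_ned (hΩ : IsLipschitzDomain Ω)
    (htan : TangAgree T.cells fun K => ned (α K) (β K)) :
    T.PatchAgree a fun K =>
      aff (-inner ℝ (ned (α K) (β K) a) a) (ned (α K) (β K) a) := by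
  have hS := T.conforming
  refine patchAgree_of_faceAgree hΩ ?_
  intro K hK L hL hne b hb e he hLK x hx
  obtain ⟨hKc, haK⟩ := T.mem_star.1 hK
  obtain ⟨hLc, haL⟩ := T.mem_star.1 hL
  have hab : a ≠ b := by
    rintro rfl
    exact hS.not_mem_of_erase_eq hLc hKc (Ne.symm hne) hb hLK.symm haL
  have haF : a ∈ hull (K.erase b) := mem_hull_of_mem (Finset.mem_erase.2 ⟨hab, haK⟩)
  obtain ⟨t, ht⟩ := exists_smul_of_cross_eq_zero ((hS.tet K hKc).glam_ne_zero hb)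
    (htan K hKc L hLc hne b hb e he hLK a haF)
  have hz : ∀ y ∈ hull (K.erase b), lam K b y = 0 := fun y hy =>
    (((hS.tet K hKc).mem_hull_subset_iff (Finset.erase_subset b K)).1 hy).2 b hb (by simp)
  have h1 : inner ℝ (ned (α K) (β K) a - ned (α L) (β L) a) (x - a) = 0 := by
    simp only at ht
    rw [ht, inner_smul_left, inner_glam_sub, hz x hx, hz a haF, sub_zero, mul_zero]
  rw [inner_sub_left, inner_sub_right, inner_sub_right] at h1
  simp only [aff]
  linarith

/-- On a Dirichlet face through `a` the vector `v_K(a)` is normal to the face, hence orthogonal to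
`x - a`. -/
theorem vanishesOn_ned (hΩ : IsLipschitzDomain Ω) (hΓ : T.IsBoundaryPartition ΓD ΓN)
    (hv : EqOnCells T.cells v fun K => ned (α K) (β K)) (hv0 : MemHcurlZero Ω ΓD v) :
    T.VanishesOn ΓD a fun K =>
      aff (-inner ℝ (ned (α K) (β K) a) a) (ned (α K) (β K) a) := by
  have hS := T.conforming
  intro K hK b hb haF ho hdisj x hx
  have hF := (hΓ.face_cases (T.isBoundaryFace_erase hΩ hK hb ho)).resolve_right hdisj
  obtain ⟨U, hU, hUD⟩ := id hΓ.openD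
  have key : ∀ y ∈ openFace K (K.erase b), y ∈ ΓD →
      cross (glam K b) (ned (α K) (β K) y) = 0 := fun y hy hyD => by
    refine hS.cross_eq_zero_of_memHcurlZero (w := fun K => ned (α K) (β K))
      (fun K _ => smoothField_ned _ _) hv hΓ.measurableSet (by rwa [T.dom_cells hΩ]) hK hb ho hy
      (hU.mem_nhds (hUD ▸ hyD : y ∈ U ∩ frontier Ω).1) ?_
    rw [T.dom_cells hΩ, ← hUD]
  obtain ⟨y, hy, hyD⟩ := T.exists_openFace_inter hΩ hΓ hK hb ho hF
  -- The vertex `a` may lie outside `ΓD`; the tangential trace is affine on the segment from `y` to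
  -- `a`, so its two zeros on the segment force a zero at `a`.
  obtain ⟨t, ht, h1, h2⟩ := T.exists_lineMap_mem hΩ hΓ hK hb ho hy hyD (mem_hull_of_mem haF)
  have h3 := key _ h1 h2
  rw [cross_ned_lineMap, key y hy hyD, smul_zero, zero_add] at h3
  obtain ⟨s, hs⟩ := exists_smul_of_cross_eq_zero ((hS.tet K hK).glam_ne_zero hb)
    ((smul_eq_zero.1 h3).resolve_left ht)
  have hz : ∀ y ∈ hull (K.erase b), lam K b y = 0 := fun y hy =>
    (((hS.tet K hK).mem_hull_subset_iff (Finset.erase_subset b K)).1 hy).2 b hb (by simp)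
  have h4 : inner ℝ (ned (α K) (β K) a) (x - a) = 0 := by
    rw [hs, inner_smul_left, inner_glam_sub, hz x hx, hz a (mem_hull_of_mem haF), sub_zero,
      mul_zero]
  rw [inner_sub_right] at h4
  simp only [aff]
  linarith

/-- The patch identity at `a` is used for the local function whose gradient on each cell `K` is the
value of `v` at `a` taken from `K`. Summed over the vertices, these constant gradients reproduce `v`
and its curl. -/
theorem ip_weakCurl_eq (hΩ : IsLipschitzDomain Ω) (hΓ : T.IsBoundaryPartition ΓD ΓN)
    (hj : MemL2 Ω j) (hA : MemHcurl Ω A)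
    (hpatch : ∀ a ∈ T.vertices, ∀ q, T.MemPolyPatch 1 a q → T.MemH1Star ΓD a q →
      T.patchForm j A a q = 0) (hvN : T.MemNedelec 0 v) (hv0 : MemHcurlZero Ω ΓD v) :
    ip Ω (weakCurl Ω A) (weakCurl Ω v) = ip Ω j v := by
  have hS := T.conforming
  have hC : MemL2 Ω (weakCurl Ω A) := hA.hasWeakCurl.2.1
  have : ∀ K, ∃ α β : E3, K ∈ T.cells → ∀ᵐ x ∂(volume.restrict (hull K)), v x = ned α β x := by
    intro K
    by_cases hK : K ∈ T.cells
    · obtain ⟨α, β, h⟩ := (hvN.2 K hK).exists_ned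
      exact ⟨α, β, fun _ => h⟩
    · exact ⟨0, 0, fun h => absurd h hK⟩
  choose α β hv using this
  have hv : EqOnCells T.cells v fun K => ned (α K) (β K) := hv
  have hw : SmoothFields T.cells fun K => ned (α K) (β K) := fun K _ => smoothField_ned _ _
  have htan : TangAgree T.cells fun K => ned (α K) (β K) :=
    hS.tangAgree_of_hasWeakCurl hw hv (T.dom_cells hΩ ▸ hv0.1.hasWeakCurl)
  have hsum : ∀ a ∈ T.vertices, ∑ K ∈ T.star a,
      ((∫ x in hull K, inner ℝ (j x) (lam K a x • ned (α K) (β K) a)) -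
        ∫ x in hull K, inner ℝ (weakCurl Ω A x) (cross (glam K a) (ned (α K) (β K) a))) = 0 := by
    intro a ha
    obtain ⟨q, m, hqP, hq0, hq⟩ := exists_memH1Star hΩ hΓ ha (patchAgree_ned hΩ htan)
      (vanishesOn_ned hΩ hΓ hv hv0)
    rw [← hpatch a ha q hqP hq0, patchForm_eq_sum hΩ hj hA hq hq0.hasWeakGrad]
  have h1 : ∑ K ∈ T.cells, ∑ a ∈ K,
      ((∫ x in hull K, inner ℝ (j x) (lam K a x • ned (α K) (β K) a)) -
        ∫ x in hull K, inner ℝ (weakCurl Ω A x) (cross (glam K a) (ned (α K) (β K) a))) = 0 := by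
    -- Summing over vertices and their patches is the same as summing over cells and their vertices.
    rw [Finset.sum_comm' (t' := T.cells.biUnion id) (s' := fun a => T.star a) fun K a => by
      simp only [mem_star, Finset.mem_biUnion, id]
      exact ⟨fun h => ⟨h, K, h⟩, fun h => h.1⟩]
    refine Finset.sum_eq_zero fun a ha => hsum a ?_
    obtain ⟨K, hK, haK⟩ := Finset.mem_biUnion.1 ha
    exact ⟨K, hK, haK⟩
  rw [ip_eq_sum hΩ hj (fun K hK => (hw K hK).continuous) hv,
    ip_eq_sum hΩ hC (fun K hK => (hw K hK).continuous_curl) (eqOnCells_weakCurl hΩ hw hv hv0.1),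
    eq_comm, ← sub_eq_zero, ← Finset.sum_sub_distrib, ← h1]
  refine Finset.sum_congr rfl fun K hK => ?_
  have hT := hS.tet K hK
  rw [Finset.sum_sub_distrib,
    integral_inner_sum (f := fun a x => lam K a x • ned (α K) (β K) a) fun a _ =>
      integrableOn_inner hΩ hj hK ((continuous_lam K a).smul continuous_const),
    integral_inner_sum (f := fun a _ => cross (glam K a) (ned (α K) (β K) a)) fun a _ =>
      integrableOn_inner hΩ hC hK continuous_const]
  -- On one cell the vertex contributions add up to the field itself and to its curl.
  simp only [hT.sum_lam_smul_ned, hT.sum_cross_glam_ned, curl_ned]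

end TetMesh

end MaxwellPatch

end

/-! ### The equivalence. -/

theorem mainTheorem8 (Ω : Set MaxwellPatch.E3) (hΩ : MaxwellPatch.IsLipschitzDomain Ω)
    (T : MaxwellPatch.TetMesh Ω) (ΓD ΓN : Set MaxwellPatch.E3)
    (hΓ : T.IsBoundaryPartition ΓD ΓN) (p : ℕ)
    (j : MaxwellPatch.E3 → MaxwellPatch.E3) (hj : MaxwellPatch.IsCurrentDensity Ω ΓD j)
    (A : MaxwellPatch.E3 → MaxwellPatch.E3) :
    T.IsDiscretePotential p ΓD j A ↔
      (T.MemNedelec p A ∧ MaxwellPatch.MemHcurlZero Ω ΓD A) ∧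
        ∀ a ∈ T.vertices, ∀ q : MaxwellPatch.E3 → ℝ,
          T.MemPolyPatch 1 a q → T.MemH1Star ΓD a q →
            MaxwellPatch.ip (T.patchDomain a) (fun x => T.hat a x • j x)
                (MaxwellPatch.weakGrad (T.patchDomain a) q) +
              MaxwellPatch.ip (T.patchDomain a)
                (fun x => MaxwellPatch.cross (MaxwellPatch.weakGrad Ω (T.hat a) x)
                  (MaxwellPatch.weakCurl Ω A x))
                (MaxwellPatch.weakGrad (T.patchDomain a) q) = 0 :=
  and_congr_right fun hA =>
    ⟨fun h _ _ _ hqP hq0 => MaxwellPatch.TetMesh.patchForm_eq_zero hΩ hΓ hj hA.2.1 h hqP hq0,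
      fun h _ hvN hv0 => MaxwellPatch.TetMesh.ip_weakCurl_eq hΩ hΓ hj.1.1.choose_spec.1 hA.2.1 h
        hvN hv0⟩
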